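/- **Setting.** Let $\mathbb C_+$ be the upper half-plane. Let $s_+:\mathbb R\to\mathbb C$ be measurable with $|s_+|\le 1$ and $s_+(\lambda)=\overline{s_+(-\lambda)}$ a.e., satisfying the Szegő condition $\int_{\mathbb R}\frac{\log(1-|s_+(\lambda)|^2)}{1+\lambda^2}\,d\lambda>-\infty$. Let $\Lambda=\{\lambda_k\}\subset i(0,\infty)$ satisfy the Blaschke condition $\sum_{\lambda_k/i\le1}\lambda_k/i<\infty$, $\sum_{\lambda_k/i>1}i/\lambda_k<\infty$, and let $\nu_+=\sum_k\nu_+(\lambda_k)\delta_{\lambda_k}$ with all $\nu_+(\lambda_k)>0$ ($\nu_+$ need not be finite). For such data $\{s,\nu\}$, $L^2_{s,\nu}$ is the space of (classes of) functions $f$ on $\mathbb R\cup\Lambda$, measurable on $\mathbb R$, with finite norm $$\|f\|^2_{s,\nu}=\sum_k|f(\lambda_k)|^2\nu(\lambda_k)+\frac1{4\pi}\int_{\mathbb R}\begin{bmatrix}\overline{f(\lambda)}&-\overline{f(-\lambda)}\end{bmatrix}\begin{bmatrix}1&\overline{s(\lambda)}\\ s(\lambda)&1\end{bmatrix}\begin{bmatrix}f(\lambda)\\-f(-\lambda)\end{bmatrix}d\lambda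 ,$$ with the corresponding scalar product. Let $s_e$ be the outer function in $\mathbb C_+$ with $|s_e|^2+|s|^2=1$ a.e. on $\mathbb R$, normalized to be positive on $i(0,\infty)$. Let $B=\prod_k b_{\lambda_k}$ with $b_{\lambda_k}(\lambda)=\pm\frac{\lambda-\lambda_k}{\lambda-\overline{\lambda_k}}$, the sign being $+$ if $\lambda_k/i\le1$ and $-$ otherwise. $H^2$ and $H^\infty$ are the standard Hardy spaces of $\mathbb C_+$, identified with their boundary functions. * $H^2_{s,\nu}$ is the closure in $L^2_{s,\nu}$ of the functions $B'g$ on $\mathbb R\cup\Lambda$, where $g\in H^\infty\cap H^2$ and $B'$ is a divisor of $B$ such that $B/B'$ is a finite Blaschke product. * $\hat H^2_{s,\nu}$ is the set of $f\in L^2_{s,\nu}$ such that $g:=s_ef|_{\mathbb R}$ belongs to $H^2$ and $f(\lambda_k)=(g/s_e)(\lambda_k)$ for all $\lambda_k\in\Lambda$, where $g$ and $s_e$ are continued analytically to $\mathbb C_+$. With $s_e$ the outer function of $s_+$, put $s=s_e/B$, $s_-=-\frac{s}{\bar s}\,\overline{s_+}$ on $\mathbb R$, and define $\nu_-$ on $\Lambda$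 by $\frac1{\nu_+(\lambda_k)\nu_-(\lambda_k)}=\left|\left(\frac1s\right)'(\lambda_k)\right|^2$. Functions $f^+$ and $f^-$ on $\mathbb R\cup\Lambda$ are called dual to each other if a.e. on $\mathbb R$ $$\begin{bmatrix}sf^+\\sf^-\end{bmatrix}(\lambda)=\begin{bmatrix}s&0\\s_+&1\end{bmatrix}(\lambda)\begin{bmatrix}f^+(\lambda)\\-f^+(-\lambda)\end{bmatrix}=\begin{bmatrix}1&s_-\\0&s\end{bmatrix}(\lambda)\begin{bmatrix}-f^-(-\lambda)\\f^-(\lambda)\end{bmatrix}$$ and $f^-(\lambda_k)=-i\left(\frac1s\right)'(\lambda_k)\,\nu_+(\lambda_k)f^+(\lambda_k)$ for all $\lambda_k\in\Lambda$. **Theorem.** The duality $f^+\leftrightarrow f^-$ defines a unitary map from $L^2_{s_+,\nu_+}$ onto $L^2_{s_-,\nu_-}$. If $f^+\in L^2_{s_+,\nu_+}\ominus H^2_{s_+,\nu_+}$, then the dual function $f^-$ belongs to $\hat H^2_{s_-,\nu_-}$. Moreover $$(\hat H^2_{s_-,\nu_-})^+=L^2_{s_+,\nu_+}\ominus H^2_{s_+,\nu_+},$$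 where the left-hand side is the set of all $f^+$ dual to some $f^-\in\hat H^2_{s_-,\nu_-}$. -/

import Mathlib

open Complex MeasureTheory Filter Set
open scoped Topology ComplexConjugate Matrix ENNReal

noncomputable section

/-! ### Hardy spaces of the upper half-plane -/

/-- The open upper half-plane, as a subset of `ℂ`. -/
def upperHalf : Set ℂ := {z | 0 < z.im}

/-- `G` belongs to the Hardy space `H²` of the upper half-plane: it is holomorphic there and
its `L²`-norms over horizontal lines are uniformly bounded. -/
def IsHardyTwo (G : ℂ → ℂ) : Prop :=
  DifferentiableOn ℂ G upperHalf ∧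
    ∃ C : ℝ≥0∞, C < ⊤ ∧ ∀ y : ℝ, 0 < y → ∫⁻ x : ℝ, ‖G (x + y * I)‖ₑ ^ 2 ≤ C

/-- `G` belongs to `H^∞` of the upper half-plane. -/
def IsHardyInfty (G : ℂ → ℂ) : Prop :=
  DifferentiableOn ℂ G upperHalf ∧ ∃ M : ℝ, ∀ z ∈ upperHalf, ‖G z‖ ≤ M

/-- `g` is the boundary function of `G` on the real axis: `G (x + i y) → g x` as `y ↓ 0`,
for almost every `x`. -/
def HasBoundaryFun (G : ℂ → ℂ) (g : ℝ → ℂ) : Prop :=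
  ∀ᵐ x : ℝ, Tendsto (fun y : ℝ => G (x + y * I)) (𝓝[>] 0) (𝓝 (g x))

/-- The boundary value `lim_{y ↓ 0} G (x + i y)`. -/
def boundaryValue (G : ℂ → ℂ) (x : ℝ) : ℂ :=
  limUnder (𝓝[>] (0 : ℝ)) (fun y : ℝ => G (x + y * I))

/-- The outer function in the upper half-plane with modulus `w` on the real axis,
`exp ((1 / π i) ∫ (1 / (t - z) - t / (1 + t²)) log w(t) dt)`. For even `w` it is
positive on the imaginary half-axis. -/
def outerFun (w : ℝ → ℝ) (z : ℂ) : ℂ :=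
  Complex.exp ((1 / (Real.pi * I)) *
    ∫ t : ℝ, (1 / ((t : ℂ) - z) - (t : ℂ) / (1 + (t : ℂ) ^ 2)) * (Real.log (w t) : ℂ))

/-- The normalized Blaschke factor with zero at the point `p` of the imaginary half-axis. -/
def blaschkeFactor (p z : ℂ) : ℂ :=
  if p.im ≤ 1 then (z - p) / (z - conj p) else -((z - p) / (z - conj p))

/-- The Blaschke product with simple zeros at the points of `Λ`. -/
def blaschke (Λ : Set ℂ) (z : ℂ) : ℂ := ∏' p : Λ, blaschkeFactor p z

/-! ### Scattering data and the weighted space -/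

/-- A function `s` on the real axis and weights `ν` of a discrete measure
`∑ ν(p) δ_p` on the set `Λ`. -/
structure ScatteringData (Λ : Set ℂ) where
  /-- the function on the real axis -/
  s : ℝ → ℂ
  /-- the masses at the points of `Λ` -/
  ν : Λ → ℝ

/-- Functions on `ℝ ∪ Λ`: the restriction to `ℝ` and the restriction to `Λ`. -/
abbrev LineAndPoints (Λ : Set ℂ) : Type := (ℝ → ℂ) × (Λ → ℂ)

namespace ScatteringData

variable {Λ : Set ℂ}

/-- The standing assumptions on the scattering data: `s` is a symmetric contractive function
satisfying the Szegő condition, and `ν` is a positive discrete measure whose support `Λ` lies on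
the imaginary half-axis `i (0, ∞)` and satisfies the Blaschke condition. As
`log (1 - |s|²) ≤ 0`, the Szegő condition says that `|s| < 1` almost everywhere and that
`log (1 - |s|²) / (1 + λ²)` is integrable. -/
structure Admissible (D : ScatteringData Λ) : Prop where
  measurable_s : AEStronglyMeasurable D.s volume
  symm_s : ∀ᵐ x : ℝ, D.s x = conj (D.s (-x))
  norm_lt_one : ∀ᵐ x : ℝ, ‖D.s x‖ < 1
  szego : Integrable (fun x : ℝ => Real.log (1 - ‖D.s x‖ ^ 2) / (1 + x ^ 2))
  imaginary : ∀ p ∈ Λ, p.re = 0 ∧ 0 < p.im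
  blaschke_small : Summable (fun p : {p : ℂ // p ∈ Λ ∧ p.im ≤ 1} => (p : ℂ).im)
  blaschke_large : Summable (fun p : {p : ℂ // p ∈ Λ ∧ 1 < p.im} => 1 / (p : ℂ).im)
  pos_ν : ∀ p, 0 < D.ν p

/-- The matrix weight `[[1, conj s], [s, 1]]`. -/
def weight (D : ScatteringData Λ) (x : ℝ) : Matrix (Fin 2) (Fin 2) ℂ :=
  !![1, conj (D.s x); D.s x, 1]

/-- The vector `(f(x), -f(-x))`. -/
def vec (f : ℝ → ℂ) (x : ℝ) : Fin 2 → ℂ := ![f x, -f (-x)]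

/-- The density of the scalar product, linear in `f` and conjugate linear in `h`. -/
def form (D : ScatteringData Λ) (f h : ℝ → ℂ) (x : ℝ) : ℂ :=
  star (vec h x) ⬝ᵥ (D.weight x *ᵥ vec f x)

/-- Membership in `L²_{s,ν}`: the norm is finite. -/
structure MemL2 (D : ScatteringData Λ) (f : LineAndPoints Λ) : Prop where
  measurable : AEStronglyMeasurable f.1 volume
  integrable : Integrable (D.form f.1 f.1)
  summable : Summable (fun p : Λ => ‖f.2 p‖ ^ 2 * D.ν p)

/-- The scalar product of `L²_{s,ν}`. -/
def innerProd (D : ScatteringData Λ) (f h : LineAndPoints Λ) : ℂ :=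
  ∑' p : Λ, f.2 p * conj (h.2 p) * (D.ν p : ℂ) +
    1 / (4 * (Real.pi : ℂ)) * ∫ x : ℝ, D.form f.1 h.1 x

/-- The squared norm of `L²_{s,ν}`. -/
def normSq (D : ScatteringData Λ) (f : LineAndPoints Λ) : ℝ := (D.innerProd f f).re

/-! ### The scattering matrix -/

/-- The outer function `s_e` in the upper half-plane with `|s_e|² + |s|² = 1` on `ℝ`. -/
def outer (D : ScatteringData Λ) (z : ℂ) : ℂ :=
  outerFun (fun t => Real.sqrt (1 - ‖D.s t‖ ^ 2)) z

/-- The boundary function of `s_e` on the real axis. -/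
def outerLine (D : ScatteringData Λ) (x : ℝ) : ℂ := boundaryValue D.outer x

/-- The entry `s_e / B` of the scattering matrix in the upper half-plane. -/
def trans (D : ScatteringData Λ) (z : ℂ) : ℂ := D.outer z / blaschke Λ z

/-- The entry `s_e / B` of the scattering matrix on the real axis. -/
def transLine (D : ScatteringData Λ) (x : ℝ) : ℂ := D.outerLine x / blaschke Λ x

/-- The derivative at `p ∈ Λ` of the reciprocal `B / s_e` of `s_e / B`. -/
def recipDeriv (D : ScatteringData Λ) (p : Λ) : ℂ := deriv (fun z => 1 / D.trans z) p

/-- The data `{s_-, ν_-}` associated with the data `{s_+, ν_+}`. -/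
def minus (D : ScatteringData Λ) : ScatteringData Λ where
  s x := -(D.transLine x / conj (D.transLine x)) * conj (D.s x)
  ν p := 1 / (D.ν p * ‖D.recipDeriv p‖ ^ 2)

/-- `f⁻` is the function dual to `f⁺`. On the real axis
`(s f⁺, s f⁻) = [[s, 0], [s_+, 1]] (f⁺(x), -f⁺(-x)) = [[1, s_-], [0, s]] (-f⁻(-x), f⁻(x))`,
and `f⁻(p) = -i (1/s)'(p) ν_+(p) f⁺(p)` on `Λ`. -/
structure IsDualPair (D : ScatteringData Λ) (fp fm : LineAndPoints Λ) : Prop where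
  line_plus : ∀ᵐ x : ℝ, ![D.transLine x * fp.1 x, D.transLine x * fm.1 x] =
    !![D.transLine x, 0; D.s x, 1] *ᵥ ![fp.1 x, -fp.1 (-x)]
  line_minus : ∀ᵐ x : ℝ, ![D.transLine x * fp.1 x, D.transLine x * fm.1 x] =
    !![1, D.minus.s x; 0, D.transLine x] *ᵥ ![-fm.1 (-x), fm.1 x]
  points : ∀ p : Λ, fm.2 p = -I * D.recipDeriv p * (D.ν p : ℂ) * fp.2 p

/-! ### The two Hardy-type subspaces -/

/-- Functions `B' g` with `g ∈ H^∞ ∩ H²` and `B'` a divisor of the Blaschke product `B`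
such that `B / B'` is a finite Blaschke product. -/
def IsGenerator (h : LineAndPoints Λ) : Prop :=
  ∃ (F : Set ℂ) (G : ℂ → ℂ) (g : ℝ → ℂ), F ⊆ Λ ∧ F.Finite ∧
    IsHardyInfty G ∧ IsHardyTwo G ∧ HasBoundaryFun G g ∧
    (∀ᵐ x : ℝ, h.1 x = blaschke (Λ \ F) x * g x) ∧
    ∀ p : Λ, h.2 p = blaschke (Λ \ F) p * G p

/-- Membership in `H²_{s,ν}`, the closure in `L²_{s,ν}` of the functions `B' g`. -/
def MemH2 (D : ScatteringData Λ) (f : LineAndPoints Λ) : Prop :=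
  D.MemL2 f ∧ ∀ ε : ℝ, 0 < ε →
    ∃ h : LineAndPoints Λ, IsGenerator h ∧ D.MemL2 h ∧ D.normSq (f - h) < ε

/-- Membership in the orthogonal complement `L²_{s,ν} ⊖ H²_{s,ν}`. -/
def MemOrthH2 (D : ScatteringData Λ) (f : LineAndPoints Λ) : Prop :=
  D.MemL2 f ∧ ∀ h : LineAndPoints Λ, D.MemH2 h → D.innerProd f h = 0

/-- Membership in `Ĥ²_{s,ν}`: `s_e f` is the boundary function of some `G ∈ H²`, and
`f = G / s_e` on `Λ`. -/
def MemHatH2 (D : ScatteringData Λ) (f : LineAndPoints Λ) : Prop :=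
  D.MemL2 f ∧ ∃ G : ℂ → ℂ, IsHardyTwo G ∧
    HasBoundaryFun G (fun x => D.outerLine x * f.1 x) ∧
    ∀ p : Λ, f.2 p = G p / D.outer p

end ScatteringData

end

/-! ### Almost everywhere convergence of Poisson integrals -/

lemma integral_poisson_kernel (x : ℝ) {y : ℝ} (hy : 0 < y) :
    ∫ t : ℝ, y / ((t - x) ^ 2 + y ^ 2) = Real.pi := by
  have h1 : ∀ t : ℝ, y / ((t - x) ^ 2 + y ^ 2) = y⁻¹ * (1 + ((t - x) / y) ^ 2)⁻¹ := by
    intro t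
    have : (t - x) ^ 2 + y ^ 2 ≠ 0 := by positivity
    field_simp
    ring
  simp_rw [h1]
  rw [integral_const_mul, integral_sub_right_eq_self (fun t => (1 + (t / y) ^ 2)⁻¹) x,
    Measure.integral_comp_div (fun t : ℝ => (1 + t ^ 2)⁻¹) y, integral_univ_inv_one_add_sq,
    abs_of_pos hy, smul_eq_mul]
  field_simp

lemma integrable_poisson_kernel (x : ℝ) {y : ℝ} (hy : 0 < y) :
    Integrable fun t : ℝ => y / ((t - x) ^ 2 + y ^ 2) := by
  refine Integrable.of_integral_ne_zero ?_
  rw [integral_poisson_kernel x hy]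
  exact Real.pi_ne_zero

/-- The kernel decreases in $|t|$, so it is its value at $\delta$ plus the integral of minus its
derivative over $(|t|,\delta]$. This layer-cake form makes Poisson averages superpositions of
averages over symmetric intervals. -/
lemma poisson_kernel_layer {y δ t : ℝ} (hy : 0 < y) (ht : |t| ≤ δ) :
    ENNReal.ofReal (y / (t ^ 2 + y ^ 2)) = ENNReal.ofReal (y / (δ ^ 2 + y ^ 2)) +
      ∫⁻ r in Ioc |t| δ, ENNReal.ofReal (2 * r * y / (r ^ 2 + y ^ 2) ^ 2) := by
  have hc : Continuous fun r : ℝ => 2 * r * y / (r ^ 2 + y ^ 2) ^ 2 := by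
    refine Continuous.div (by fun_prop) (by fun_prop) fun r => by positivity
  have hint : ∫ r in |t|..δ, 2 * r * y / (r ^ 2 + y ^ 2) ^ 2 =
      -(y / (δ ^ 2 + y ^ 2)) - -(y / (|t| ^ 2 + y ^ 2)) := by
    refine intervalIntegral.integral_eq_sub_of_hasDerivAt
      (f := fun r => -(y / (r ^ 2 + y ^ 2))) (fun r _ => ?_) (hc.intervalIntegrable _ _)
    have h0 : r ^ 2 + y ^ 2 ≠ 0 := by positivity
    have h1 : HasDerivAt (fun r : ℝ => r ^ 2 + y ^ 2) (2 * r) r := by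
      simpa using (hasDerivAt_pow 2 r).add_const (y ^ 2)
    refine ((h1.inv h0).const_mul (-y)).congr_deriv ?_ |>.congr_of_eventuallyEq ?_
    · field_simp
    · exact Eventually.of_forall fun r => by simp [div_eq_mul_inv]
  rw [← ofReal_integral_eq_lintegral_ofReal]
  · rw [← intervalIntegral.integral_of_le ht, hint, ← ENNReal.ofReal_add (by positivity)]
    · congr 1
      rw [sq_abs]
      ring
    · rw [sq_abs]
      have : y / (δ ^ 2 + y ^ 2) ≤ y / (t ^ 2 + y ^ 2) := by
        have : t ^ 2 ≤ δ ^ 2 := sq_le_sq' (abs_le.1 ht).1 (abs_le.1 ht).2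
        exact div_le_div_of_nonneg_left hy.le (by positivity) (by linarith)
      linarith
  · exact (hc.integrableOn_Icc (a := |t|) (b := δ)).mono_set Ioc_subset_Icc_self
  · refine (ae_restrict_iff' measurableSet_Ioc).2 (ae_of_all _ fun r hr => ?_)
    have : 0 ≤ r := (abs_nonneg t).trans hr.1.le
    positivity

/-- If the averages of `v` over the intervals `(-r, r)`, `r ≤ δ`, are at most `ε`, then so are,
up to a constant, its Poisson averages over `(-δ, δ)`. -/
lemma lintegral_poisson_kernel_near_le {v : ℝ → ℝ≥0∞} (hv : AEMeasurable v) {y δ ε : ℝ}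
    (hy : 0 < y) (hδ : 0 < δ) (hε : 0 < ε)
    (hA : ∀ r, 0 < r → r ≤ δ → ∫⁻ t in Icc (-r) r, v t ≤ ENNReal.ofReal (2 * r * ε)) :
    ∫⁻ t in Icc (-δ) δ, ENNReal.ofReal (y / (t ^ 2 + y ^ 2)) * v t ≤
      ENNReal.ofReal ((1 + 4 * Real.pi) * ε) := by
  set k : ℝ → ℝ≥0∞ := fun r => ENNReal.ofReal (2 * r * y / (r ^ 2 + y ^ 2) ^ 2) with hk
  have hkm : Measurable k := by
    refine ENNReal.measurable_ofReal.comp ?_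
    fun_prop
  have hind : ∀ t ∈ Icc (-δ) δ, ENNReal.ofReal (y / (t ^ 2 + y ^ 2)) * v t =
      ENNReal.ofReal (y / (δ ^ 2 + y ^ 2)) * v t +
        ∫⁻ r in Ioc 0 δ, (Ioi |t|).indicator k r * v t := by
    intro t ht
    rw [poisson_kernel_layer hy (abs_le.2 ht), add_mul, lintegral_mul_const _
      (hkm.indicator measurableSet_Ioi), lintegral_indicator measurableSet_Ioi,
      Measure.restrict_restrict measurableSet_Ioi]
    congr 4
    ext r
    simp only [mem_Ioc, mem_inter_iff, mem_Ioi]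
    exact ⟨fun h => ⟨h.1, (abs_nonneg t).trans_lt h.1, h.2⟩, fun h => ⟨h.1, h.2.2⟩⟩
  rw [setLIntegral_congr_fun measurableSet_Icc hind, lintegral_add_left'
    (hv.restrict.const_mul _)]
  have hfar : ∫⁻ t in Icc (-δ) δ, ENNReal.ofReal (y / (δ ^ 2 + y ^ 2)) * v t ≤
      ENNReal.ofReal ε := by
    rw [lintegral_const_mul'' _ hv.restrict]
    refine (mul_le_mul_right (hA δ hδ le_rfl) _).trans ?_
    rw [← ENNReal.ofReal_mul (by positivity)]
    refine ENNReal.ofReal_le_ofReal ?_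
    have : y / (δ ^ 2 + y ^ 2) * (2 * δ) ≤ 1 := by
      rw [div_mul_eq_mul_div, div_le_one (by positivity)]
      nlinarith [sq_nonneg (δ - y)]
    nlinarith
  have hswap : ∫⁻ t in Icc (-δ) δ, ∫⁻ r in Ioc 0 δ, (Ioi |t|).indicator k r * v t =
      ∫⁻ r in Ioc 0 δ, ∫⁻ t in Icc (-δ) δ, (Ioi |t|).indicator k r * v t := by
    refine lintegral_lintegral_swap (AEMeasurable.mul ?_ ?_)
    · have : Measurable fun q : ℝ × ℝ => ({q : ℝ × ℝ | |q.1| < q.2}).indicator (fun q => k q.2) q :=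
        (hkm.comp measurable_snd).indicator
          (measurableSet_lt (by fun_prop) measurable_snd)
      exact this.aemeasurable
    · exact hv.restrict.comp_fst
  -- After the swap the inner integral is at most $k(r)$ times $\int_{-r}^r v\le 2r\varepsilon$.
  -- Since $2r\,k(r)=4r^2y/(r^2+y^2)^2$ is at most four Poisson kernels, the total mass $\pi$ gives
  -- $4\pi\varepsilon$.
  have hmid : ∫⁻ r in Ioc 0 δ, ∫⁻ t in Icc (-δ) δ, (Ioi |t|).indicator k r * v t ≤
      ENNReal.ofReal (4 * Real.pi * ε) := by
    calc ∫⁻ r in Ioc 0 δ, ∫⁻ t in Icc (-δ) δ, (Ioi |t|).indicator k r * v t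
        ≤ ∫⁻ r in Ioc 0 δ, ENNReal.ofReal (4 * ε * (y / ((r - 0) ^ 2 + y ^ 2))) := by
          refine setLIntegral_mono' measurableSet_Ioc fun r hr => ?_
          calc ∫⁻ t in Icc (-δ) δ, (Ioi |t|).indicator k r * v t
              ≤ ∫⁻ t, (Icc (-r) r).indicator (fun t => k r * v t) t := by
                refine (setLIntegral_le_lintegral _ _).trans (lintegral_mono fun t => ?_)
                by_cases h : |t| < r
                · rw [indicator_of_mem (s := Ioi |t|) h, indicator_of_mem]
                  exact abs_le.1 h.le
                · rw [indicator_of_notMem (s := Ioi |t|) h, zero_mul]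
                  exact zero_le
            _ = k r * ∫⁻ t in Icc (-r) r, v t := by
                rw [lintegral_indicator measurableSet_Icc, lintegral_const_mul'' _ hv.restrict]
            _ ≤ k r * ENNReal.ofReal (2 * r * ε) := mul_le_mul_right (hA r hr.1 hr.2) _
            _ ≤ _ := by
                have hr0 := hr.1
                rw [hk, ← ENNReal.ofReal_mul (by positivity)]
                refine ENNReal.ofReal_le_ofReal ?_
                have h2 : r ^ 2 / (r ^ 2 + y ^ 2) ≤ 1 := by
                  rw [div_le_one (by positivity)]
                  nlinarith [sq_nonneg y]
                have h3 : 2 * r * y / (r ^ 2 + y ^ 2) ^ 2 * (2 * r * ε) =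
                    4 * ε * (y / ((r - 0) ^ 2 + y ^ 2)) * (r ^ 2 / (r ^ 2 + y ^ 2)) := by
                  rw [sub_zero]
                  field_simp
                  ring
                rw [h3]
                exact mul_le_of_le_one_right (by positivity) h2
      _ ≤ ∫⁻ r, ENNReal.ofReal (4 * ε * (y / ((r - 0) ^ 2 + y ^ 2))) :=
          setLIntegral_le_lintegral _ _
      _ = ENNReal.ofReal (4 * Real.pi * ε) := by
          rw [← ofReal_integral_eq_lintegral_ofReal
            ((integrable_poisson_kernel 0 hy).const_mul _)
            (ae_of_all _ fun r => by positivity), integral_const_mul,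
            integral_poisson_kernel 0 hy]
          congr 1
          ring
  rw [hswap]
  refine (add_le_add hfar hmid).trans_eq ?_
  rw [← ENNReal.ofReal_add hε.le (by positivity)]
  congr 1
  ring

/-- Away from $x$ the Poisson kernel is thus at most $Cy/(1+t^2)$, which controls its tail by the
weighted integrability of `f` alone. -/
lemma one_add_sq_le_mul {x d t w : ℝ} (hd : 0 < d) (h1 : d ^ 2 ≤ w) (h2 : (t - x) ^ 2 ≤ w) :
    1 + t ^ 2 ≤ ((1 + 2 * x ^ 2) / d ^ 2 + 2) * w := by
  have h3 : (1 + 2 * x ^ 2) ≤ (1 + 2 * x ^ 2) / d ^ 2 * w := by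
    rw [div_mul_eq_mul_div, le_div_iff₀ (by positivity)]
    exact mul_le_mul_of_nonneg_left h1 (by positivity)
  nlinarith [sq_nonneg (t - 2 * x)]

lemma poisson_kernel_le {x d y t : ℝ} (hd : 0 < d) (hy : 0 < y)
    (h1 : d ^ 2 ≤ (t - x) ^ 2 + y ^ 2) :
    y / ((t - x) ^ 2 + y ^ 2) ≤ y * ((1 + 2 * x ^ 2) / d ^ 2 + 2) * (1 / (1 + t ^ 2)) := by
  rw [mul_one_div, div_le_div_iff₀ (by positivity) (by positivity), mul_assoc]
  exact mul_le_mul_of_nonneg_left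
    (one_add_sq_le_mul hd h1 (by nlinarith [sq_nonneg y])) hy.le

lemma continuous_poisson_kernel (x : ℝ) {y : ℝ} (hy : 0 < y) :
    Continuous fun t : ℝ => y / ((t - x) ^ 2 + y ^ 2) :=
  Continuous.div (by fun_prop) (by fun_prop) fun t => by positivity

lemma integrable_poisson_kernel_mul {f : ℝ → ℂ} (hf : Integrable fun t => f t / (1 + t ^ 2))
    (x : ℝ) {y : ℝ} (hy : 0 < y) :
    Integrable fun t : ℝ => ((y / ((t - x) ^ 2 + y ^ 2) : ℝ) : ℂ) * f t := by
  have h1 : (fun t : ℝ => ((y / ((t - x) ^ 2 + y ^ 2) : ℝ) : ℂ) * f t) =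
      fun t : ℝ => ((y / ((t - x) ^ 2 + y ^ 2) * (1 + t ^ 2) : ℝ) : ℂ) * (f t / (1 + t ^ 2)) := by
    funext t
    have : (1 + (t : ℂ) ^ 2) ≠ 0 := by
      norm_cast
      positivity
    push_cast
    field_simp
  rw [h1]
  refine hf.bdd_mul (c := y * ((1 + 2 * x ^ 2) / y ^ 2 + 2)) ?_ (ae_of_all _ fun t => ?_)
  · refine Continuous.aestronglyMeasurable ?_
    have := continuous_poisson_kernel x hy
    fun_prop
  · rw [Complex.norm_real, Real.norm_of_nonneg (by positivity), ← le_div_iff₀ (by positivity)]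
    refine (poisson_kernel_le hy hy (by nlinarith [sq_nonneg (t - x)])).trans_eq ?_
    ring

/-- The Poisson integral of `f` converges to `f` almost everywhere. -/
theorem ae_tendsto_poisson_integral {f : ℝ → ℂ}
    (hf : Integrable fun t : ℝ => f t / (1 + t ^ 2)) :
    ∀ᵐ x : ℝ, Tendsto (fun y : ℝ => ∫ t : ℝ, ((y / ((t - x) ^ 2 + y ^ 2) : ℝ) : ℂ) * f t)
      (𝓝[>] 0) (𝓝 (Real.pi * f x)) := by
  have hloc : LocallyIntegrable f := by
    have h1 : f = fun t : ℝ => (1 + (t : ℂ) ^ 2) * (f t / (1 + t ^ 2)) := by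
      funext t
      have : (1 + (t : ℂ) ^ 2) ≠ 0 := by
        norm_cast
        positivity
      field_simp
    rw [h1]
    exact LocallyIntegrable.continuous_mul (by fun_prop) hf.locallyIntegrable
  -- Lebesgue points: the averages of $|f-f(x)|$ over balls centred at $x$ tend to $0$.
  filter_upwards [IsUnifLocDoublingMeasure.ae_tendsto_average_norm_sub volume hloc 1] with x hx
  have hleb := hx (fun _ : ℝ => x) (fun r : ℝ => r) (l := 𝓝[>] 0) tendsto_id (by
    filter_upwards [self_mem_nhdsWithin] with r hr
    rw [one_mul]
    exact Metric.mem_closedBall_self (le_of_lt hr))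
  have hgint : Integrable fun t : ℝ => (f t - f x) / (1 + t ^ 2) := by
    have h2 : Integrable fun t : ℝ => f x / (1 + (t : ℂ) ^ 2) := by
      have := (integrable_inv_one_add_sq.ofReal (𝕜 := ℂ)).const_mul (f x)
      refine this.congr (ae_of_all _ fun t => ?_)
      simp [div_eq_mul_inv]
    refine (hf.sub h2).congr (ae_of_all _ fun t => ?_)
    simp [sub_div]
  set v : ℝ → ℝ≥0∞ := fun t => ‖f (t + x) - f x‖ₑ with hv
  have hvm : AEMeasurable v := by
    refine ((hloc.aestronglyMeasurable.comp_measurePreserving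
      (measurePreserving_add_right volume x)).sub aestronglyMeasurable_const).enorm
  have key : Tendsto (fun y : ℝ => ∫⁻ t, ENNReal.ofReal (y / (t ^ 2 + y ^ 2)) * v t)
      (𝓝[>] 0) (𝓝 0) := by
    rw [ENNReal.tendsto_nhds_zero]
    intro ε hε
    obtain ⟨e, he0, hee⟩ : ∃ e : ℝ, 0 < e ∧ ENNReal.ofReal ((1 + 4 * Real.pi) * e) ≤ ε / 2 := by
      rcases eq_or_ne ε ⊤ with rfl | htop
      · exact ⟨1, one_pos, by simp [ENNReal.top_div]⟩
      · have hp : 0 < (ε / 2).toReal :=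
          ENNReal.toReal_pos (by simpa using hε.ne') (ENNReal.div_ne_top htop (by simp))
        refine ⟨(ε / 2).toReal / (1 + 4 * Real.pi), by positivity, ?_⟩
        rw [mul_div_cancel₀ _ (by positivity), ENNReal.ofReal_toReal
          (ENNReal.div_ne_top htop (by simp))]
    obtain ⟨δ, hδ, hδA⟩ : ∃ δ : ℝ, 0 < δ ∧ ∀ r, 0 < r → r ≤ δ →
        ∫⁻ t in Icc (-r) r, v t ≤ ENNReal.ofReal (2 * r * e) := by
      obtain ⟨δ, hδ, hball⟩ := (mem_nhdsGT_iff_exists_Ioc_subset).1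
        (hleb.eventually (gt_mem_nhds he0))
      refine ⟨δ, hδ, fun r hr hrδ => ?_⟩
      have h1 := hball ⟨hr, hrδ⟩
      simp only [mem_ofPred_eq] at h1
      rw [setAverage_eq, Real.volume_real_closedBall hr.le, smul_eq_mul,
        inv_mul_lt_iff₀ (by positivity)] at h1
      have h2 : ∫⁻ t in Icc (-r) r, v t = ∫⁻ t in Metric.closedBall x r, ‖f t - f x‖ₑ := by
        rw [← lintegral_indicator measurableSet_Icc,
          ← lintegral_indicator Metric.isClosed_closedBall.measurableSet,
          ← lintegral_add_right_eq_self
            ((Metric.closedBall x r).indicator fun t => ‖f t - f x‖ₑ) x]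
        congr 1
        funext t
        have : t + x ∈ Metric.closedBall x r ↔ t ∈ Icc (-r) r := by
          rw [Metric.mem_closedBall, Real.dist_eq, add_sub_cancel_right, abs_le, mem_Icc]
        by_cases ht : t ∈ Icc (-r) r
        · rw [indicator_of_mem ht, indicator_of_mem (this.2 ht)]
        · rw [indicator_of_notMem ht, indicator_of_notMem (fun h => ht (this.1 h))]
      rw [h2, ← ofReal_integral_norm_eq_lintegral_enorm]
      · exact ENNReal.ofReal_le_ofReal h1.le
      · exact (hloc.integrableOn_isCompact (isCompact_closedBall x r)).sub
          (integrableOn_const (isCompact_closedBall x r).measure_lt_top.ne)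
    have hMfin : ∫⁻ t : ℝ, ‖(f t - f x) / (1 + (t : ℂ) ^ 2)‖ₑ < ⊤ := hgint.2
    set M := ∫⁻ t : ℝ, ‖(f t - f x) / (1 + (t : ℂ) ^ 2)‖ₑ with hM
    set C : ℝ := (1 + 2 * x ^ 2) / δ ^ 2 + 2
    have hlim : Tendsto (fun y : ℝ => ENNReal.ofReal (y * C) * M) (𝓝[>] 0) (𝓝 0) := by
      have h3 : Tendsto (fun y : ℝ => ENNReal.ofReal (y * C)) (𝓝[>] 0) (𝓝 0) := by
        have h4 : Continuous fun y : ℝ => ENNReal.ofReal (y * C) :=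
        ENNReal.continuous_ofReal.comp (by fun_prop)
        have := h4.tendsto 0
        simp only [zero_mul, ENNReal.ofReal_zero] at this
        exact this.mono_left nhdsWithin_le_nhds
      simpa using ENNReal.Tendsto.mul_const h3 (Or.inr hMfin.ne)
    filter_upwards [self_mem_nhdsWithin, (ENNReal.tendsto_nhds_zero.1 hlim) (ε / 2)
      (by simpa using hε.ne')] with y hy hyM
    have hy : 0 < y := hy
    rw [← lintegral_add_compl _ (measurableSet_Icc (a := -δ) (b := δ)), ← ENNReal.add_halves ε]
    refine add_le_add ((lintegral_poisson_kernel_near_le hvm hy hδ he0 hδA).trans hee)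
      (le_trans ?_ hyM)
    -- The part of the integral outside $(-\delta,\delta)$ is $O(y)$ once $\delta$ is fixed.
    calc ∫⁻ t in (Icc (-δ) δ)ᶜ, ENNReal.ofReal (y / (t ^ 2 + y ^ 2)) * v t
        ≤ ∫⁻ t in (Icc (-δ) δ)ᶜ, ENNReal.ofReal (y * C) *
            ‖(f (t + x) - f x) / (1 + ((t + x : ℝ) : ℂ) ^ 2)‖ₑ := by
          refine setLIntegral_mono' measurableSet_Icc.compl fun t ht => ?_
          have ht' : δ ^ 2 ≤ t ^ 2 := by
            rw [sq_le_sq, abs_of_pos hδ]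
            by_contra hlt
            exact ht (abs_le.1 (not_le.1 hlt).le)
          have := poisson_kernel_le (x := x) (d := δ) (y := y) (t := t + x) hδ hy (by
            rw [add_sub_cancel_right]
            nlinarith [sq_nonneg y])
          rw [add_sub_cancel_right] at this
          have h5 : ‖(f (t + x) - f x) / (1 + ((t + x : ℝ) : ℂ) ^ 2)‖ₑ =
              ENNReal.ofReal (1 / (1 + (t + x) ^ 2)) * v t := by
            rw [hv, div_eq_mul_one_div, mul_comm, enorm_mul]
            congr 1
            rw [← ofReal_norm]
            congr 1
            have : (1 : ℂ) / (1 + ((t + x : ℝ) : ℂ) ^ 2) = ((1 / (1 + (t + x) ^ 2) : ℝ) : ℂ) := by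
              push_cast
              rfl
            rw [this, Complex.norm_real, Real.norm_of_nonneg (by positivity)]
          rw [h5, ← mul_assoc, ← ENNReal.ofReal_mul (by positivity)]
          exact mul_le_mul_left (ENNReal.ofReal_le_ofReal this) _
      _ ≤ ∫⁻ t, ENNReal.ofReal (y * C) *
            ‖(f (t + x) - f x) / (1 + ((t + x : ℝ) : ℂ) ^ 2)‖ₑ := setLIntegral_le_lintegral _ _
      _ = ENNReal.ofReal (y * C) * M := by
          rw [lintegral_const_mul' _ _ ENNReal.ofReal_ne_top, hM,
            lintegral_add_right_eq_self (fun t : ℝ => ‖(f t - f x) / (1 + (t : ℂ) ^ 2)‖ₑ) x]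
  rw [tendsto_iff_edist_tendsto_0]
  refine tendsto_of_tendsto_of_tendsto_of_le_of_le' tendsto_const_nhds key
    (Eventually.of_forall fun _ => zero_le) ?_
  filter_upwards [self_mem_nhdsWithin] with y hy
  have hy : 0 < y := hy
  have hK : Integrable fun t : ℝ => ((y / ((t - x) ^ 2 + y ^ 2) : ℝ) : ℂ) * f x :=
    ((integrable_poisson_kernel x hy).ofReal (𝕜 := ℂ)).mul_const _
  have hπ : (Real.pi : ℂ) * f x = ∫ t : ℝ, ((y / ((t - x) ^ 2 + y ^ 2) : ℝ) : ℂ) * f x := by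
    rw [integral_mul_const, integral_complex_ofReal, integral_poisson_kernel x hy]
  rw [edist_eq_enorm_sub, hπ, ← integral_sub (integrable_poisson_kernel_mul hf x hy) hK]
  refine (enorm_integral_le_lintegral_enorm _).trans_eq ?_
  rw [← lintegral_add_right_eq_self _ x]
  refine lintegral_congr fun t => ?_
  rw [← mul_sub, enorm_mul, add_sub_cancel_right, ← ofReal_norm, Complex.norm_real,
    Real.norm_of_nonneg (by positivity)]

/-! ### Hardy classes of the upper half-plane -/

/-- `ψ` belongs to the Hardy space `H¹` of the upper half-plane. -/
def IsHardyOne (ψ : ℂ → ℂ) : Prop :=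
  DifferentiableOn ℂ ψ upperHalf ∧
    ∃ C : ℝ≥0∞, C < ⊤ ∧ ∀ y : ℝ, 0 < y → ∫⁻ x : ℝ, ‖ψ (x + y * I)‖ₑ ≤ C

lemma mem_upperHalf_line {x y : ℝ} (hy : 0 < y) : (x + y * I : ℂ) ∈ upperHalf := by
  simpa [upperHalf] using hy

lemma isOpen_upperHalf : IsOpen upperHalf := isOpen_lt continuous_const Complex.continuous_im

lemma continuous_line {G : ℂ → ℂ} (hG : DifferentiableOn ℂ G upperHalf) {y : ℝ} (hy : 0 < y) :
    Continuous fun x : ℝ => G (x + y * I) :=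
  hG.continuousOn.comp_continuous (by fun_prop) fun _ => mem_upperHalf_line hy

lemma IsHardyOne.integrable {ψ : ℂ → ℂ} (h : IsHardyOne ψ) {y : ℝ} (hy : 0 < y) :
    Integrable fun x : ℝ => ψ (x + y * I) := by
  obtain ⟨hd, C, hC, hb⟩ := h
  exact ⟨(continuous_line hd hy).aestronglyMeasurable, (hb y hy).trans_lt hC⟩

lemma IsHardyOne.exists_integral_norm_le {ψ : ℂ → ℂ} (h : IsHardyOne ψ) :
    ∃ C : ℝ, ∀ y : ℝ, 0 < y → ∫ x : ℝ, ‖ψ (x + y * I)‖ ≤ C := by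
  obtain ⟨hd, C, hC, hb⟩ := id h
  refine ⟨C.toReal, fun y hy => ?_⟩
  rw [integral_norm_eq_lintegral_enorm (h.integrable hy).1]
  exact ENNReal.toReal_mono hC.ne (hb y hy)

lemma memLp_two_iff_lintegral {u : ℝ → ℂ} (hm : AEStronglyMeasurable u) :
    MemLp u 2 ↔ ∫⁻ x, ‖u x‖ₑ ^ 2 < ⊤ := by
  rw [MemLp, eLpNorm_lt_top_iff_lintegral_rpow_enorm_lt_top (by simp) (by simp)]
  simp [hm]

lemma IsHardyTwo.memLp {G : ℂ → ℂ} (h : IsHardyTwo G) {y : ℝ} (hy : 0 < y) :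
    MemLp (fun x : ℝ => G (x + y * I)) 2 := by
  obtain ⟨hd, C, hC, hb⟩ := h
  exact (memLp_two_iff_lintegral (continuous_line hd hy).aestronglyMeasurable).2
    ((hb y hy).trans_lt hC)

lemma IsHardyTwo.shift {G : ℂ → ℂ} (h : IsHardyTwo G) {c : ℝ} (hc : 0 ≤ c) :
    IsHardyTwo fun z => G (z + c * I) := by
  obtain ⟨hd, C, hC, hb⟩ := h
  refine ⟨hd.comp (by fun_prop) fun z hz => ?_, C, hC, fun y hy => ?_⟩
  · have hz : 0 < z.im := hz
    simp only [upperHalf, mem_ofPred_eq, add_im, mul_im, ofReal_re, I_im, ofReal_im, I_re]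
    linarith
  · convert hb (y + c) (by linarith) using 6
    push_cast
    ring

lemma IsHardyTwo.mul {g G : ℂ → ℂ} (hg : IsHardyTwo g) (hG : IsHardyTwo G) :
    IsHardyOne fun z => g z * G z := by
  obtain ⟨hd, C, hC, hb⟩ := hg
  obtain ⟨hd', C', hC', hb'⟩ := hG
  refine ⟨hd.mul hd', C + C', ENNReal.add_lt_top.2 ⟨hC, hC'⟩, fun y hy => ?_⟩
  calc ∫⁻ x : ℝ, ‖g (x + y * I) * G (x + y * I)‖ₑ
      ≤ ∫⁻ x : ℝ, (‖g (x + y * I)‖ₑ ^ 2 + ‖G (x + y * I)‖ₑ ^ 2) := by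
        refine lintegral_mono fun x => ?_
        rw [enorm_mul, sq, sq]
        rcases le_total ‖g (x + y * I)‖ₑ ‖G (x + y * I)‖ₑ with h | h
        · exact (mul_le_mul_left h _).trans le_add_self
        · exact (mul_le_mul_right h _).trans le_self_add
    _ = (∫⁻ x : ℝ, ‖g (x + y * I)‖ₑ ^ 2) + ∫⁻ x : ℝ, ‖G (x + y * I)‖ₑ ^ 2 :=
        lintegral_add_left ((continuous_line hd hy).enorm.measurable.pow_const _) _
    _ ≤ C + C' := add_le_add (hb y hy) (hb' y hy)

/-! ### Cauchy's theorem on horizontal lines -/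

/-- Cauchy's theorem on rectangles, where the vertical sides are known only to be bounded by an
integrable function of their abscissa, not to tend to $0$. If the two line integrals differed by
$L>0$ in modulus, then $V(X)+V(-X)\ge L/2$ for all large $X$, against integrability. -/
lemma integral_line_eq_of_le {f : ℂ → ℂ} {a b : ℝ} (hab : a ≤ b)
    (hf : DifferentiableOn ℂ f {z | a ≤ z.im})
    (hia : Integrable fun x : ℝ => f (x + a * I)) (hib : Integrable fun x : ℝ => f (x + b * I))
    {V : ℝ → ℝ} (hV : Integrable V) {R : ℝ}
    (hVf : ∀ x : ℝ, R ≤ |x| → ‖∫ y in a..b, f (x + y * I)‖ ≤ V x) :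
    ∫ x : ℝ, f (x + a * I) = ∫ x : ℝ, f (x + b * I) := by
  have hbd : ∀ X : ℝ, max R 0 ≤ X →
      ‖(∫ x in (-X)..X, f (x + a * I)) - ∫ x in (-X)..X, f (x + b * I)‖ ≤ V X + V (-X) := by
    intro X hX
    have hX0 : 0 ≤ X := (le_max_right _ _).trans hX
    have hXR : R ≤ |X| := ((le_max_left _ _).trans hX).trans (le_abs_self X)
    have h1 := Complex.integral_boundary_rect_eq_zero_of_differentiableOn f
      (-X + a * I) (X + b * I) (hf.mono fun z hz => by
        have := hz.2
        simp only [add_im, neg_im, ofReal_im, mul_im, ofReal_re, I_im, I_re] at this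
        simp only [neg_zero, mul_one, mul_zero, add_zero, zero_add, mem_preimage,
          uIcc_of_le hab] at this
        exact this.1)
    simp only [add_im, neg_im, ofReal_im, mul_im, ofReal_re, I_im, I_re, add_re, neg_re, mul_re,
      neg_zero, mul_one, mul_zero, add_zero, zero_add, sub_zero] at h1
    have h2 : (∫ x in (-X)..X, f (x + a * I)) - ∫ x in (-X)..X, f (x + b * I) =
        I • (∫ y in a..b, f (((-X : ℝ) : ℂ) + y * I)) - I • ∫ y in a..b, f (X + y * I) := by
      linear_combination h1
    rw [h2]
    refine (norm_sub_le _ _).trans ?_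
    rw [norm_smul, norm_smul, norm_I, one_mul, one_mul, add_comm]
    exact add_le_add (hVf X hXR) (hVf (-X) (by rwa [abs_neg]))
  by_contra hne
  set L := ‖(∫ x : ℝ, f (x + a * I)) - ∫ x : ℝ, f (x + b * I)‖
  have hL : 0 < L := norm_pos_iff.2 (sub_ne_zero.2 hne)
  have hlim : Tendsto (fun X : ℝ =>
      ‖(∫ x in (-X)..X, f (x + a * I)) - ∫ x in (-X)..X, f (x + b * I)‖) atTop (𝓝 L) :=
    ((intervalIntegral_tendsto_integral hia tendsto_neg_atTop_atBot tendsto_id).sub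
      (intervalIntegral_tendsto_integral hib tendsto_neg_atTop_atBot tendsto_id)).norm
  obtain ⟨X₀, hX₀⟩ := eventually_atTop.1
    ((hlim.eventually (lt_mem_nhds (half_lt_self hL))).and (eventually_ge_atTop (max R 0)))
  have hW : IntegrableOn (fun X => V X + V (-X)) (Ioi X₀) := (hV.add hV.comp_neg).integrableOn
  have hc : IntegrableOn (fun _ : ℝ => L / 2) (Ioi X₀) := by
    refine Integrable.mono' hW aestronglyMeasurable_const
      ((ae_restrict_iff' measurableSet_Ioi).2 (ae_of_all _ fun X hX => ?_))
    obtain ⟨h1, h2⟩ := hX₀ X (le_of_lt hX)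
    rw [Real.norm_of_nonneg (half_pos hL).le]
    exact h1.le.trans (hbd X h2)
  rw [integrableOn_const_iff] at hc
  rcases hc with h | h
  · exact (half_pos hL).ne' (by simpa using h)
  · simp at h

lemma IsHardyOne.integrable_strip {ψ : ℂ → ℂ} (h : IsHardyOne ψ) {a b : ℝ} (ha : 0 < a)
    (hab : a ≤ b) : Integrable fun x : ℝ => ∫ y in a..b, ‖ψ (x + y * I)‖ := by
  obtain ⟨hd, C, hC, hb⟩ := h
  simp_rw [intervalIntegral.integral_of_le hab]
  have hc : ContinuousOn (fun q : ℝ × ℝ => ψ (q.1 + q.2 * I)) (univ ×ˢ Ioc a b) :=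
    hd.continuousOn.comp (by fun_prop) fun q hq => mem_upperHalf_line (ha.trans hq.2.1)
  have hm : AEStronglyMeasurable (fun q : ℝ × ℝ => ψ (q.1 + q.2 * I))
      ((volume : Measure ℝ).prod ((volume : Measure ℝ).restrict (Ioc a b))) := by
    have := hc.aestronglyMeasurable (μ := (volume : Measure ℝ).prod (volume : Measure ℝ))
      (MeasurableSet.univ.prod measurableSet_Ioc)
    rwa [← Measure.prod_restrict, Measure.restrict_univ] at this
  have hint : Integrable (fun q : ℝ × ℝ => ψ (q.1 + q.2 * I))
      ((volume : Measure ℝ).prod ((volume : Measure ℝ).restrict (Ioc a b))) := by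
    refine ⟨hm, ?_⟩
    rw [HasFiniteIntegral, lintegral_prod_symm _ hm.enorm]
    refine (setLIntegral_mono' measurableSet_Ioc fun y hy => hb y (ha.trans hy.1)).trans_lt ?_
    rw [setLIntegral_const]
    exact ENNReal.mul_lt_top hC (by simp)
  exact hint.norm.integral_prod_left

/-- The bounding function comes from Fubini on the strip. The extra term $(1+x^2)^{-1}$ leaves room
for a constant times a Poisson-type kernel, which occurs when the value of `ψ` at a point is
subtracted. -/
lemma IsHardyOne.integral_line_eq {ψ f : ℂ → ℂ} (h : IsHardyOne ψ) {a b : ℝ} (ha : 0 < a)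
    (hab : a ≤ b) (hf : DifferentiableOn ℂ f {z | a ≤ z.im})
    (hia : Integrable fun x : ℝ => f (x + a * I)) (hib : Integrable fun x : ℝ => f (x + b * I))
    {M R : ℝ} (hM : ∀ x y : ℝ, R ≤ |x| → a ≤ y →
      ‖f (x + y * I)‖ ≤ M * ‖ψ (x + y * I)‖ + M * (1 + x ^ 2)⁻¹) :
    ∫ x : ℝ, f (x + a * I) = ∫ x : ℝ, f (x + b * I) := by
  have hcl : ∀ x : ℝ, ContinuousOn (fun y : ℝ => ψ (x + y * I)) (uIcc a b) := fun x =>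
    h.1.continuousOn.comp (by fun_prop) fun y hy => by
      rw [uIcc_of_le hab] at hy
      exact mem_upperHalf_line (ha.trans_le hy.1)
  refine integral_line_eq_of_le hab hf hia hib (R := R) (V := fun x =>
    M * (∫ y in a..b, ‖ψ (x + y * I)‖) + (b - a) * (M * (1 + x ^ 2)⁻¹))
    (((h.integrable_strip ha hab).const_mul M).add
      ((integrable_inv_one_add_sq.const_mul M).const_mul (b - a))) fun x hx => ?_
  have h1 : IntervalIntegrable (fun y : ℝ => M * ‖ψ (x + y * I)‖) volume a b :=
    ((hcl x).norm.const_mul M).intervalIntegrable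
  have h2 : IntervalIntegrable (fun y : ℝ => M * ‖ψ (x + y * I)‖ + M * (1 + x ^ 2)⁻¹) volume a b :=
    h1.add intervalIntegrable_const
  refine (intervalIntegral.norm_integral_le_of_norm_le hab
    (ae_of_all _ fun y hy => hM x y hx hy.1.le) h2).trans_eq ?_
  rw [intervalIntegral.integral_add h1 intervalIntegrable_const,
    intervalIntegral.integral_const_mul, intervalIntegral.integral_const, smul_eq_mul]

/-! ### Cauchy's theorem and the Poisson formula for $H^1$ -/

lemma le_norm_line_sub {x y : ℝ} {q : ℂ} : y - q.im ≤ ‖(x + y * I : ℂ) - q‖ := by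
  refine le_trans ?_ ((le_abs_self _).trans (Complex.abs_im_le_norm _))
  simp

lemma line_sub_ne_zero {x y : ℝ} {q : ℂ} (h : y ≠ q.im) : (x + y * I : ℂ) - q ≠ 0 := by
  intro h0
  have := congrArg Complex.im h0
  simp at this
  exact h (by linarith)

/-- There is no pole above the line, so it can be moved up to height $b$, where the $H^1$ bound and
$|z-q|\ge b-\operatorname{Im}q$ make the integral tend to $0$. -/
lemma IsHardyOne.integral_div_sub_eq_zero {ψ : ℂ → ℂ} (h : IsHardyOne ψ) {a : ℝ} (ha : 0 < a)
    {q : ℂ} (hq : q.im < a) : ∫ x : ℝ, ψ (x + a * I) / ((x + a * I : ℂ) - q) = 0 := by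
  have hd : 0 < a - q.im := by linarith
  have hle : ∀ x y : ℝ, a ≤ y → ‖ψ (x + y * I) / ((x + y * I : ℂ) - q)‖ ≤
      (y - q.im)⁻¹ * ‖ψ (x + y * I)‖ := by
    intro x y hy
    rw [norm_div, div_eq_inv_mul]
    exact mul_le_mul_of_nonneg_right (inv_anti₀ (by linarith) le_norm_line_sub) (norm_nonneg _)
  have hcont : ∀ y : ℝ, a ≤ y → Continuous fun x : ℝ => ψ (x + y * I) / ((x + y * I : ℂ) - q) :=
    fun y hy => (continuous_line h.1 (ha.trans_le hy)).div (by fun_prop)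
      fun x => line_sub_ne_zero (by linarith)
  have hint : ∀ y : ℝ, a ≤ y → Integrable fun x : ℝ => ψ (x + y * I) / ((x + y * I : ℂ) - q) :=
    fun y hy => Integrable.mono' ((h.integrable (ha.trans_le hy)).norm.const_mul _)
      (hcont y hy).aestronglyMeasurable (ae_of_all _ fun x => hle x y hy)
  have hconst : ∀ b : ℝ, a ≤ b → ∫ x : ℝ, ψ (x + a * I) / ((x + a * I : ℂ) - q) =
      ∫ x : ℝ, ψ (x + b * I) / ((x + b * I : ℂ) - q) := by
    intro b hb
    refine h.integral_line_eq (f := fun z => ψ z / (z - q)) ha hb ?_ (hint a le_rfl) (hint b hb)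
      (M := (a - q.im)⁻¹) (R := 0) fun x y _ hy => (hle x y hy).trans ?_
    · refine (h.1.mono fun z hz => ha.trans_le hz).div (by fun_prop) fun z hz h0 => ?_
      have h1 := congrArg Complex.im h0
      have hz : a ≤ z.im := hz
      simp at h1
      linarith
    · have : (y - q.im)⁻¹ ≤ (a - q.im)⁻¹ := inv_anti₀ hd (by linarith)
      have h2 : 0 ≤ (a - q.im)⁻¹ * (1 + x ^ 2)⁻¹ := by positivity
      nlinarith [norm_nonneg (ψ (x + y * I))]
  obtain ⟨C, hC⟩ := h.exists_integral_norm_le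
  have hlim : Tendsto (fun b : ℝ => (b - q.im)⁻¹ * C) atTop (𝓝 0) := by
    have := (tendsto_inv_atTop_zero.comp (tendsto_atTop_add_const_right atTop (-q.im)
      tendsto_id)).mul_const C
    simpa [sub_eq_add_neg] using this
  refine norm_le_zero_iff.1 (ge_of_tendsto hlim ?_)
  filter_upwards [eventually_ge_atTop a] with b hb
  rw [hconst b hb]
  refine (norm_integral_le_of_norm_le ((h.integrable (ha.trans_le hb)).norm.const_mul _)
    (ae_of_all _ fun x => hle x b hb)).trans ?_
  rw [integral_const_mul]
  exact mul_le_mul_of_nonneg_left (hC b (ha.trans_le hb)) (inv_nonneg.2 (by linarith))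

lemma IsHardyOne.integral_eq_zero {ψ : ℂ → ℂ} (h : IsHardyOne ψ) {a : ℝ} (ha : 0 < a) :
    ∫ x : ℝ, ψ (x + a * I) = 0 := by
  have hne : ∀ (n : ℕ) (x : ℝ), (x + a * I : ℂ) - (-(n * I) : ℂ) ≠ 0 := fun n x =>
    line_sub_ne_zero (by
      simp
      -- The multipliers $ni/(z+ni)$ are bounded by $1$ on the line and tend to $1$; each multiplied
      -- integral vanishes by the preceding lemma with the pole at $-ni$.
      have : (0 : ℝ) ≤ n := Nat.cast_nonneg n
      linarith)
  have hlim : Tendsto (fun n : ℕ => ∫ x : ℝ, (n * I) * (ψ (x + a * I) /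
      ((x + a * I : ℂ) - (-(n * I) : ℂ)))) atTop (𝓝 (∫ x : ℝ, ψ (x + a * I))) := by
    refine tendsto_integral_of_dominated_convergence (fun x => ‖ψ (x + a * I)‖) (fun n => ?_)
      (h.integrable ha).norm (fun n => ae_of_all _ fun x => ?_) (ae_of_all _ fun x => ?_)
    · exact (continuous_const.mul ((continuous_line h.1 ha).div (by fun_prop)
        (hne n))).aestronglyMeasurable
    · rw [mul_div_left_comm, norm_mul]
      refine mul_le_of_le_one_right (norm_nonneg _) ?_
      rw [norm_div, div_le_one (norm_pos_iff.2 (hne n x))]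
      refine le_trans ?_ le_norm_line_sub
      simp
      exact ha.le
    · have h1 : Tendsto (fun n : ℕ => (x + a * I : ℂ) / n) atTop (𝓝 0) :=
        tendsto_const_div_atTop_nhds_zero_nat _
      have h2 : Tendsto (fun n : ℕ => ψ (x + a * I) * (I / ((x + a * I : ℂ) / n + I))) atTop
          (𝓝 (ψ (x + a * I) * (I / (0 + I)))) :=
        tendsto_const_nhds.mul (tendsto_const_nhds.div (h1.add_const I) (by simp))
      rw [zero_add, div_self I_ne_zero, mul_one] at h2
      refine h2.congr' ?_
      filter_upwards [eventually_gt_atTop 0] with n hn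
      have hn' : (n : ℂ) ≠ 0 := by exact_mod_cast hn.ne'
      have h3 := hne n x
      have h4 : (x + a * I : ℂ) / n + I = ((x + a * I : ℂ) - (-(n * I) : ℂ)) / n := by
        field_simp
        ring
      rw [h4]
      field_simp
  refine tendsto_nhds_unique hlim ?_
  refine tendsto_const_nhds.congr fun n => ?_
  rw [integral_const_mul, h.integral_div_sub_eq_zero ha, mul_zero]
  simp
  have : (0 : ℝ) ≤ n := Nat.cast_nonneg n
  linarith

/-- The point $\bar p+2ai$ is the reflection of `p` in the line $\operatorname{Im}z=a$, so a point
on or above that line is at least as close to `p` as to the reflection. -/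
lemma sq_add_sq_le_norm_mul_norm {x y a : ℝ} {p : ℂ} (ha : a ≤ p.im) (hy : a ≤ y) :
    (x - p.re) ^ 2 + (y - p.im) ^ 2 ≤
      ‖(x + y * I : ℂ) - p‖ * ‖(x + y * I : ℂ) - (conj p + 2 * a * I)‖ := by
  have h1 : ‖(x + y * I : ℂ) - p‖ ^ 2 = (x - p.re) ^ 2 + (y - p.im) ^ 2 := by
    rw [← Complex.normSq_eq_norm_sq, Complex.normSq_apply]
    simp
    ring
  have h2 : ‖(x + y * I : ℂ) - (conj p + 2 * a * I)‖ ^ 2 =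
      (x - p.re) ^ 2 + (y - 2 * a + p.im) ^ 2 := by
    rw [← Complex.normSq_eq_norm_sq, Complex.normSq_apply]
    simp
    ring
  rw [← h1, sq]
  refine mul_le_mul_of_nonneg_left ?_ (norm_nonneg _)
  refine (pow_le_pow_iff_left₀ (norm_nonneg _) (norm_nonneg _) two_ne_zero).1 ?_
  rw [h1, h2]
  nlinarith

lemma line_sub_mul_line_sub (x a : ℝ) (p : ℂ) :
    ((x + a * I : ℂ) - p) * ((x + a * I : ℂ) - (conj p + 2 * a * I)) =
      (((x - p.re) ^ 2 + (p.im - a) ^ 2 : ℝ) : ℂ) := by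
  apply Complex.ext
  · rw [Complex.ofReal_re]
    simp
    ring
  · rw [Complex.ofReal_im]
    simp
    ring

lemma one_div_sub_one_div_eq_poisson_kernel {x a : ℝ} {p : ℂ} (hp : a ≠ p.im) :
    1 / ((x + a * I : ℂ) - p) - 1 / ((x + a * I : ℂ) - (conj p + 2 * a * I)) =
      2 * I * (((p.im - a) / ((x - p.re) ^ 2 + (p.im - a) ^ 2) : ℝ) : ℂ) := by
  have h1 : (x + a * I : ℂ) - p ≠ 0 := line_sub_ne_zero hp
  have h2 : (x + a * I : ℂ) - (conj p + 2 * a * I) ≠ 0 := line_sub_ne_zero (by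
    simp
    contrapose! hp
    linarith)
  have h3 : p - (conj p + 2 * a * I) = 2 * (p.im - a : ℝ) * I := by
    apply Complex.ext
    · simp
    · simp
      ring
  rw [div_sub_div _ _ h1 h2, one_mul, mul_one, sub_sub_sub_cancel_left, line_sub_mul_line_sub, h3]
  push_cast
  ring

/-- The Poisson representation on the line `Im z = a` of functions of class `H¹`. -/
lemma IsHardyOne.integral_poisson {ψ : ℂ → ℂ} (h : IsHardyOne ψ) {a : ℝ} (ha : 0 < a) {p : ℂ}
    (hp : a < p.im) :
    ∫ x : ℝ, ψ (x + a * I) *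
      (1 / ((x + a * I : ℂ) - p) - 1 / ((x + a * I : ℂ) - (conj p + 2 * a * I))) =
      2 * Real.pi * I * ψ p := by
  set q : ℂ := conj p + 2 * a * I with hq
  have hqim : q.im = 2 * a - p.im := by simp [hq]; ring
  have hpq : p - q = 2 * (p.im - a : ℝ) * I := by
    apply Complex.ext
    · simp [hq]
    · simp [hq]; ring
  set κ : ℝ := 2 * (p.im - a) with hκ
  have hκ0 : 0 < κ := by rw [hκ]; linarith
  have hnpq : ‖p - q‖ = κ := by
    rw [hpq, norm_mul, norm_mul, norm_I, Complex.norm_real, Real.norm_of_nonneg (by linarith), hκ]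
    simp
  -- Off `p` this is $(\psi(z)-\psi(p))$ times the difference of the Cauchy kernels at `p` and at
  -- its reflection `q`. The divided slope removes the pole at `p`, and `q` lies below the line, so
  -- Cauchy's theorem applies without residues.
  set f : ℂ → ℂ := fun z => dslope ψ p z * ((p - q) / (z - q)) with hf
  have hpS : {z : ℂ | a ≤ z.im} ∈ 𝓝 p :=
    mem_of_superset ((isOpen_lt continuous_const Complex.continuous_im).mem_nhds hp)
      fun z hz => show a ≤ z.im from le_of_lt hz
  have hψd : DifferentiableOn ℂ ψ {z | a ≤ z.im} := h.1.mono fun z hz => ha.trans_le hz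
  have hfd : DifferentiableOn ℂ f {z | a ≤ z.im} := by
    refine ((Complex.differentiableOn_dslope hpS).2 hψd).mul
      ((differentiableOn_const _).div (by fun_prop) fun z hz h0 => ?_)
    have h1 := congrArg Complex.im h0
    have hz : a ≤ z.im := hz
    simp [hqim] at h1
    linarith
  have hfe : ∀ x y : ℝ, a ≤ y → (x + y * I : ℂ) ≠ p → f (x + y * I) =
      (ψ (x + y * I) - ψ p) * (1 / ((x + y * I : ℂ) - p) - 1 / ((x + y * I : ℂ) - q)) := by
    intro x y hy hne
    have h1 : (x + y * I : ℂ) - p ≠ 0 := sub_ne_zero.2 hne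
    have h2 : (x + y * I : ℂ) - q ≠ 0 := line_sub_ne_zero (by rw [hqim]; linarith)
    rw [hf]
    simp only
    rw [dslope_of_ne _ hne, slope_def_field]
    field_simp
    ring
  have hK : ∀ x y : ℝ, a ≤ y → (x + y * I : ℂ) ≠ p →
      ‖1 / ((x + y * I : ℂ) - p) - 1 / ((x + y * I : ℂ) - q)‖ ≤
        κ / ((x - p.re) ^ 2 + (y - p.im) ^ 2) := by
    intro x y hy hne
    have h1 : (x + y * I : ℂ) - p ≠ 0 := sub_ne_zero.2 hne
    have h2 : (x + y * I : ℂ) - q ≠ 0 := line_sub_ne_zero (by rw [hqim]; linarith)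
    have h3 : 1 / ((x + y * I : ℂ) - p) - 1 / ((x + y * I : ℂ) - q) =
        (p - q) / (((x + y * I : ℂ) - p) * ((x + y * I : ℂ) - q)) := by
      field_simp
      ring
    rw [h3, norm_div, norm_mul, hnpq]
    refine div_le_div_of_nonneg_left hκ0.le ?_ (sq_add_sq_le_norm_mul_norm hp.le hy)
    rcases eq_or_ne x p.re with rfl | hx
    · have : y - p.im ≠ 0 := fun h0 => hne (by
        apply Complex.ext
        · simp
        · simp; linarith)
      positivity
    · have : x - p.re ≠ 0 := sub_ne_zero.2 hx
      positivity
  have hne : ∀ x y : ℝ, y ≠ p.im → (x + y * I : ℂ) ≠ p := fun x y hy h0 =>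
    line_sub_ne_zero (x := x) hy (sub_eq_zero.2 h0)
  have hKd : ∀ x y : ℝ, a ≤ y → y ≠ p.im →
      ‖1 / ((x + y * I : ℂ) - p) - 1 / ((x + y * I : ℂ) - q)‖ ≤
        κ / |y - p.im| * (|y - p.im| / ((x - p.re) ^ 2 + |y - p.im| ^ 2)) := by
    intro x y hy hyp
    refine (hK x y hy (hne x y hyp)).trans_eq ?_
    have : |y - p.im| ≠ 0 := abs_ne_zero.2 (sub_ne_zero.2 hyp)
    rw [sq_abs, div_mul_div_comm, mul_comm κ, mul_div_mul_left _ _ this]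
  have hKb : ∀ x y : ℝ, a ≤ y → y ≠ p.im →
      ‖1 / ((x + y * I : ℂ) - p) - 1 / ((x + y * I : ℂ) - q)‖ ≤ κ / (y - p.im) ^ 2 := by
    intro x y hy hyp
    refine (hK x y hy (hne x y hyp)).trans ?_
    have : y - p.im ≠ 0 := sub_ne_zero.2 hyp
    exact div_le_div_of_nonneg_left hκ0.le (by positivity) (by nlinarith [sq_nonneg (x - p.re)])
  have hKc : ∀ y : ℝ, a ≤ y → y ≠ p.im → Continuous fun x : ℝ =>
      1 / ((x + y * I : ℂ) - p) - 1 / ((x + y * I : ℂ) - q) := by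
    intro y hy hyp
    refine (continuous_const.div (by fun_prop) fun x => line_sub_ne_zero hyp).sub
      (continuous_const.div (by fun_prop) fun x => line_sub_ne_zero ?_)
    rw [hqim]
    linarith
  have hKi : ∀ y : ℝ, a ≤ y → y ≠ p.im → Integrable fun x : ℝ =>
      1 / ((x + y * I : ℂ) - p) - 1 / ((x + y * I : ℂ) - q) := fun y hy hyp =>
    Integrable.mono' ((integrable_poisson_kernel p.re
      (abs_pos.2 (sub_ne_zero.2 hyp))).const_mul _) (hKc y hy hyp).aestronglyMeasurable
      (ae_of_all _ fun x => hKd x y hy hyp)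
  have hψK : ∀ y : ℝ, a ≤ y → y ≠ p.im → Integrable fun x : ℝ => ψ (x + y * I) *
      (1 / ((x + y * I : ℂ) - p) - 1 / ((x + y * I : ℂ) - q)) := fun y hy hyp =>
    (h.integrable (ha.trans_le hy)).mul_bdd (hKc y hy hyp).aestronglyMeasurable
      (ae_of_all _ fun x => hKb x y hy hyp)
  have hfe' : ∀ y : ℝ, a ≤ y → y ≠ p.im → (fun x : ℝ => f (x + y * I)) = fun x : ℝ =>
      ψ (x + y * I) * (1 / ((x + y * I : ℂ) - p) - 1 / ((x + y * I : ℂ) - q)) -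
      ψ p * (1 / ((x + y * I : ℂ) - p) - 1 / ((x + y * I : ℂ) - q)) := fun y hy hyp => by
    funext x
    rw [hfe x y hy (hne x y hyp), sub_mul]
  have hfi : ∀ y : ℝ, a ≤ y → y ≠ p.im → Integrable fun x : ℝ => f (x + y * I) :=
    fun y hy hyp => by
      rw [hfe' y hy hyp]
      exact (hψK y hy hyp).sub ((hKi y hy hyp).const_mul _)
  have hconst : ∀ b : ℝ, p.im < b → ∫ x : ℝ, f (x + a * I) = ∫ x : ℝ, f (x + b * I) := by
    intro b hb
    -- For $|x|\ge 2|\operatorname{Re}p|+1$ one has $|x|\le2|x-\operatorname{Re}p|$ and $x^2\ge1$,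
    -- hence $1+x^2\le8(x-\operatorname{Re}p)^2$; this is the source of `R` and of the factor
    -- $8\kappa$.
    refine h.integral_line_eq ha (hp.trans hb).le hfd (hfi a le_rfl hp.ne)
      (hfi b (hp.trans hb).le hb.ne') (M := 8 * κ * (1 + ‖ψ p‖)) (R := 2 * |p.re| + 1)
      fun x y hx hy => ?_
    have h1 : |x| ≤ 2 * |x - p.re| := by
      have := abs_sub_abs_le_abs_sub x p.re
      have := abs_nonneg p.re
      linarith
    have h2 : 1 + x ^ 2 ≤ 8 * (x - p.re) ^ 2 := by
      have h3 : x ^ 2 ≤ 4 * (x - p.re) ^ 2 := by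
        rw [← sq_abs x, ← sq_abs (x - p.re)]
        nlinarith [abs_nonneg x]
      have h4 : 1 ≤ x ^ 2 := by
        rw [← sq_abs x]
        nlinarith [abs_nonneg p.re]
      linarith
    have hxp : x - p.re ≠ 0 := by
      intro h0
      rw [h0] at h2
      nlinarith [sq_nonneg x]
    have hnep : (x + y * I : ℂ) ≠ p := fun h0 => hxp (by
      have := congrArg Complex.re h0
      simp at this
      linarith)
    have h5 : ‖1 / ((x + y * I : ℂ) - p) - 1 / ((x + y * I : ℂ) - q)‖ ≤
        8 * κ * (1 + x ^ 2)⁻¹ := by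
      refine (hK x y hy hnep).trans ?_
      rw [← div_eq_mul_inv, div_le_div_iff₀ (by positivity) (by positivity)]
      nlinarith [sq_nonneg (y - p.im)]
    have h6 : (1 + x ^ 2)⁻¹ ≤ 1 := inv_le_one_of_one_le₀ (by nlinarith [sq_nonneg x])
    have h7 : 0 ≤ (1 + x ^ 2)⁻¹ := by positivity
    rw [hfe x y hy hnep, norm_mul]
    calc ‖ψ (x + y * I) - ψ p‖ * ‖1 / ((x + y * I : ℂ) - p) - 1 / ((x + y * I : ℂ) - q)‖
        ≤ (‖ψ (x + y * I)‖ + ‖ψ p‖) * (8 * κ * (1 + x ^ 2)⁻¹) :=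
          mul_le_mul (norm_sub_le _ _) h5 (norm_nonneg _) (by positivity)
      _ = 8 * κ * (1 + x ^ 2)⁻¹ * ‖ψ (x + y * I)‖ + 8 * κ * ‖ψ p‖ * (1 + x ^ 2)⁻¹ := by ring
      _ ≤ 8 * κ * (1 + ‖ψ p‖) * ‖ψ (x + y * I)‖ + 8 * κ * (1 + ‖ψ p‖) * (1 + x ^ 2)⁻¹ := by
          refine add_le_add (mul_le_mul_of_nonneg_right ?_ (norm_nonneg _))
            (mul_le_mul_of_nonneg_right ?_ h7)
          · have : 0 ≤ 8 * κ * ‖ψ p‖ := by positivity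
            nlinarith
          · linarith
  obtain ⟨C, hC⟩ := h.exists_integral_norm_le
  -- As $b\to\infty$, the $\psi$-part is at most $C\kappa/(b-\operatorname{Im}p)^2$, and the
  -- constant part is at most $|\psi(p)|\,\pi\kappa/(b-\operatorname{Im}p)$.
  have hzero : ∫ x : ℝ, f (x + a * I) = 0 := by
    have hlim : Tendsto (fun b : ℝ => C * (κ / (b - p.im) ^ 2) + ‖ψ p‖ * (κ / (b - p.im) * Real.pi))
        atTop (𝓝 0) := by
      have h1 : Tendsto (fun b : ℝ => b - p.im) atTop atTop :=
        tendsto_atTop_add_const_right atTop (-p.im) tendsto_id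
      have h2 : Tendsto (fun b : ℝ => κ / (b - p.im)) atTop (𝓝 0) := h1.const_div_atTop κ
      have h3 : Tendsto (fun b : ℝ => κ / (b - p.im) ^ 2) atTop (𝓝 0) :=
        ((tendsto_pow_atTop two_ne_zero).comp h1).const_div_atTop κ
      simpa using (h3.const_mul C).add ((h2.mul_const Real.pi).const_mul ‖ψ p‖)
    refine norm_le_zero_iff.1 (ge_of_tendsto hlim ?_)
    filter_upwards [eventually_gt_atTop p.im] with b hb
    have hba : a ≤ b := (hp.trans hb).le
    have hb' : 0 < b - p.im := sub_pos.2 hb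
    have hint := ((h.integrable (ha.trans_le hba)).norm.mul_const (κ / (b - p.im) ^ 2)).add
      (((integrable_poisson_kernel p.re hb').const_mul (κ / (b - p.im))).const_mul ‖ψ p‖)
    rw [hconst b hb]
    refine (norm_integral_le_of_norm_le hint (ae_of_all _ fun x => ?_)).trans ?_
    · rw [congrFun (hfe' b hba hb.ne') x]
      refine (norm_sub_le _ _).trans ?_
      rw [norm_mul, norm_mul]
      have := hKd x b hba hb.ne'
      rw [abs_of_pos hb'] at this
      exact add_le_add (mul_le_mul_of_nonneg_left (hKb x b hba hb.ne') (norm_nonneg _))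
        (mul_le_mul_of_nonneg_left this (norm_nonneg _))
    · simp only [Pi.add_apply]
      rw [integral_add ((h.integrable (ha.trans_le hba)).norm.mul_const _)
        (((integrable_poisson_kernel p.re hb').const_mul _).const_mul _), integral_mul_const,
        integral_const_mul, integral_const_mul, integral_poisson_kernel p.re hb']
      gcongr
      exact hC b (ha.trans_le hba)
  rw [hfe' a le_rfl hp.ne, integral_sub (hψK a le_rfl hp.ne) ((hKi a le_rfl hp.ne).const_mul _),
    integral_const_mul, sub_eq_zero] at hzero
  rw [hzero, mul_comm (2 * Real.pi * I : ℂ)]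
  congr 1
  have hpa : 0 < p.im - a := sub_pos.2 hp
  have hreal := fun x : ℝ => one_div_sub_one_div_eq_poisson_kernel (x := x) hp.ne
  rw [← hq] at hreal
  simp_rw [hreal]
  rw [integral_const_mul, integral_complex_ofReal, integral_poisson_kernel _ hpa]
  ring

/-- Cauchy's formula for functions of class `H¹`. -/
lemma IsHardyOne.integral_div_sub {ψ : ℂ → ℂ} (h : IsHardyOne ψ) {a : ℝ} (ha : 0 < a) {p : ℂ}
    (hp : a < p.im) :
    ∫ x : ℝ, ψ (x + a * I) / ((x + a * I : ℂ) - p) = 2 * Real.pi * I * ψ p := by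
  have hb : ∀ q : ℂ, a ≠ q.im → Integrable fun x : ℝ => ψ (x + a * I) / ((x + a * I : ℂ) - q) := by
    intro q hq
    simp_rw [div_eq_mul_inv]
    refine (h.integrable ha).mul_bdd (c := |a - q.im|⁻¹) ?_ (ae_of_all _ fun x => ?_)
    · exact (Continuous.inv₀ (by fun_prop) fun x => line_sub_ne_zero hq).aestronglyMeasurable
    · rw [norm_inv]
      refine inv_anti₀ (abs_pos.2 (sub_ne_zero.2 hq)) ?_
      have := Complex.abs_im_le_norm ((x + a * I : ℂ) - q)
      simpa using this
  have hqa : (conj p + 2 * a * I).im < a := by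
    simp
    linarith
  rw [← h.integral_poisson ha hp]
  simp_rw [mul_sub, mul_one_div]
  rw [integral_sub (hb p hp.ne) (hb _ hqa.ne'), h.integral_div_sub_eq_zero ha hqa, sub_zero]

/-! ### Boundary functions -/

lemma integrable_mul_of_memLp_two {f g : ℝ → ℂ} (hf : MemLp f 2) (hg : MemLp g 2) :
    Integrable fun x => f x * g x :=
  hf.integrable_mul hg

/-- An `L²`-bounded family that converges almost everywhere converges weakly. -/
lemma tendsto_integral_mul_of_ae_tendsto {ι : Type*} {l : Filter ι} [l.IsCountablyGenerated]
    {H : ι → ℝ → ℂ} {u φ : ℝ → ℂ} {C : ℝ≥0∞} (hC : C < ⊤)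
    (hHm : ∀ᶠ i in l, AEStronglyMeasurable (H i)) (hHb : ∀ᶠ i in l, ∫⁻ x, ‖H i x‖ₑ ^ 2 ≤ C)
    (hu : MemLp u 2) (hlim : ∀ᵐ x, Tendsto (fun i => H i x) l (𝓝 (u x))) (hφ : MemLp φ 2) :
    Tendsto (fun i => ∫ x, H i x * φ x) l (𝓝 (∫ x, u x * φ x)) := by
  have hφ2 := (memLp_two_iff_lintegral hφ.1).1 hφ
  have hu2 := (memLp_two_iff_lintegral hu.1).1 hu
  set C' : ℝ≥0∞ := 2 * C + 2 * ∫⁻ x, ‖u x‖ₑ ^ 2 with hC'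
  have hC'top : C' ≠ ⊤ := by
    rw [hC']
    exact ENNReal.add_ne_top.2 ⟨ENNReal.mul_ne_top (by simp) hC.ne,
      ENNReal.mul_ne_top (by simp) hu2.ne⟩
  have hdiff : ∀ᶠ i in l, ∫⁻ x, ‖H i x - u x‖ₑ ^ 2 ≤ C' := by
    filter_upwards [hHm, hHb] with i hm hb
    calc ∫⁻ x, ‖H i x - u x‖ₑ ^ 2 ≤ ∫⁻ x, (2 * ‖H i x‖ₑ ^ 2 + 2 * ‖u x‖ₑ ^ 2) := by
          refine lintegral_mono fun x => ?_
          refine (pow_le_pow_left' enorm_sub_le 2).trans ?_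
          rw [← mul_add, enorm_eq_nnnorm, enorm_eq_nnnorm]
          exact_mod_cast add_sq_le (a := ‖H i x‖₊) (b := ‖u x‖₊)
      _ = 2 * (∫⁻ x, ‖H i x‖ₑ ^ 2) + 2 * ∫⁻ x, ‖u x‖ₑ ^ 2 := by
          rw [lintegral_add_left' ((hm.enorm.pow_const _).const_mul _),
            lintegral_const_mul' _ _ (by simp), lintegral_const_mul' _ _ (by simp)]
      _ ≤ C' := by
          rw [hC']
          gcongr
  -- Truncation at level $Kf$: where $h\le Kf$ the first term already suffices, and elsewhere $fh\le
  -- K^{-1}h^2$. With $f=|\varphi|$ and $h=|H_i-u|$, the truncated part tends to $0$ by domination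
  -- by $K|\varphi|^2$, and the remainder is at most $C'/K$ uniformly in $i$.
  have hpt : ∀ f h K : ℝ≥0∞, K ≠ 0 → K ≠ ⊤ →
      f * h ≤ f * min h (K * f) + K⁻¹ * h ^ 2 := by
    intro f h K hK hK'
    rcases le_total h (K * f) with hle | hle
    · rw [min_eq_left hle]
      exact le_self_add
    · refine le_trans ?_ le_add_self
      rw [sq, ← mul_assoc]
      refine mul_le_mul_left ?_ _
      rw [← ENNReal.div_eq_inv_mul, ENNReal.le_div_iff_mul_le (Or.inl hK) (Or.inl hK'), mul_comm]
      exact hle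
  have hmin : ∀ K : ℝ≥0∞, K ≠ ⊤ →
      Tendsto (fun i => ∫⁻ x, ‖φ x‖ₑ * min ‖H i x - u x‖ₑ (K * ‖φ x‖ₑ)) l (𝓝 0) := by
    intro K hK
    have h0 : ∫⁻ _ : ℝ, (0 : ℝ≥0∞) = 0 := by simp
    rw [← h0]
    refine tendsto_lintegral_filter_of_dominated_convergence' (fun x => K * ‖φ x‖ₑ ^ 2) ?_ ?_ ?_ ?_
    · filter_upwards [hHm] with i hm
      exact hφ.1.enorm.mul ((hm.sub hu.1).enorm.min (hφ.1.enorm.const_mul _))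
    · refine Eventually.of_forall fun i => ae_of_all _ fun x => ?_
      calc ‖φ x‖ₑ * min ‖H i x - u x‖ₑ (K * ‖φ x‖ₑ) ≤ ‖φ x‖ₑ * (K * ‖φ x‖ₑ) :=
            mul_le_mul_right (min_le_right _ _) _
        _ = K * ‖φ x‖ₑ ^ 2 := by ring
    · rw [lintegral_const_mul' _ _ hK]
      exact ENNReal.mul_ne_top hK hφ2.ne
    · filter_upwards [hlim] with x hx
      have h1 : Tendsto (fun i => ‖H i x - u x‖ₑ) l (𝓝 0) := by
        have := (hx.sub_const (u x)).enorm
        simpa using this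
      have h2 : Tendsto (fun i => ‖φ x‖ₑ * ‖H i x - u x‖ₑ) l (𝓝 0) := by
        simpa using ENNReal.Tendsto.const_mul h1 (Or.inr (by simp))
      exact tendsto_of_tendsto_of_tendsto_of_le_of_le tendsto_const_nhds h2
        (fun _ => zero_le) fun i => mul_le_mul_right (min_le_left _ _) _
  have hzero : Tendsto (fun i => ∫⁻ x, ‖φ x‖ₑ * ‖H i x - u x‖ₑ) l (𝓝 0) := by
    rw [ENNReal.tendsto_nhds_zero]
    intro ε hε
    rcases eq_or_ne ε ⊤ with rfl | hεt
    · simp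
    have hε2 : ε / 2 ≠ 0 := by simpa using hε.ne'
    have hε2t : ε / 2 ≠ ⊤ := ENNReal.div_ne_top hεt (by simp)
    set K : ℝ≥0∞ := C' / (ε / 2) + 1 with hK
    have hK0 : K ≠ 0 := by simp [hK]
    have hKt : K ≠ ⊤ := ENNReal.add_ne_top.2 ⟨ENNReal.div_ne_top hC'top hε2, by simp⟩
    filter_upwards [hdiff, hHm, ENNReal.tendsto_nhds_zero.1 (hmin K hKt) (ε / 2)
      (pos_iff_ne_zero.2 hε2)] with i h1 hm h2
    calc ∫⁻ x, ‖φ x‖ₑ * ‖H i x - u x‖ₑ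
        ≤ ∫⁻ x, (‖φ x‖ₑ * min ‖H i x - u x‖ₑ (K * ‖φ x‖ₑ) + K⁻¹ * ‖H i x - u x‖ₑ ^ 2) :=
          lintegral_mono fun x => hpt _ _ K hK0 hKt
      _ = (∫⁻ x, ‖φ x‖ₑ * min ‖H i x - u x‖ₑ (K * ‖φ x‖ₑ)) +
            K⁻¹ * ∫⁻ x, ‖H i x - u x‖ₑ ^ 2 := by
          have hmm : AEMeasurable fun x => ‖φ x‖ₑ * min ‖H i x - u x‖ₑ (K * ‖φ x‖ₑ) :=
            hφ.1.enorm.mul ((hm.sub hu.1).enorm.min (hφ.1.enorm.const_mul _))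
          rw [lintegral_add_left' hmm, lintegral_const_mul' _ _ (ENNReal.inv_ne_top.2 hK0)]
      _ ≤ ε / 2 + ε / 2 := by
          refine add_le_add h2 ((mul_le_mul_right h1 _).trans ?_)
          rw [← ENNReal.div_eq_inv_mul, ENNReal.div_le_iff_le_mul (Or.inl hK0) (Or.inl hKt)]
          calc C' = ε / 2 * (C' / (ε / 2)) := (ENNReal.mul_div_cancel hε2 hε2t).symm
            _ ≤ ε / 2 * K := mul_le_mul_right le_self_add _
      _ = ε := ENNReal.add_halves ε
  rw [tendsto_iff_edist_tendsto_0]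
  refine tendsto_of_tendsto_of_tendsto_of_le_of_le' tendsto_const_nhds hzero
    (Eventually.of_forall fun _ => zero_le) ?_
  filter_upwards [hHm, hHb] with i hm hb
  have hH : MemLp (H i) 2 := (memLp_two_iff_lintegral hm).2 (hb.trans_lt hC)
  rw [edist_eq_enorm_sub, ← integral_sub (integrable_mul_of_memLp_two hH hφ)
    (integrable_mul_of_memLp_two hu hφ)]
  refine (enorm_integral_le_lintegral_enorm _).trans_eq (lintegral_congr fun x => ?_)
  rw [← sub_mul, enorm_mul, mul_comm]

lemma tendsto_one_div_nat_nhdsGT : Tendsto (fun n : ℕ => 1 / ((n : ℝ) + 1)) atTop (𝓝[>] 0) :=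
  tendsto_nhdsWithin_iff.2 ⟨tendsto_one_div_add_atTop_nhds_zero_nat,
    Eventually.of_forall fun n => by
      have : (0 : ℝ) < 1 / ((n : ℝ) + 1) := by positivity
      exact this⟩

lemma HasBoundaryFun.aestronglyMeasurable {G : ℂ → ℂ} {u : ℝ → ℂ} (hb : HasBoundaryFun G u)
    (hd : DifferentiableOn ℂ G upperHalf) : AEStronglyMeasurable u := by
  refine aestronglyMeasurable_of_tendsto_ae atTop
    (f := fun (n : ℕ) (x : ℝ) => G (x + ((1 / ((n : ℝ) + 1) : ℝ) : ℂ) * I))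
    (fun n => (continuous_line hd (by positivity)).aestronglyMeasurable) ?_
  filter_upwards [hb] with x hx
  exact hx.comp tendsto_one_div_nat_nhdsGT

/-- Fatou's lemma along the heights $1/(n+1)$. -/
lemma IsHardyTwo.memLp_boundary {G : ℂ → ℂ} {u : ℝ → ℂ} (h : IsHardyTwo G)
    (hb : HasBoundaryFun G u) : MemLp u 2 := by
  obtain ⟨hd, C, hC, hC'⟩ := h
  refine (memLp_two_iff_lintegral (hb.aestronglyMeasurable hd)).2 (lt_of_le_of_lt ?_ hC)
  have hlim : ∀ᵐ x, ‖u x‖ₑ ^ 2 = liminf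
      (fun n : ℕ => ‖G (x + ((1 / ((n : ℝ) + 1) : ℝ) : ℂ) * I)‖ₑ ^ 2) atTop := by
    filter_upwards [hb] with x hx
    have h1 := ENNReal.Tendsto.pow (n := 2) (hx.comp tendsto_one_div_nat_nhdsGT).enorm
    exact h1.liminf_eq.symm
  rw [lintegral_congr_ae hlim]
  refine (lintegral_liminf_le fun n => ?_).trans ?_
  · exact (continuous_line hd (by positivity)).enorm.measurable.pow_const _
  · exact liminf_le_of_le (by isBoundedDefault) fun b hb' => by
      obtain ⟨n, hn⟩ := hb'.exists
      exact hn.trans (hC' _ (by positivity))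

lemma tendsto_add_mul_I {G : ℂ → ℂ} (hd : DifferentiableOn ℂ G upperHalf) {p : ℂ}
    (hp : p ∈ upperHalf) : Tendsto (fun ε : ℝ => G (p + ε * I)) (𝓝[>] 0) (𝓝 (G p)) := by
  have h1 : ContinuousAt G p := (hd.differentiableAt (isOpen_upperHalf.mem_nhds hp)).continuousAt
  have h2 : Tendsto (fun ε : ℝ => p + ε * I) (𝓝 0) (𝓝 p) := by
    have : Continuous fun ε : ℝ => p + ε * I := by fun_prop
    simpa using this.tendsto 0
  exact (h1.tendsto.comp h2).mono_left nhdsWithin_le_nhds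

/-- Passing to boundary values in an integral over two different horizontal lines. -/
lemma integral_boundary_mul_boundary {g G : ℂ → ℂ} {g₀ u k : ℝ → ℂ} (hg : IsHardyTwo g)
    (hG : IsHardyTwo G) (hgb : HasBoundaryFun g g₀) (hGb : HasBoundaryFun G u)
    (hk : Continuous k) {M : ℝ} (hkM : ∀ x, ‖k x‖ ≤ M) {A p : ℂ} (hp : p ∈ upperHalf)
    (hA : ∀ ε δ : ℝ, 0 < ε → ε < δ → ε < p.im →
      ∫ x : ℝ, g (x + ε * I) * (G (x + δ * I) * k x) = A * (g (p + ε * I) * G (p + δ * I))) :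
    ∫ x : ℝ, g₀ x * u x * k x = A * (g p * G p) := by
  have hg₀ := hg.memLp_boundary hgb
  have hu := hG.memLp_boundary hGb
  have hbdd : ∀ {f : ℝ → ℂ}, MemLp f 2 → MemLp (fun x => f x * k x) 2 := fun {f} hf => by
    refine MemLp.of_le_mul (c := M) hf (hf.1.mul hk.aestronglyMeasurable) (ae_of_all _ fun x => ?_)
    rw [norm_mul, mul_comm]
    exact mul_le_mul_of_nonneg_right (hkM x) (norm_nonneg _)
  have hweak : ∀ {F : ℂ → ℂ} {f φ : ℝ → ℂ}, IsHardyTwo F → HasBoundaryFun F f → MemLp φ 2 →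
      Tendsto (fun y : ℝ => ∫ x : ℝ, F (x + y * I) * φ x) (𝓝[>] 0) (𝓝 (∫ x, f x * φ x)) := by
    intro F f φ hF hFb hφ
    obtain ⟨hd, C, hC, hC'⟩ := id hF
    refine tendsto_integral_mul_of_ae_tendsto hC ?_ ?_ (hF.memLp_boundary hFb) hFb hφ
    · filter_upwards [self_mem_nhdsWithin] with y hy
      exact (continuous_line hd hy).aestronglyMeasurable
    · filter_upwards [self_mem_nhdsWithin] with y hy
      exact hC' y hy
  -- The two heights allow successive limits. For fixed `δ`, the function $G(\cdot+i\delta)k$ is a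
  -- fixed $L^2$ test function for the weak convergence as $\varepsilon\downarrow0$; afterwards
  -- $g_0k$ plays that role as $\delta\downarrow0$.
  have hstep : ∀ δ : ℝ, 0 < δ → ∫ x : ℝ, g₀ x * (G (x + δ * I) * k x) =
      A * (g p * G (p + δ * I)) := by
    intro δ hδ
    have h1 := hweak hg hgb (hbdd (hG.memLp hδ))
    have h2 : Tendsto (fun ε : ℝ => A * (g (p + ε * I) * G (p + δ * I))) (𝓝[>] 0)
        (𝓝 (A * (g p * G (p + δ * I)))) :=
      ((tendsto_add_mul_I hg.1 hp).mul_const _).const_mul _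
    have hm : (0 : ℝ) < min δ p.im := lt_min hδ hp
    refine tendsto_nhds_unique h1 (h2.congr' ?_)
    filter_upwards [Ioo_mem_nhdsGT hm] with ε hε
    exact (hA ε δ hε.1 (hε.2.trans_le (min_le_left _ _))
      (hε.2.trans_le (min_le_right _ _))).symm
  have h1 := hweak hG hGb (hbdd hg₀)
  have h2 : Tendsto (fun δ : ℝ => A * (g p * G (p + δ * I))) (𝓝[>] 0) (𝓝 (A * (g p * G p))) :=
    ((tendsto_add_mul_I hG.1 hp).const_mul _).const_mul _
  have h3 : ∫ x : ℝ, g₀ x * u x * k x = ∫ x, u x * (g₀ x * k x) :=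
    integral_congr_ae (ae_of_all _ fun x => by ring)
  rw [h3]
  refine tendsto_nhds_unique h1 (h2.congr' ?_)
  filter_upwards [self_mem_nhdsWithin] with δ hδ
  rw [← hstep δ hδ]
  exact integral_congr_ae (ae_of_all _ fun x => by ring)

/-- Cauchy's theorem for the product of two functions of class `H²`. -/
theorem integral_boundary_mul_eq_zero {g G : ℂ → ℂ} {g₀ u : ℝ → ℂ} (hg : IsHardyTwo g)
    (hG : IsHardyTwo G) (hgb : HasBoundaryFun g g₀) (hGb : HasBoundaryFun G u) :
    ∫ x : ℝ, g₀ x * u x = 0 := by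
  -- With `A = 0` the point `p = I` plays no part. The function $g(z)G(z+i(\delta-\varepsilon))$ is
  -- of class $H^1$, and its integral over height `ε` vanishes.
  have h1 := integral_boundary_mul_boundary hg hG hgb hGb (k := fun _ => 1) continuous_const
    (M := 1) (by simp) (A := 0) (p := I) (by simp [upperHalf]) fun ε δ hε hεδ _ => by
      have := (hg.mul (hG.shift (c := δ - ε) (by linarith))).integral_eq_zero hε
      rw [zero_mul, ← this]
      refine integral_congr_ae (ae_of_all _ fun x => ?_)
      simp only
      rw [mul_one]
      congr 2
      push_cast
      ring
  simpa using h1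

/-- Cauchy's formula for the product of two functions of class `H²`. -/
theorem integral_boundary_mul_div {g G : ℂ → ℂ} {g₀ u : ℝ → ℂ} (hg : IsHardyTwo g)
    (hG : IsHardyTwo G) (hgb : HasBoundaryFun g g₀) (hGb : HasBoundaryFun G u) {p : ℂ}
    (hp : p ∈ upperHalf) :
    ∫ x : ℝ, g₀ x * u x / (x - p) = 2 * Real.pi * I * (g p * G p) := by
  have hp' : 0 < p.im := hp
  have hne : ∀ x : ℝ, (x - p : ℂ) ≠ 0 := fun x h0 => by
    have := congrArg Complex.im h0
    simp at this
    exact hp'.ne' this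
  simp_rw [div_eq_mul_inv]
  refine integral_boundary_mul_boundary hg hG hgb hGb (k := fun x => ((x : ℂ) - p)⁻¹)
    (Continuous.inv₀ (by fun_prop) hne) (M := p.im⁻¹) (fun x => ?_) hp fun ε δ hε hεδ _ => ?_
  · rw [norm_inv]
    refine inv_anti₀ hp' ?_
    have := Complex.abs_im_le_norm (x - p : ℂ)
    simp only [sub_im, ofReal_im, zero_sub, abs_neg] at this
    exact (le_abs_self _).trans this
  · have := (hg.mul (hG.shift (c := δ - ε) (by linarith))).integral_div_sub hε
      (p := p + ε * I) (by simpa using hp')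
    have hδ : (ε : ℂ) * I + ((δ - ε : ℝ) : ℂ) * I = δ * I := by
      push_cast
      ring
    simp_rw [add_assoc, hδ] at this
    rw [← this]
    refine integral_congr_ae (ae_of_all _ fun x => ?_)
    simp only
    rw [add_sub_add_right_eq_sub, div_eq_mul_inv, mul_assoc]

/-! ### The Poisson representation and Fatou's theorem -/

lemma norm_line_sub_sq (x y : ℝ) (q : ℂ) :
    ‖(x + y * I : ℂ) - q‖ ^ 2 = (x - q.re) ^ 2 + (y - q.im) ^ 2 := by
  rw [← Complex.normSq_eq_norm_sq, Complex.normSq_apply]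
  simp
  ring

lemma lintegral_poisson_kernel (x : ℝ) {y : ℝ} (hy : 0 < y) :
    ∫⁻ t : ℝ, ENNReal.ofReal (y / ((t - x) ^ 2 + y ^ 2)) = ENNReal.ofReal Real.pi := by
  rw [← integral_poisson_kernel x hy, ofReal_integral_eq_lintegral_ofReal
    (integrable_poisson_kernel x hy) (ae_of_all _ fun t => by positivity)]

/-- The quotient of a bounded holomorphic function by `z - q` is of class `H²` for `q` in the
lower half-plane. -/
lemma IsHardyInfty.isHardyTwo_div_sub {E : ℂ → ℂ} (hE : IsHardyInfty E) {q : ℂ} (hq : q.im < 0) :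
    IsHardyTwo fun z => E z / (z - q) := by
  obtain ⟨hd, M, hM⟩ := hE
  have hM0 : 0 ≤ M := (norm_nonneg _).trans (hM I (by simp [upperHalf]))
  refine ⟨hd.div (by fun_prop) fun z hz h0 => ?_,
    ENNReal.ofReal (M ^ 2 / (-q.im)) * ENNReal.ofReal Real.pi,
    ENNReal.mul_lt_top (by simp) (by simp), fun y hy => ?_⟩
  · have h1 := congrArg Complex.im h0
    have hz : 0 < z.im := hz
    simp at h1
    linarith
  have hyq : 0 < y - q.im := by linarith
  calc ∫⁻ x : ℝ, ‖E (x + y * I) / ((x + y * I : ℂ) - q)‖ₑ ^ 2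
      ≤ ∫⁻ x : ℝ, ENNReal.ofReal (M ^ 2 / (-q.im)) *
          ENNReal.ofReal ((y - q.im) / ((x - q.re) ^ 2 + (y - q.im) ^ 2)) := by
        refine lintegral_mono fun x => ?_
        rw [← ofReal_norm, ← ENNReal.ofReal_pow (norm_nonneg _),
          ← ENNReal.ofReal_mul (div_nonneg (sq_nonneg _) (by linarith))]
        refine ENNReal.ofReal_le_ofReal ?_
        rw [norm_div, div_pow, norm_line_sub_sq, div_mul_div_comm,
          div_le_div_iff₀ (by positivity) (mul_pos (by linarith) (by positivity))]
        have h1 : ‖E (x + y * I)‖ ^ 2 ≤ M ^ 2 :=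
          pow_le_pow_left₀ (norm_nonneg _) (hM _ (mem_upperHalf_line hy)) 2
        calc ‖E (x + y * I)‖ ^ 2 * (-q.im * ((x - q.re) ^ 2 + (y - q.im) ^ 2))
            ≤ M ^ 2 * ((y - q.im) * ((x - q.re) ^ 2 + (y - q.im) ^ 2)) := by
              refine mul_le_mul h1 (mul_le_mul_of_nonneg_right (by linarith) (by positivity))
                (mul_nonneg (by linarith) (by positivity)) (by positivity)
          _ = _ := by ring
    _ = ENNReal.ofReal (M ^ 2 / (-q.im)) * ENNReal.ofReal Real.pi := by
        rw [lintegral_const_mul' _ _ ENNReal.ofReal_ne_top, lintegral_poisson_kernel _ hyq]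

lemma isHardyInfty_const (c : ℂ) : IsHardyInfty fun _ => c :=
  ⟨differentiableOn_const c, ‖c‖, fun _ _ => le_rfl⟩

/-- The Poisson representation on horizontal lines of functions of class `H²`. -/
lemma IsHardyTwo.integral_poisson {G : ℂ → ℂ} (hG : IsHardyTwo G) {p : ℂ} {a : ℝ} (ha : 0 < a)
    (hp : a < p.im) :
    ∫ x : ℝ, G (x + a * I) * ((p.im / ((x - p.re) ^ 2 + p.im ^ 2) : ℝ) : ℂ) =
      Real.pi * G (p + a * I) := by
  set p' : ℂ := p + a * I with hp'
  have him : p'.im = p.im + a := by simp [hp']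
  have hre : p'.re = p.re := by simp [hp']
  -- The reflection of `p'` in the line $\operatorname{Im}z=a$. As $a<\operatorname{Im}p$, it lies
  -- in the lower half-plane, so $1/(z-q)$ is in $H^2$ and Cauchy's formula applies to $G(z)/(z-q)$;
  -- on the line $(z-q)(z-p')$ is real and produces the Poisson kernel.
  set q : ℂ := conj p' + 2 * a * I with hq
  have hqim : q.im = a - p.im := by
    simp [hq, him]
    ring
  have hpq : p' - q = 2 * p.im * I := by
    apply Complex.ext
    · simp [hq]
    · simp [hq, him]
      ring
  have h1 := (hG.mul ((isHardyInfty_const 1).isHardyTwo_div_sub (q := q)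
    (by linarith))).integral_div_sub ha (p := p') (by linarith)
  have hpim : (p.im : ℂ) ≠ 0 := by exact_mod_cast (ha.trans hp).ne'
  have h2 : ∀ x : ℝ, G (x + a * I) * (1 / ((x + a * I : ℂ) - q)) / ((x + a * I : ℂ) - p') =
      (1 / p.im) * (G (x + a * I) * ((p.im / ((x - p.re) ^ 2 + p.im ^ 2) : ℝ) : ℂ)) := by
    intro x
    have h3 := line_sub_mul_line_sub x a p'
    rw [hre, him, add_sub_cancel_right, ← hq] at h3
    rw [mul_one_div, div_div, mul_comm (_ - q), h3]
    push_cast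
    field_simp
  simp_rw [h2] at h1
  rw [integral_const_mul, hpq] at h1
  have h4 : (∫ x : ℝ, G (x + a * I) * ((p.im / ((x - p.re) ^ 2 + p.im ^ 2) : ℝ) : ℂ)) =
      p.im * (2 * Real.pi * I * (G p' * (1 / (2 * p.im * I)))) := by
    rw [← h1]
    field_simp
  rw [h4]
  field_simp

lemma memLp_poisson_kernel (x : ℝ) {y : ℝ} (hy : 0 < y) :
    MemLp (fun t : ℝ => ((y / ((t - x) ^ 2 + y ^ 2) : ℝ) : ℂ)) 2 := by
  have hm : AEStronglyMeasurable fun t : ℝ => ((y / ((t - x) ^ 2 + y ^ 2) : ℝ) : ℂ) := by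
    have := continuous_poisson_kernel x hy
    exact Continuous.aestronglyMeasurable (by fun_prop)
  refine (memLp_two_iff_integrable_sq_norm hm).2 ?_
  refine ((integrable_poisson_kernel x hy).const_mul (1 / y)).mono' (hm.norm.pow 2)
    (ae_of_all _ fun t => ?_)
  rw [Real.norm_of_nonneg (by positivity), Complex.norm_real, Real.norm_of_nonneg (by positivity),
    sq]
  refine mul_le_mul_of_nonneg_right ?_ (by positivity)
  rw [div_le_div_iff₀ (by positivity) hy]
  nlinarith [sq_nonneg (t - x)]

lemma integrable_div_one_add_sq_of_memLp {u : ℝ → ℂ} (hu : MemLp u 2) :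
    Integrable fun t : ℝ => u t / (1 + t ^ 2) := by
  refine (integrable_mul_of_memLp_two hu (memLp_poisson_kernel 0 one_pos)).congr
    (ae_of_all _ fun t => ?_)
  simp [div_eq_mul_inv, add_comm]

/-- A function whose values are Poisson integrals of `u ∈ L²` has the boundary function `u`. -/
lemma hasBoundaryFun_of_poisson {G : ℂ → ℂ} {u : ℝ → ℂ} (hu : MemLp u 2)
    (h : ∀ x y : ℝ, 0 < y → Real.pi * G (x + y * I) =
      ∫ t : ℝ, ((y / ((t - x) ^ 2 + y ^ 2) : ℝ) : ℂ) * u t) : HasBoundaryFun G u := by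
  filter_upwards [ae_tendsto_poisson_integral (integrable_div_one_add_sq_of_memLp hu)] with x hx
  have hπ : (Real.pi : ℂ) ≠ 0 := by exact_mod_cast Real.pi_ne_zero
  have h1 := hx.const_mul (Real.pi : ℂ)⁻¹
  rw [inv_mul_cancel_left₀ hπ] at h1
  refine h1.congr' ?_
  filter_upwards [self_mem_nhdsWithin] with y hy
  rw [← h x y hy, inv_mul_cancel_left₀ hπ]

/-- Bounded sequences in a Hilbert space converge weakly along an ultrafilter. -/
lemma exists_weak_limit {H : Type*} [NormedAddCommGroup H] [InnerProductSpace ℂ H]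
    [CompleteSpace H] (U : Ultrafilter ℕ) (g : ℕ → H) (C : ℝ) (hg : ∀ n, ‖g n‖ ≤ C) :
    ∃ u : H, ∀ v : H, Tendsto (fun n => inner ℂ (g n) v) U (𝓝 (inner ℂ u v)) := by
  set φ : ℕ → WeakDual ℂ H := fun n => StrongDual.toWeakDual (InnerProductSpace.toDual ℂ H (g n))
  have hK := WeakDual.isCompact_closedBall (𝕜 := ℂ) (E := H) 0 C
  obtain ⟨ℓ, -, hℓ⟩ := hK.ultrafilter_le_nhds (U.map φ) (by
    rw [Ultrafilter.coe_map, le_principal_iff]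
    refine mem_map.2 (Eventually.of_forall fun n => ?_)
    simpa [φ] using hg n)
  refine ⟨(InnerProductSpace.toDual ℂ H).symm (WeakDual.toStrongDual ℓ), fun v => ?_⟩
  rw [InnerProductSpace.toDual_symm_apply]
  have h1 : Tendsto φ U (𝓝 ℓ) := hℓ
  exact ((WeakBilin.eval_continuous _ v).tendsto ℓ).comp h1

/-- Fatou's theorem for the class `H²`. -/
theorem IsHardyTwo.exists_hasBoundaryFun {G : ℂ → ℂ} (hG : IsHardyTwo G) :
    ∃ u : ℝ → ℂ, HasBoundaryFun G u := by
  obtain ⟨hd, C, hC, hb⟩ := id hG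
  have hpos : ∀ n : ℕ, 0 < 1 / ((n : ℝ) + 1) := fun n => by positivity
  set g : ℕ → Lp ℂ 2 (volume : Measure ℝ) := fun n => (hG.memLp (hpos n)).toLp _ with hgdef
  have hgb : ∀ n, ‖g n‖ ≤ (C ^ (1 / 2 : ℝ)).toReal := by
    intro n
    rw [hgdef, Lp.norm_toLp]
    refine ENNReal.toReal_mono (ENNReal.rpow_ne_top_of_nonneg (by norm_num) hC.ne) ?_
    rw [eLpNorm_eq_lintegral_rpow_enorm_toReal (by simp) (by simp)]
    refine ENNReal.rpow_le_rpow ?_ (by simp)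
    simpa using hb _ (hpos n)
  set U : Ultrafilter ℕ := hyperfilter ℕ
  have hU : (U : Filter ℕ) ≤ atTop := by
    rw [← Nat.cofinite_eq_atTop]
    exact hyperfilter_le_cofinite
  -- The restrictions of `G` to the heights $1/(n+1)$ are bounded in $L^2$. Testing their weak limit
  -- against Poisson kernels passes the Poisson representation to the boundary, and almost
  -- everywhere convergence of Poisson integrals then identifies `u` as the boundary function.
  obtain ⟨u, hu⟩ := exists_weak_limit U g _ hgb
  refine ⟨u, hasBoundaryFun_of_poisson (Lp.memLp u) fun x y hy => ?_⟩
  set v := (memLp_poisson_kernel x hy).toLp _ with hv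
  have hvc := (memLp_poisson_kernel x hy).coeFn_toLp
  have h1 := (Complex.continuous_conj.tendsto _).comp (hu v)
  have h2 : conj (inner ℂ u v) = ∫ t : ℝ, ((y / ((t - x) ^ 2 + y ^ 2) : ℝ) : ℂ) * u t := by
    rw [L2.inner_def, ← integral_conj]
    refine integral_congr_ae ?_
    filter_upwards [hvc] with t ht
    rw [hv, ht, RCLike.inner_apply, map_mul, Complex.conj_conj, Complex.conj_ofReal]
  have h3 : ∀ n, conj (inner ℂ (g n) v) =
      ∫ t : ℝ, G (t + ((1 / ((n : ℝ) + 1) : ℝ) : ℂ) * I) *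
        ((y / ((t - x) ^ 2 + y ^ 2) : ℝ) : ℂ) := by
    intro n
    rw [L2.inner_def, ← integral_conj]
    refine integral_congr_ae ?_
    filter_upwards [hvc, (hG.memLp (hpos n)).coeFn_toLp] with t ht ht'
    rw [hv, hgdef, ht, ht', RCLike.inner_apply, map_mul, Complex.conj_conj, Complex.conj_ofReal,
      mul_comm]
  rw [h2] at h1
  refine tendsto_nhds_unique ?_ h1
  have h4 : Tendsto (fun n : ℕ => (Real.pi : ℂ) *
      G ((x + y * I : ℂ) + ((1 / ((n : ℝ) + 1) : ℝ) : ℂ) * I)) U (𝓝 (Real.pi * G (x + y * I))) :=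
    (((tendsto_add_mul_I hd (mem_upperHalf_line hy)).comp
      tendsto_one_div_nat_nhdsGT).mono_left hU).const_mul _
  refine h4.congr' ?_
  have h5 : ∀ᶠ n : ℕ in atTop, 1 / ((n : ℝ) + 1) < y :=
    tendsto_one_div_add_atTop_nhds_zero_nat.eventually (gt_mem_nhds hy)
  filter_upwards [hU h5] with n hn
  have h6 := hG.integral_poisson (p := x + y * I) (hpos n) (by simpa using hn)
  rw [← h6, Function.comp_apply, h3]
  simp

/-- Fatou's theorem for the class `H^∞`. -/
theorem IsHardyInfty.exists_hasBoundaryFun {E : ℂ → ℂ} (hE : IsHardyInfty E) :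
    ∃ e : ℝ → ℂ, HasBoundaryFun E e := by
  -- Division by $z+i$ reduces the claim to $H^2$.
  obtain ⟨u, hu⟩ := (hE.isHardyTwo_div_sub (q := -I) (by simp)).exists_hasBoundaryFun
  refine ⟨fun x => u x * (x + I), ?_⟩
  filter_upwards [hu] with x hx
  have h1 : Tendsto (fun y : ℝ => (x + y * I : ℂ) - (-I)) (𝓝[>] 0) (𝓝 (x + I)) := by
    have : Continuous fun y : ℝ => (x + y * I : ℂ) - (-I) := by fun_prop
    have := this.tendsto 0
    simp only [ofReal_zero, zero_mul, add_zero, sub_neg_eq_add] at this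
    simpa only [sub_neg_eq_add] using this.mono_left nhdsWithin_le_nhds
  refine (hx.mul h1).congr' ?_
  filter_upwards [self_mem_nhdsWithin] with y hy
  have hy : 0 < y := hy
  refine div_mul_cancel₀ _ (line_sub_ne_zero ?_)
  simp
  linarith

/-! ### Cauchy transforms -/

/-- The constant depends only on a lower bound for the imaginary part and an upper bound for the
modulus, so the estimate dominates both the Cauchy integral and its derivative locally uniformly in
`z`. -/
lemma norm_cauchy_kernel_le {z : ℂ} {d R t : ℝ} (hd : 0 < d) (hz : d ≤ z.im)
    (hR : ‖z‖ ≤ R) : ‖((t : ℂ) - z)⁻¹‖ ≤ (1 + (1 + R) / d) * (1 + |t|)⁻¹ := by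
  have h1 : d ≤ ‖(t : ℂ) - z‖ := by
    have := Complex.abs_im_le_norm ((t : ℂ) - z)
    simp only [sub_im, ofReal_im, zero_sub, abs_neg] at this
    exact hz.trans ((le_abs_self _).trans this)
  have hpos : 0 < ‖(t : ℂ) - z‖ := hd.trans_le h1
  have h2 : |t| ≤ ‖(t : ℂ) - z‖ + R := by
    have := norm_add_le ((t : ℂ) - z) z
    rw [sub_add_cancel, Complex.norm_real, Real.norm_eq_abs] at this
    linarith
  have hR0 : 0 ≤ R := (norm_nonneg z).trans hR
  have h3 : 1 + R ≤ (1 + R) / d * ‖(t : ℂ) - z‖ := by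
    rw [div_mul_eq_mul_div, le_div_iff₀ hd]
    exact mul_le_mul_of_nonneg_left h1 (by linarith)
  rw [norm_inv, ← div_eq_mul_inv, inv_eq_one_div, div_le_div_iff₀ hpos (by positivity)]
  linarith

lemma continuous_ofReal_sub_inv {z : ℂ} (hz : z.im ≠ 0) :
    Continuous fun t : ℝ => ((t : ℂ) - z)⁻¹ :=
  Continuous.inv₀ (by fun_prop) fun t h0 => hz (by
    have := congrArg Complex.im h0
    simpa using this)

lemma integrable_mul_cauchy_kernel {f : ℝ → ℂ} (hfm : AEStronglyMeasurable f)
    (hf : Integrable fun t => ‖f t‖ * (1 + |t|)⁻¹) {z : ℂ} (hz : z ∈ upperHalf) :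
    Integrable fun t : ℝ => f t * ((t : ℂ) - z)⁻¹ := by
  have hz : 0 < z.im := hz
  refine (hf.const_mul (1 + (1 + ‖z‖) / z.im)).mono'
    (hfm.mul (continuous_ofReal_sub_inv hz.ne').aestronglyMeasurable) (ae_of_all _ fun t => ?_)
  rw [norm_mul, mul_left_comm]
  exact mul_le_mul_of_nonneg_left (norm_cauchy_kernel_le hz le_rfl le_rfl)
    (norm_nonneg _)

lemma differentiableOn_cauchy_transform {f : ℝ → ℂ} (hfm : AEStronglyMeasurable f)
    (hf : Integrable fun t => ‖f t‖ * (1 + |t|)⁻¹) :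
    DifferentiableOn ℂ (fun z => ∫ t : ℝ, f t * ((t : ℂ) - z)⁻¹) upperHalf := by
  intro z₀ hz₀
  have hz₀' : 0 < z₀.im := hz₀
  set d := z₀.im / 2 with hd
  have hd0 : 0 < d := half_pos hz₀'
  set R := ‖z₀‖ + d
  have hball : ∀ z ∈ Metric.ball z₀ d, d ≤ z.im ∧ ‖z‖ ≤ R := by
    intro z hz
    rw [Metric.mem_ball, dist_eq_norm] at hz
    constructor
    · have := (Complex.abs_im_le_norm (z - z₀)).trans hz.le
      rw [abs_le, sub_im] at this
      linarith
    · have := norm_add_le (z - z₀) z₀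
      rw [sub_add_cancel] at this
      simp only [R]
      linarith
  set M := 1 + (1 + R) / d
  have h := hasDerivAt_integral_of_dominated_loc_of_deriv_le (μ := volume) (x₀ := z₀)
    (F := fun z t => f t * ((t : ℂ) - z)⁻¹) (F' := fun z t => f t * (((t : ℂ) - z)⁻¹) ^ 2)
    (s := Metric.ball z₀ d) (bound := fun t => (M * d⁻¹) * (‖f t‖ * (1 + |t|)⁻¹))
    (Metric.ball_mem_nhds z₀ hd0) ?_ (integrable_mul_cauchy_kernel hfm hf hz₀) ?_ ?_
    (hf.const_mul _) ?_
  · exact h.2.differentiableAt.differentiableWithinAt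
  · filter_upwards [isOpen_upperHalf.mem_nhds hz₀] with z hz
    exact (integrable_mul_cauchy_kernel hfm hf hz).1
  · exact hfm.mul ((continuous_ofReal_sub_inv hz₀'.ne').pow 2).aestronglyMeasurable
  · refine ae_of_all _ fun t z hz => ?_
    obtain ⟨h1, h2⟩ := hball z hz
    have h3 : ‖((t : ℂ) - z)⁻¹‖ ≤ d⁻¹ := by
      rw [norm_inv]
      refine inv_anti₀ hd0 (h1.trans ?_)
      have := Complex.abs_im_le_norm ((t : ℂ) - z)
      simp only [sub_im, ofReal_im, zero_sub, abs_neg] at this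
      exact (le_abs_self _).trans this
    have h4 := norm_cauchy_kernel_le (t := t) hd0 h1 h2
    rw [norm_mul, norm_pow, sq]
    calc ‖f t‖ * (‖((t : ℂ) - z)⁻¹‖ * ‖((t : ℂ) - z)⁻¹‖)
        ≤ ‖f t‖ * ((M * (1 + |t|)⁻¹) * d⁻¹) := by
          refine mul_le_mul_of_nonneg_left (mul_le_mul h4 h3 (norm_nonneg _) ?_) (norm_nonneg _)
          exact (norm_nonneg _).trans h4
      _ = _ := by ring
  · refine ae_of_all _ fun t z hz => ?_
    have hne : (t : ℂ) - z ≠ 0 := fun h0 => by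
      have := congrArg Complex.im h0
      simp at this
      linarith [(hball z hz).1]
    have h1 : HasDerivAt (fun z => (t : ℂ) - z) (-1) z := by
      simpa using (hasDerivAt_id z).const_sub (t : ℂ)
    refine ((h1.inv hne).const_mul (f t)).congr_deriv ?_
    field_simp

lemma integrable_norm_mul_inv_of_memLp {u : ℝ → ℂ} (hu : MemLp u 2) :
    Integrable fun t : ℝ => ‖u t‖ * (1 + |t|)⁻¹ := by
  have h1 : MemLp (fun t : ℝ => (1 + |t|)⁻¹) 2 := by
    have hc : Continuous fun t : ℝ => (1 + |t|)⁻¹ :=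
      Continuous.inv₀ (by fun_prop) fun t => by positivity
    refine (memLp_two_iff_integrable_sq hc.aestronglyMeasurable).2 ?_
    refine integrable_inv_one_add_sq.mono' (hc.pow 2).aestronglyMeasurable
      (ae_of_all _ fun t => ?_)
    rw [Real.norm_of_nonneg (by positivity), inv_pow]
    refine inv_anti₀ (by positivity) ?_
    nlinarith [abs_nonneg t, sq_abs t]
  exact hu.norm.integrable_mul h1

/-! ### Recovering an $H^2$ function from its boundary values -/

lemma sq_lintegral_mul_le {k f : ℝ → ℝ≥0∞} (hk : AEMeasurable k) (hf : AEMeasurable f) :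
    (∫⁻ t, k t * f t) ^ 2 ≤ (∫⁻ t, k t) * ∫⁻ t, k t * f t ^ 2 := by
  have h1 := ENNReal.lintegral_mul_le_Lp_mul_Lq volume Real.HolderConjugate.two_two
    (f := fun t => k t ^ (1 / 2 : ℝ)) (g := fun t => k t ^ (1 / 2 : ℝ) * f t)
    (hk.pow_const _) ((hk.pow_const _).mul hf)
  have h2 : ∀ t, (k t ^ (1 / 2 : ℝ)) ^ (2 : ℝ) = k t := fun t => by
    rw [← ENNReal.rpow_mul]
    norm_num
  have h3 : ∀ t, k t ^ (1 / 2 : ℝ) * (k t ^ (1 / 2 : ℝ) * f t) = k t * f t := fun t => by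
    rw [← mul_assoc, ← sq, ← ENNReal.rpow_two, h2]
  have h4 : ∀ t, (k t ^ (1 / 2 : ℝ) * f t) ^ (2 : ℝ) = k t * f t ^ 2 := fun t => by
    rw [ENNReal.mul_rpow_of_nonneg _ _ (by norm_num), h2, ENNReal.rpow_two]
  simp only [Pi.mul_apply, h2, h3, h4] at h1
  refine (pow_le_pow_left' h1 2).trans_eq ?_
  have h5 : ∀ c : ℝ≥0∞, (c ^ (1 / 2 : ℝ)) ^ 2 = c := fun c => by
    rw [← ENNReal.rpow_two, ← ENNReal.rpow_mul]
    norm_num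
  rw [mul_pow, h5, h5]

/-- A function in `L²(ℝ)` orthogonal to the Cauchy kernels of the lower half-plane is the boundary
function of a function of class `H²`. -/
theorem exists_isHardyTwo_of_forall_integral_eq_zero {u : ℝ → ℂ} (hu : MemLp u 2)
    (h : ∀ q : ℂ, q.im < 0 → ∫ t : ℝ, u t * ((t : ℂ) - q)⁻¹ = 0) :
    ∃ G : ℂ → ℂ, IsHardyTwo G ∧ HasBoundaryFun G u := by
  have hπ : (Real.pi : ℂ) ≠ 0 := by exact_mod_cast Real.pi_ne_zero
  set G : ℂ → ℂ := fun z => (2 * Real.pi * I)⁻¹ * ∫ t : ℝ, u t * ((t : ℂ) - z)⁻¹ with hG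
  have hui := integrable_norm_mul_inv_of_memLp hu
  have hpois : ∀ x y : ℝ, 0 < y → Real.pi * G (x + y * I) =
      ∫ t : ℝ, ((y / ((t - x) ^ 2 + y ^ 2) : ℝ) : ℂ) * u t := by
    intro x y hy
    set p : ℂ := x + y * I with hp
    have hpim : p.im = y := by simp [hp]
    have hpre : p.re = x := by simp [hp]
    have h0 := h (conj p) (by simp [hpim, hy])
    have hi2 : Integrable fun t : ℝ => u t * ((t : ℂ) - conj p)⁻¹ := by
      have h1 := integrable_mul_cauchy_kernel hu.1 hui (mem_upperHalf_line (x := x) hy)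
      refine h1.mono (hu.1.mul (continuous_ofReal_sub_inv
        (by simp [hpim, hy.ne'])).aestronglyMeasurable) (ae_of_all _ fun t => ?_)
      rw [norm_mul, norm_mul]
      refine mul_le_mul_of_nonneg_left (le_of_eq ?_) (norm_nonneg _)
      rw [← Complex.norm_conj]
      simp [hp]
    have h1 : ∫ t : ℝ, u t * ((t : ℂ) - p)⁻¹ =
        ∫ t : ℝ, (2 * I) * (((y / ((t - x) ^ 2 + y ^ 2) : ℝ) : ℂ) * u t) := by
      rw [← sub_zero (∫ t : ℝ, u t * ((t : ℂ) - p)⁻¹), ← h0, ← integral_sub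
        (integrable_mul_cauchy_kernel hu.1 hui (mem_upperHalf_line hy)) hi2]
      refine integral_congr_ae (ae_of_all _ fun t => ?_)
      have h2 := one_div_sub_one_div_eq_poisson_kernel (x := t) (a := 0) (p := p)
        (by rw [hpim]; exact hy.ne)
      simp only [ofReal_zero, zero_mul, add_zero, mul_zero, hpim, hpre, sub_zero, one_div] at h2
      simp only
      rw [← mul_sub, h2]
      ring
    rw [hG]
    simp only
    rw [h1, integral_const_mul]
    field_simp
  refine ⟨G, ⟨(differentiableOn_cauchy_transform hu.1 hui).const_mul _,
    ∫⁻ t, ‖u t‖ₑ ^ 2, (memLp_two_iff_lintegral hu.1).1 hu, fun y hy => ?_⟩,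
    hasBoundaryFun_of_poisson hu hpois⟩
  have hkm : Measurable fun q : ℝ × ℝ => ENNReal.ofReal (y / ((q.2 - q.1) ^ 2 + y ^ 2)) :=
    ENNReal.measurable_ofReal.comp (by fun_prop)
  have hπ0 : ENNReal.ofReal Real.pi ≠ 0 := by simp [Real.pi_pos]
  -- Cauchy–Schwarz for the Poisson kernel, of mass $\pi$. Integrating in `x` by Tonelli, the kernel
  -- again has mass $\pi$, so every horizontal line has norm at most that of `u`.
  have hpt : ∀ x : ℝ, ENNReal.ofReal Real.pi * ‖G (x + y * I)‖ₑ ^ 2 ≤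
      ∫⁻ t, ENNReal.ofReal (y / ((t - x) ^ 2 + y ^ 2)) * ‖u t‖ₑ ^ 2 := by
    intro x
    have h1 : ENNReal.ofReal Real.pi * ‖G (x + y * I)‖ₑ ≤
        ∫⁻ t, ENNReal.ofReal (y / ((t - x) ^ 2 + y ^ 2)) * ‖u t‖ₑ := by
      have h2 : ENNReal.ofReal Real.pi * ‖G (x + y * I)‖ₑ = ‖(Real.pi : ℂ) * G (x + y * I)‖ₑ := by
        rw [enorm_mul (Real.pi : ℂ), ← ofReal_norm (Real.pi : ℂ), Complex.norm_real,
          Real.norm_of_nonneg Real.pi_pos.le]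
      rw [h2, hpois x y hy]
      refine (enorm_integral_le_lintegral_enorm _).trans_eq (lintegral_congr fun t => ?_)
      rw [enorm_mul, ← ofReal_norm (((y / ((t - x) ^ 2 + y ^ 2) : ℝ)) : ℂ), Complex.norm_real,
        Real.norm_of_nonneg (by positivity)]
    have h3 := (pow_le_pow_left' h1 2).trans (sq_lintegral_mul_le
      (hkm.comp (measurable_const.prodMk measurable_id)).aemeasurable hu.1.enorm)
    rw [lintegral_poisson_kernel x hy, mul_pow, sq, mul_assoc] at h3
    exact (ENNReal.mul_le_mul_iff_right hπ0 ENNReal.ofReal_ne_top).1 h3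
  refine (ENNReal.mul_le_mul_iff_right hπ0 ENNReal.ofReal_ne_top).1 ?_
  rw [← lintegral_const_mul' _ _ ENNReal.ofReal_ne_top]
  refine (lintegral_mono hpt).trans_eq ?_
  rw [lintegral_lintegral_swap]
  · rw [← lintegral_const_mul' _ _ ENNReal.ofReal_ne_top]
    refine lintegral_congr fun t => ?_
    have hkt : Measurable fun x : ℝ => ENNReal.ofReal (y / ((t - x) ^ 2 + y ^ 2)) :=
      ENNReal.measurable_ofReal.comp (by fun_prop)
    rw [lintegral_mul_const _ hkt, ← lintegral_poisson_kernel t hy]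
    congr 1
    refine lintegral_congr fun x => ?_
    congr 3
    ring
  · exact hkm.aemeasurable.mul ((hu.1.enorm.pow_const 2).comp_snd)

/-! ### Outer functions -/

/-- The hypotheses on a modulus `w` under which `outerFun w` is a contractive outer function that is
real on the imaginary half-axis. -/
structure IsOuterModulus (w : ℝ → ℝ) : Prop where
  integrable : Integrable fun t => Real.log (w t) / (1 + t ^ 2)
  pos : ∀ᵐ t, 0 < w t
  le_one : ∀ᵐ t, w t ≤ 1
  even : ∀ᵐ t, w (-t) = w t

namespace IsOuterModulus

variable {w : ℝ → ℝ}

lemma integrable_complex (hw : IsOuterModulus w) :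
    Integrable fun t : ℝ => (Real.log (w t) : ℂ) / (1 + (t : ℂ) ^ 2) := by
  refine (hw.integrable.ofReal (𝕜 := ℂ)).congr (ae_of_all _ fun t => ?_)
  simp

lemma integrable_mul_inv (hw : IsOuterModulus w) :
    Integrable fun t : ℝ => ‖(Real.log (w t) : ℂ) / (1 + (t : ℂ) ^ 2)‖ * (1 + |t|)⁻¹ := by
  have hc : Continuous fun t : ℝ => (1 + |t|)⁻¹ :=
    Continuous.inv₀ (by fun_prop) fun t => by positivity
  refine hw.integrable_complex.norm.mul_bdd (c := 1) hc.aestronglyMeasurable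
    (ae_of_all _ fun t => ?_)
  rw [Real.norm_of_nonneg (by positivity)]
  exact inv_le_one_of_one_le₀ (by linarith [abs_nonneg t])

/-- Only $\log w/(1+t^2)$ is assumed integrable; this form expresses the exponent through its Cauchy
transform, so that holomorphy follows from `differentiableOn_cauchy_transform`. -/
lemma outer_kernel_eq {z : ℂ} (hz : z ∈ upperHalf) (t : ℝ) (l : ℂ) :
    (1 / ((t : ℂ) - z) - (t : ℂ) / (1 + (t : ℂ) ^ 2)) * l =
      (1 + z ^ 2) * (l / (1 + (t : ℂ) ^ 2) * ((t : ℂ) - z)⁻¹) + z * (l / (1 + (t : ℂ) ^ 2)) := by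
  have h1 : (1 + (t : ℂ) ^ 2) ≠ 0 := by
    norm_cast
    positivity
  have h2 : (t : ℂ) - z ≠ 0 := fun h0 => by
    have hz : 0 < z.im := hz
    have := congrArg Complex.im h0
    simp at this
    linarith
  field_simp
  ring

lemma integrable_kernel (hw : IsOuterModulus w) {z : ℂ} (hz : z ∈ upperHalf) :
    Integrable fun t : ℝ =>
      (1 / ((t : ℂ) - z) - (t : ℂ) / (1 + (t : ℂ) ^ 2)) * (Real.log (w t) : ℂ) := by
  simp_rw [outer_kernel_eq hz]
  exact ((integrable_mul_cauchy_kernel hw.integrable_complex.1 hw.integrable_mul_inv hz).const_mul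
    _).add (hw.integrable_complex.const_mul _)

lemma outerFun_eq (hw : IsOuterModulus w) {z : ℂ} (hz : z ∈ upperHalf) :
    outerFun w z = Complex.exp ((1 / (Real.pi * I)) *
      ((1 + z ^ 2) * (∫ t : ℝ, (Real.log (w t) : ℂ) / (1 + (t : ℂ) ^ 2) * ((t : ℂ) - z)⁻¹) +
        z * ∫ t : ℝ, (Real.log (w t) : ℂ) / (1 + (t : ℂ) ^ 2))) := by
  rw [outerFun]
  simp_rw [outer_kernel_eq hz]
  rw [integral_add ((integrable_mul_cauchy_kernel hw.integrable_complex.1 hw.integrable_mul_inv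
    hz).const_mul _) (hw.integrable_complex.const_mul _), integral_const_mul, integral_const_mul]

lemma differentiableOn (hw : IsOuterModulus w) : DifferentiableOn ℂ (outerFun w) upperHalf := by
  have h1 := differentiableOn_cauchy_transform hw.integrable_complex.1 hw.integrable_mul_inv
  refine DifferentiableOn.congr ?_ fun z hz => hw.outerFun_eq hz
  exact (DifferentiableOn.const_mul (((differentiableOn_const _).add
    (differentiableOn_id.pow 2)).mul h1 |>.add (differentiableOn_id.mul_const _)) _).cexp

/-- The prefactor $1/(\pi i)$ selects the imaginary part of the integral. The term $t/(1+t^2)$ is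
real, and $\operatorname{Im}\frac1{t-z}$ is the Poisson kernel. -/
lemma norm_outerFun (hw : IsOuterModulus w) (x : ℝ) {y : ℝ} (hy : 0 < y) :
    ‖outerFun w (x + y * I)‖ =
      Real.exp (Real.pi⁻¹ * ∫ t : ℝ, y / ((t - x) ^ 2 + y ^ 2) * Real.log (w t)) := by
  have hint := hw.integrable_kernel (mem_upperHalf_line (x := x) hy)
  rw [outerFun, Complex.norm_exp]
  congr 1
  have h1 : ∀ J : ℂ, (1 / (Real.pi * I) * J).re = Real.pi⁻¹ * J.im := by
    intro J
    have : (1 / (Real.pi * I) * J : ℂ) = ((Real.pi⁻¹ : ℝ) : ℂ) * (-I * J) := by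
      have hπ : (Real.pi : ℂ) ≠ 0 := by exact_mod_cast Real.pi_ne_zero
      push_cast
      field_simp
      rw [I_sq]
      ring
    rw [this, Complex.re_ofReal_mul]
    simp
  rw [h1]
  congr 1
  rw [← RCLike.im_eq_complex_im, ← integral_im hint]
  refine integral_congr_ae (ae_of_all _ fun t => ?_)
  simp only [RCLike.im_eq_complex_im]
  rw [Complex.im_mul_ofReal]
  congr 1
  have h2 : ((t : ℂ) / (1 + (t : ℂ) ^ 2)) = ((t / (1 + t ^ 2) : ℝ) : ℂ) := by push_cast; rfl
  rw [sub_im, h2, ofReal_im, sub_zero, one_div, inv_im, Complex.normSq_apply]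
  simp
  ring

lemma norm_outerFun_le_one (hw : IsOuterModulus w) {z : ℂ} (hz : z ∈ upperHalf) :
    ‖outerFun w z‖ ≤ 1 := by
  rw [← Complex.re_add_im z, hw.norm_outerFun _ hz, Real.exp_le_one_iff]
  refine mul_nonpos_of_nonneg_of_nonpos (by positivity) (integral_nonpos_of_ae ?_)
  filter_upwards [hw.pos, hw.le_one] with t h0 h1
  have : 0 < z.im := hz
  exact mul_nonpos_of_nonneg_of_nonpos (by positivity) (Real.log_nonpos h0.le h1)

lemma isHardyInfty (hw : IsOuterModulus w) : IsHardyInfty (outerFun w) :=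
  ⟨hw.differentiableOn, 1, fun _ hz => hw.norm_outerFun_le_one hz⟩

/-- The boundary values of an outer function exist almost everywhere. -/
lemma hasBoundaryFun (hw : IsOuterModulus w) :
    HasBoundaryFun (outerFun w) (boundaryValue (outerFun w)) := by
  obtain ⟨e, he⟩ := hw.isHardyInfty.exists_hasBoundaryFun
  filter_upwards [he] with x hx
  rwa [boundaryValue, hx.limUnder_eq]

lemma norm_boundaryValue (hw : IsOuterModulus w) :
    ∀ᵐ x, ‖boundaryValue (outerFun w) x‖ = w x := by
  filter_upwards [hw.hasBoundaryFun, ae_tendsto_poisson_integral hw.integrable_complex, hw.pos]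
    with x h1 h2 h3
  refine tendsto_nhds_unique h1.norm ?_
  have h4 : Tendsto (fun y : ℝ => ∫ t : ℝ, y / ((t - x) ^ 2 + y ^ 2) * Real.log (w t)) (𝓝[>] 0)
      (𝓝 (Real.pi * Real.log (w x))) := by
    have h5 := (Complex.continuous_re.tendsto _).comp h2
    rw [← Complex.ofReal_mul, Complex.ofReal_re] at h5
    refine h5.congr fun y => ?_
    rw [Function.comp_apply]
    simp_rw [← Complex.ofReal_mul]
    rw [integral_complex_ofReal, Complex.ofReal_re]
  have h5 := (Real.continuous_exp.tendsto _).comp (h4.const_mul Real.pi⁻¹)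
  rw [inv_mul_cancel_left₀ Real.pi_ne_zero, Real.exp_log h3] at h5
  refine h5.congr' ?_
  filter_upwards [self_mem_nhdsWithin] with y hy
  rw [hw.norm_outerFun x hy, Function.comp_apply]

/-- The substitution $t\mapsto-t$ and the evenness of `w`. -/
lemma outerFun_neg_conj (hw : IsOuterModulus w) (z : ℂ) :
    outerFun w (-conj z) = conj (outerFun w z) := by
  rw [outerFun, outerFun, ← Complex.exp_conj, map_mul, ← integral_conj]
  congr 1
  have h1 : conj (1 / (Real.pi * I) : ℂ) = -(1 / (Real.pi * I)) := by
    simp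
  rw [h1, neg_mul, ← mul_neg, ← integral_neg]
  congr 1
  rw [← integral_neg_eq_self]
  refine integral_congr_ae ?_
  filter_upwards [hw.even] with t ht
  rw [ht, map_mul, Complex.conj_ofReal, ← neg_mul]
  congr 1
  simp only [map_sub, map_div₀, map_one, Complex.conj_ofReal, map_add, map_pow, ofReal_neg, neg_sq]
  rw [show (-(t : ℂ) - -conj z) = -((t : ℂ) - conj z) by ring, one_div_neg_eq_neg_one_div]
  ring

lemma boundaryValue_neg (hw : IsOuterModulus w) :
    ∀ᵐ x, boundaryValue (outerFun w) (-x) = conj (boundaryValue (outerFun w) x) := by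
  have hneg : ∀ᵐ x : ℝ, Tendsto (fun y : ℝ => outerFun w (((-x : ℝ) : ℂ) + y * I)) (𝓝[>] 0)
      (𝓝 (boundaryValue (outerFun w) (-x))) :=
    (Measure.measurePreserving_neg (volume : Measure ℝ)).quasiMeasurePreserving.ae hw.hasBoundaryFun
  filter_upwards [hw.hasBoundaryFun, hneg] with x h1 h2
  refine tendsto_nhds_unique h2 (((Complex.continuous_conj.tendsto _).comp h1).congr fun y => ?_)
  rw [Function.comp_apply, ← hw.outerFun_neg_conj]
  congr 1
  simp
  ring

end IsOuterModulus

/-! ### Blaschke products -/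

/-- The sign in the normalized Blaschke factor. -/
noncomputable def blaschkeSign (p : ℂ) : ℂ := if p.im ≤ 1 then 1 else -1

/-- The derivative at `p` of the Blaschke factor with zero at `p`. -/
noncomputable def blaschkeFactorDeriv (p : ℂ) : ℂ := blaschkeSign p / (p - conj p)

lemma blaschkeSign_mul_self (p : ℂ) : blaschkeSign p * blaschkeSign p = 1 := by
  rw [blaschkeSign]
  split_ifs <;> simp

lemma blaschkeSign_ne_zero (p : ℂ) : blaschkeSign p ≠ 0 := by
  rw [blaschkeSign]
  split_ifs <;> simp

lemma blaschkeFactor_eq (p z : ℂ) :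
    blaschkeFactor p z = blaschkeSign p * ((z - p) / (z - conj p)) := by
  rw [blaschkeFactor, blaschkeSign]
  split_ifs <;> simp

lemma sub_conj_ne_zero {p z : ℂ} (hp : 0 < p.im) (hz : 0 ≤ z.im) : z - conj p ≠ 0 := fun h => by
  have := congrArg Complex.im h
  simp at this
  linarith

lemma blaschkeFactor_ne_zero {p z : ℂ} (hp : 0 < p.im) (hz : 0 ≤ z.im) (hzp : z ≠ p) :
    blaschkeFactor p z ≠ 0 := by
  rw [blaschkeFactor_eq]
  exact mul_ne_zero (blaschkeSign_ne_zero p)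
    (div_ne_zero (sub_ne_zero.2 hzp) (sub_conj_ne_zero hp hz))

lemma blaschkeFactorDeriv_ne_zero {p : ℂ} (hp : 0 < p.im) : blaschkeFactorDeriv p ≠ 0 :=
  div_ne_zero (blaschkeSign_ne_zero p) (sub_conj_ne_zero hp hp.le)

lemma blaschkeFactor_self (p : ℂ) : blaschkeFactor p p = 0 := by
  simp [blaschkeFactor_eq]

/-- `Λ` is a subset of the imaginary half-axis satisfying the Blaschke condition. -/
structure IsBlaschkeSet (Λ : Set ℂ) : Prop where
  imaginary : ∀ p ∈ Λ, p.re = 0 ∧ 0 < p.im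
  summable : Summable fun p : Λ => if (p : ℂ).im ≤ 1 then (p : ℂ).im else 1 / (p : ℂ).im

lemma ScatteringData.Admissible.isBlaschkeSet {Λ : Set ℂ} {D : ScatteringData Λ}
    (hD : D.Admissible) : IsBlaschkeSet Λ := by
  refine ⟨hD.imaginary, ?_⟩
  have h1 : Summable ((fun p : ℂ => p.im) ∘ ((↑) : {p : ℂ | p ∈ Λ ∧ p.im ≤ 1} → ℂ)) :=
    hD.blaschke_small
  have h2 : Summable ((fun p : ℂ => 1 / p.im) ∘ ((↑) : {p : ℂ | p ∈ Λ ∧ 1 < p.im} → ℂ)) :=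
    hD.blaschke_large
  have h3 : Summable ((fun p : ℂ => if p.im ≤ 1 then p.im else 1 / p.im) ∘ ((↑) : Λ → ℂ)) := by
    rw [summable_subtype_iff_indicator] at h1 h2 ⊢
    refine (h1.add h2).congr fun p => ?_
    by_cases hp : p ∈ Λ <;> by_cases hp1 : p.im ≤ 1 <;>
      simp [indicator, hp, hp1, not_le.1]
  exact h3

namespace IsBlaschkeSet

variable {Λ : Set ℂ}

lemma mono (hΛ : IsBlaschkeSet Λ) {S : Set ℂ} (hS : S ⊆ Λ) : IsBlaschkeSet S :=
  ⟨fun p hp => hΛ.imaginary p (hS hp), by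
    have := hΛ.summable.comp_injective (inclusion_injective hS)
    simpa only [Function.comp_def, coe_inclusion] using this⟩

lemma mem_upperHalf (hΛ : IsBlaschkeSet Λ) {p : ℂ} (hp : p ∈ Λ) : p ∈ upperHalf :=
  (hΛ.imaginary p hp).2

lemma conj_eq_neg (hΛ : IsBlaschkeSet Λ) {p : ℂ} (hp : p ∈ Λ) : conj p = -p := by
  have := (hΛ.imaginary p hp).1
  apply Complex.ext <;> simp [this]

/-- The sign makes almost all factors close to $1$: the factor minus one is $-2p/(z-\bar p)$ for
$\operatorname{Im}p\le1$ and $-2z/(z-\bar p)$ otherwise. The bound is valid up to the real axis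
except at $0$, so the product converges absolutely there and no boundary limit is needed to define
`B` on the line. -/
lemma norm_blaschkeFactor_sub_one_le (hΛ : IsBlaschkeSet Λ) (p : Λ) {z : ℂ} (hz : 0 ≤ z.im)
    (hz0 : z ≠ 0) : ‖blaschkeFactor p z - 1‖ ≤
      2 * (‖z‖ + ‖z‖⁻¹) * (if (p : ℂ).im ≤ 1 then (p : ℂ).im else 1 / (p : ℂ).im) := by
  obtain ⟨hre, him⟩ := hΛ.imaginary p p.2
  have hzn : 0 < ‖z‖ := norm_pos_iff.2 hz0
  have hne := sub_conj_ne_zero him hz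
  have hcp := hΛ.conj_eq_neg p.2
  have hpn : ‖(p : ℂ)‖ = (p : ℂ).im := by
    rw [← Complex.abs_im_eq_norm.2 hre, abs_of_pos him]
  have h1 : ‖z‖ ≤ ‖z - conj (p : ℂ)‖ := by
    refine (pow_le_pow_iff_left₀ (norm_nonneg _) (norm_nonneg _) two_ne_zero).1 ?_
    rw [← Complex.normSq_eq_norm_sq, ← Complex.normSq_eq_norm_sq, Complex.normSq_apply,
      Complex.normSq_apply]
    simp [hre]
    nlinarith
  have h2 : (p : ℂ).im ≤ ‖z - conj (p : ℂ)‖ := by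
    refine le_trans ?_ ((le_abs_self _).trans (Complex.abs_im_le_norm _))
    simp [hz]
  rw [blaschkeFactor]
  split_ifs with hp1
  · have : (z - p) / (z - conj (p : ℂ)) - 1 = -(2 * p) / (z - conj (p : ℂ)) := by
      rw [div_sub_one hne, hcp]
      ring
    rw [this, norm_div, norm_neg, norm_mul, hpn]
    calc ‖(2 : ℂ)‖ * (p : ℂ).im / ‖z - conj (p : ℂ)‖ ≤ 2 * (p : ℂ).im / ‖z‖ := by
          rw [Complex.norm_ofNat]
          gcongr
      _ = 2 * (0 + ‖z‖⁻¹) * (p : ℂ).im := by ring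
      _ ≤ _ := by gcongr
  · have : -((z - p) / (z - conj (p : ℂ))) - 1 = -(2 * z) / (z - conj (p : ℂ)) := by
      rw [← neg_div, div_sub_one hne, hcp]
      ring
    rw [this, norm_div, norm_neg, norm_mul]
    calc ‖(2 : ℂ)‖ * ‖z‖ / ‖z - conj (p : ℂ)‖ ≤ 2 * ‖z‖ / (p : ℂ).im := by
          rw [Complex.norm_ofNat]
          gcongr
      _ = 2 * (‖z‖ + 0) * (1 / (p : ℂ).im) := by ring
      _ ≤ _ := by gcongr; positivity

lemma summable_norm_sub_one (hΛ : IsBlaschkeSet Λ) {z : ℂ} (hz : 0 ≤ z.im) (hz0 : z ≠ 0) :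
    Summable fun p : Λ => ‖blaschkeFactor p z - 1‖ :=
  (hΛ.summable.mul_left _).of_nonneg_of_le (fun _ => norm_nonneg _)
    fun p => hΛ.norm_blaschkeFactor_sub_one_le p hz hz0

lemma multipliable (hΛ : IsBlaschkeSet Λ) {z : ℂ} (hz : 0 ≤ z.im) (hz0 : z ≠ 0) :
    Multipliable fun p : Λ => blaschkeFactor p z := by
  simpa using multipliable_one_add_of_summable (hΛ.summable_norm_sub_one hz hz0)

lemma blaschke_ne_zero (hΛ : IsBlaschkeSet Λ) {z : ℂ} (hz : 0 ≤ z.im) (hz0 : z ≠ 0)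
    (hzΛ : z ∉ Λ) : blaschke Λ z ≠ 0 := by
  have := tprod_one_add_ne_zero_of_summable (f := fun p : Λ => blaschkeFactor p z - 1)
    (fun p => by
      rw [add_sub_cancel]
      exact blaschkeFactor_ne_zero (hΛ.imaginary p p.2).2 hz fun h => hzΛ (h ▸ p.2))
    (hΛ.summable_norm_sub_one hz hz0)
  simpa [blaschke] using this

/-- Dominated convergence for products; the `+ 1` in the bound is slack that makes it valid near
`z₀`. -/
lemma continuousOn_blaschke (hΛ : IsBlaschkeSet Λ) :
    ContinuousOn (blaschke Λ) {z | 0 ≤ z.im ∧ z ≠ 0} := by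
  intro z₀ hz₀
  have h1 := tendsto_tprod_one_add_of_dominated_convergence
    (𝓕 := 𝓝[{z : ℂ | 0 ≤ z.im ∧ z ≠ 0}] z₀) (f := fun z (p : Λ) => blaschkeFactor p z - 1)
    (g := fun p : Λ => blaschkeFactor p z₀ - 1)
    (hΛ.summable.mul_left (2 * (‖z₀‖ + ‖z₀‖⁻¹) + 1)) (fun p => ?_) ?_
  · simp only [add_sub_cancel] at h1
    exact h1
  · have hne := sub_conj_ne_zero (hΛ.imaginary p p.2).2 hz₀.1
    have hdiv : ContinuousAt (fun z : ℂ => (z - p) / (z - conj (p : ℂ))) z₀ :=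
      ContinuousAt.div (by fun_prop) (by fun_prop) hne
    have : ContinuousAt (fun z => blaschkeFactor p z - 1) z₀ := by
      simp_rw [blaschkeFactor_eq]
      exact (hdiv.const_mul _).sub continuousAt_const
    exact this.tendsto.mono_left nhdsWithin_le_nhds
  · have hc : ContinuousAt (fun z : ℂ => 2 * (‖z‖ + ‖z‖⁻¹)) z₀ :=
      continuousAt_const.mul (continuousAt_id.norm.add
        (continuousAt_id.norm.inv₀ (norm_ne_zero_iff.2 hz₀.2)))
    filter_upwards [self_mem_nhdsWithin,
      nhdsWithin_le_nhds (hc.eventually (gt_mem_nhds (lt_add_one _)))] with z hz hz' p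
    refine (hΛ.norm_blaschkeFactor_sub_one_le p hz.1 hz.2).trans ?_
    refine mul_le_mul_of_nonneg_right hz'.le ?_
    have := (hΛ.imaginary p p.2).2
    split_ifs <;> positivity

lemma continuousAt_blaschke (hΛ : IsBlaschkeSet Λ) {z : ℂ} (hz : z ∈ upperHalf) :
    ContinuousAt (blaschke Λ) z := by
  refine hΛ.continuousOn_blaschke.continuousAt (mem_of_superset (isOpen_upperHalf.mem_nhds hz) ?_)
  intro w hw
  have hw : 0 < w.im := hw
  exact ⟨hw.le, fun h => by simp [h] at hw⟩

lemma aestronglyMeasurable_blaschke (hΛ : IsBlaschkeSet Λ) :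
    AEStronglyMeasurable fun x : ℝ => blaschke Λ x := by
  have h1 : ContinuousOn (fun x : ℝ => blaschke Λ x) {0}ᶜ :=
    hΛ.continuousOn_blaschke.comp (by fun_prop) fun x hx => ⟨by simp, by simpa using hx⟩
  have h2 := h1.aestronglyMeasurable (μ := volume) (measurableSet_singleton _).compl
  rwa [Measure.restrict_eq_self_of_ae_mem] at h2
  exact (measure_eq_zero_iff_ae_notMem.1 (by simp : volume ({0} : Set ℝ) = 0))

lemma norm_blaschke_ofReal (hΛ : IsBlaschkeSet Λ) {x : ℝ} (hx : x ≠ 0) :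
    ‖blaschke Λ x‖ = 1 := by
  rw [blaschke, Multipliable.norm_tprod (hΛ.multipliable (by simp) (by simpa using hx))]
  have : ∀ p : Λ, ‖blaschkeFactor p x‖ = 1 := fun p => by
    have h1 : ‖(x : ℂ) - p‖ = ‖(x : ℂ) - conj (p : ℂ)‖ := by
      rw [← Complex.norm_conj]
      simp
    have h2 : ‖blaschkeSign p‖ = 1 := by
      rw [blaschkeSign]
      split_ifs <;> simp
    rw [blaschkeFactor_eq, norm_mul, norm_div, h1, h2, one_mul, div_self]
    exact norm_ne_zero_iff.2 (sub_conj_ne_zero (hΛ.imaginary p p.2).2 (by simp))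
  simp [this]

/-- Every zero is fixed by $z\mapsto-\bar z$, because `Λ` lies on the imaginary axis, so the
symmetry holds factor by factor. -/
lemma blaschke_neg_conj (hΛ : IsBlaschkeSet Λ) {z : ℂ} (hz : 0 ≤ z.im) (hz0 : z ≠ 0) :
    blaschke Λ (-conj z) = conj (blaschke Λ z) := by
  rw [blaschke, blaschke, Multipliable.map_tprod (hΛ.multipliable hz hz0) (starRingEnd ℂ)
    Complex.continuous_conj]
  refine tprod_congr fun p => ?_
  have hs : conj (blaschkeSign p) = blaschkeSign p := by
    rw [blaschkeSign]
    split_ifs <;> simp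
  rw [blaschkeFactor_eq, blaschkeFactor_eq, map_mul, hs, map_div₀, map_sub, map_sub,
    Complex.conj_conj, hΛ.conj_eq_neg p.2, ← neg_div_neg_eq]
  congr 2 <;> ring

lemma blaschke_neg_ofReal (hΛ : IsBlaschkeSet Λ) {x : ℝ} (hx : x ≠ 0) :
    blaschke Λ ((-x : ℝ) : ℂ) = conj (blaschke Λ x) := by
  rw [← hΛ.blaschke_neg_conj (by simp) (by simpa using hx)]
  simp

lemma conj_blaschke_self (hΛ : IsBlaschkeSet Λ) {S : Set ℂ} (hS : S ⊆ Λ) {p : ℂ} (hp : p ∈ Λ) :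
    conj (blaschke S p) = blaschke S p := by
  have hp' := (hΛ.imaginary p hp).2
  rw [← (hΛ.mono hS).blaschke_neg_conj hp'.le (fun h => by simp [h] at hp'),
    hΛ.conj_eq_neg hp, neg_neg]

lemma blaschke_eq_prod_mul (hΛ : IsBlaschkeSet Λ) {F : Finset ℂ} (hF : ↑F ⊆ Λ) {z : ℂ}
    (hz : 0 ≤ z.im) (hz0 : z ≠ 0) :
    blaschke Λ z = (∏ p ∈ F, blaschkeFactor p z) * blaschke (Λ \ F) z := by
  have h1 := Multipliable.tprod_union_disjoint (f := fun p => blaschkeFactor p z)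
    (s := (F : Set ℂ)) (t := Λ \ F) disjoint_sdiff_right
    ((hΛ.mono hF).multipliable hz hz0) ((hΛ.mono sdiff_subset).multipliable hz hz0)
  rw [union_sdiff_cancel hF] at h1
  rw [blaschke, h1, blaschke]
  congr 1
  exact Finset.tprod_subtype F fun p => blaschkeFactor p z

lemma blaschke_eq_zero (hΛ : IsBlaschkeSet Λ) {p : ℂ} (hp : p ∈ Λ) : blaschke Λ p = 0 := by
  have hp' := (hΛ.imaginary p hp).2
  rw [hΛ.blaschke_eq_prod_mul (F := {p}) (by simpa using hp) hp'.le (fun h => by simp [h] at hp')]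
  simp [blaschkeFactor_self]

end IsBlaschkeSet

/-- Continuity of the cofactor is enough at a zero. Thus $(1/s)'(p)$ can be computed from the
continuity of the remaining Blaschke product, without proving that the infinite product is
holomorphic. -/
lemma hasDerivAt_sub_mul {k : ℂ → ℂ} {p : ℂ} (hk : ContinuousAt k p) :
    HasDerivAt (fun z => (z - p) * k z) (k p) p := by
  rw [hasDerivAt_iff_tendsto_slope]
  refine (hk.tendsto.mono_left nhdsWithin_le_nhds).congr' ?_
  filter_upwards [self_mem_nhdsWithin] with z hz
  have : z - p ≠ 0 := sub_ne_zero.2 hz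
  rw [slope_def_field]
  field_simp
  simp

/-- The partial fraction decomposition of the reciprocal of a finite Blaschke product. -/
lemma exists_inv_prod_blaschkeFactor_eq (F : Finset ℂ) (hF : ∀ p ∈ F, 0 < p.im) :
    ∃ c : ℂ, ∀ z : ℂ, z ∉ F → 0 ≤ z.im → (∏ q ∈ F, blaschkeFactor q z)⁻¹ =
      c + ∑ p ∈ F, (blaschkeFactorDeriv p * ∏ q ∈ F.erase p, blaschkeFactor q p)⁻¹ *
        (z - p)⁻¹ := by
  induction F using Finset.induction_on with
  | empty => exact ⟨1, by simp⟩
  | insert q F hq ih =>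
    obtain ⟨c, hc⟩ := ih fun p hp => hF p (Finset.mem_insert_of_mem hp)
    have hqim : 0 < q.im := hF q (Finset.mem_insert_self _ _)
    have hs := blaschkeSign_mul_self q
    have hs0 := blaschkeSign_ne_zero q
    refine ⟨blaschkeSign q * c, fun z hz hzim => ?_⟩
    rw [Finset.mem_insert, not_or] at hz
    have hzq : z - q ≠ 0 := sub_ne_zero.2 hz.1
    have hzq' := sub_conj_ne_zero hqim hzim
    have hqq := sub_conj_ne_zero hqim hqim.le
    have hinv : ∀ w : ℂ, w - q ≠ 0 → w - conj q ≠ 0 →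
        (blaschkeFactor q w)⁻¹ = blaschkeSign q * ((w - conj q) / (w - q)) := by
      intro w h1 h2
      rw [blaschkeFactor_eq, mul_inv, inv_div, ← eq_inv_of_mul_eq_one_left hs]
    rw [Finset.prod_insert hq, mul_inv, hc z hz.2 hzim, Finset.sum_insert hq,
      Finset.erase_insert hq, mul_inv, hc q hq hqim.le, hinv z hzq hzq', blaschkeFactorDeriv,
      inv_div]
    have hsum : ∑ p ∈ F, (blaschkeFactorDeriv p *
          ∏ r ∈ (insert q F).erase p, blaschkeFactor r p)⁻¹ * (z - p)⁻¹ =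
        ∑ p ∈ F, (blaschkeFactorDeriv p * ∏ r ∈ F.erase p, blaschkeFactor r p)⁻¹ *
          (blaschkeSign q * ((p - conj q) / (p - q)) * (z - p)⁻¹) := by
      refine Finset.sum_congr rfl fun p hp => ?_
      have hpq : p ≠ q := fun h => hq (h ▸ hp)
      rw [Finset.erase_insert_of_ne hpq.symm, Finset.prod_insert (by simp [hq]),
        mul_left_comm, mul_inv, hinv p (sub_ne_zero.2 hpq)
          (sub_conj_ne_zero hqim (hF p (Finset.mem_insert_of_mem hp)).le)]
      ring
    rw [hsum, mul_add, mul_add, Finset.mul_sum, add_mul, Finset.mul_sum, Finset.sum_mul]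
    -- Partial fractions of $\frac{z-\bar q}{(z-q)(z-p)}$: the new reciprocal factor multiplies the
    -- residue at `p` by its value there and contributes a residue at `q`.
    have hterm : ∀ p ∈ F, blaschkeSign q * ((z - conj q) / (z - q)) *
          ((blaschkeFactorDeriv p * ∏ r ∈ F.erase p, blaschkeFactor r p)⁻¹ * (z - p)⁻¹) =
        (q - conj q) / blaschkeSign q * ((blaschkeFactorDeriv p *
          ∏ r ∈ F.erase p, blaschkeFactor r p)⁻¹ * (q - p)⁻¹) * (z - q)⁻¹ +
        (blaschkeFactorDeriv p * ∏ r ∈ F.erase p, blaschkeFactor r p)⁻¹ *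
          (blaschkeSign q * ((p - conj q) / (p - q)) * (z - p)⁻¹) := by
      intro p hp
      have hpq : p - q ≠ 0 := sub_ne_zero.2 fun h => hq (h ▸ hp)
      have hqp : q - p ≠ 0 := sub_ne_zero.2 fun h => hq (h ▸ hp)
      have hzp : z - p ≠ 0 := sub_ne_zero.2 fun h => hz.2 (h ▸ hp)
      have hsinv : (q - conj q) / blaschkeSign q = blaschkeSign q * (q - conj q) := by
        rw [div_eq_iff hs0]
        linear_combination -(q - conj q) * hs
      rw [hsinv]
      generalize (blaschkeFactorDeriv p * ∏ r ∈ F.erase p, blaschkeFactor r p)⁻¹ = a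
      have hpq' : (p - q)⁻¹ = -(q - p)⁻¹ := by rw [← inv_neg, neg_sub]
      rw [div_eq_mul_inv (p - conj q), hpq']
      field_simp
      ring
    rw [Finset.sum_congr rfl hterm, Finset.sum_add_distrib]
    have hc' : blaschkeSign q * ((z - conj q) / (z - q)) * c =
        blaschkeSign q * c + (q - conj q) / blaschkeSign q * c * (z - q)⁻¹ := by
      have hsinv : (q - conj q) / blaschkeSign q = blaschkeSign q * (q - conj q) := by
        rw [div_eq_iff hs0]
        linear_combination -(q - conj q) * hs
      rw [hsinv]
      field_simp
      ring
    rw [hc']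
    ring

/-- The residue theorem for `g G / B` with `g, G ∈ H²` and a finite Blaschke product `B`. -/
theorem integral_boundary_mul_div_prod_blaschkeFactor {g G : ℂ → ℂ} {g₀ u : ℝ → ℂ}
    (hg : IsHardyTwo g) (hG : IsHardyTwo G) (hgb : HasBoundaryFun g g₀) (hGb : HasBoundaryFun G u)
    (F : Finset ℂ) (hF : ∀ p ∈ F, 0 < p.im) :
    ∫ x : ℝ, g₀ x * u x * (∏ q ∈ F, blaschkeFactor q x)⁻¹ =
      2 * Real.pi * I * ∑ p ∈ F, (blaschkeFactorDeriv p *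
        ∏ q ∈ F.erase p, blaschkeFactor q p)⁻¹ * (g p * G p) := by
  obtain ⟨c, hc⟩ := exists_inv_prod_blaschkeFactor_eq F hF
  have hint := integrable_mul_of_memLp_two (hg.memLp_boundary hgb) (hG.memLp_boundary hGb)
  have hF' : ∀ x : ℝ, (x : ℂ) ∉ F := fun x hx => by
    have := hF x hx
    simp at this
  have h1 : ∀ x : ℝ, g₀ x * u x * (∏ q ∈ F, blaschkeFactor q x)⁻¹ = c * (g₀ x * u x) +
      ∑ p ∈ F, (blaschkeFactorDeriv p * ∏ q ∈ F.erase p, blaschkeFactor q p)⁻¹ *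
        (g₀ x * u x / (x - p)) := fun x => by
    rw [hc x (hF' x) (by simp), mul_add, Finset.mul_sum]
    congr 1
    · ring
    · exact Finset.sum_congr rfl fun p _ => by ring
  have hi : ∀ p ∈ F, Integrable fun x : ℝ => g₀ x * u x / (x - p) := fun p hp => by
    simp_rw [div_eq_mul_inv]
    refine hint.mul_bdd (c := (p.im)⁻¹)
      (continuous_ofReal_sub_inv (hF p hp).ne').aestronglyMeasurable (ae_of_all _ fun x => ?_)
    rw [norm_inv]
    refine inv_anti₀ (hF p hp) ?_
    have := Complex.abs_im_le_norm ((x : ℂ) - p)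
    simp only [sub_im, ofReal_im, zero_sub, abs_neg] at this
    exact (le_abs_self _).trans this
  simp_rw [h1]
  rw [integral_add (hint.const_mul c) (integrable_finsetSum _ fun p hp => (hi p hp).const_mul _),
    integral_const_mul, integral_boundary_mul_eq_zero hg hG hgb hGb, mul_zero, zero_add,
    integral_finsetSum _ fun p hp => (hi p hp).const_mul _, Finset.mul_sum]
  refine Finset.sum_congr rfl fun p hp => ?_
  rw [integral_const_mul, integral_boundary_mul_div hg hG hgb hGb (hF p hp)]
  ring

/-! ### The scattering data on the real axis -/

namespace ScatteringData

variable {Λ : Set ℂ} {D : ScatteringData Λ}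

lemma Admissible.isOuterModulus (hD : D.Admissible) :
    IsOuterModulus fun t => Real.sqrt (1 - ‖D.s t‖ ^ 2) where
  integrable := by
    refine (hD.szego.const_mul (1 / 2)).congr ?_
    filter_upwards [hD.norm_lt_one] with t ht
    rw [Real.log_sqrt (by nlinarith [norm_nonneg (D.s t)])]
    ring
  pos := by
    filter_upwards [hD.norm_lt_one] with t ht
    exact Real.sqrt_pos.2 (by nlinarith [norm_nonneg (D.s t)])
  le_one := by
    refine ae_of_all _ fun t => Real.sqrt_le_one.2 ?_
    nlinarith [sq_nonneg ‖D.s t‖]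
  even := by
    filter_upwards [hD.symm_s] with t ht
    rw [ht, Complex.norm_conj]

lemma Admissible.hasBoundaryFun_outer (hD : D.Admissible) :
    HasBoundaryFun D.outer D.outerLine :=
  hD.isOuterModulus.hasBoundaryFun

lemma Admissible.differentiableOn_outer (hD : D.Admissible) :
    DifferentiableOn ℂ D.outer upperHalf :=
  hD.isOuterModulus.differentiableOn

lemma outer_ne_zero (z : ℂ) : D.outer z ≠ 0 := Complex.exp_ne_zero _

lemma Admissible.aestronglyMeasurable_transLine (hD : D.Admissible) :
    AEStronglyMeasurable D.transLine := by
  have h1 := (hD.hasBoundaryFun_outer.aestronglyMeasurable hD.differentiableOn_outer).aemeasurable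
  have h2 := hD.isBlaschkeSet.aestronglyMeasurable_blaschke.aemeasurable
  exact (h1.div h2).aestronglyMeasurable

/-- The pointwise relations on the real axis between the entries of the scattering matrix. -/
structure IsRegularAt (D : ScatteringData Λ) (x : ℝ) : Prop where
  ne_zero : x ≠ 0
  trans_mul_conj : D.transLine x * conj (D.transLine x) = 1 - D.s x * conj (D.s x)
  trans_ne_zero : D.transLine x ≠ 0
  trans_neg : D.transLine (-x) = conj (D.transLine x)
  s_neg : D.s (-x) = conj (D.s x)
  outerLine_eq : D.outerLine x = D.transLine x * blaschke Λ x

lemma ae_neg {P : ℝ → Prop} (h : ∀ᵐ x, P x) : ∀ᵐ x, P (-x) :=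
  (Measure.measurePreserving_neg (volume : Measure ℝ)).quasiMeasurePreserving.ae h

lemma Admissible.ae_isRegularAt (hD : D.Admissible) : ∀ᵐ x, D.IsRegularAt x := by
  have hΛ := hD.isBlaschkeSet
  have h0 : ∀ᵐ x : ℝ, x ≠ 0 := by
    simp [ae_iff]
  filter_upwards [h0, hD.norm_lt_one, hD.isOuterModulus.norm_boundaryValue,
    hD.isOuterModulus.boundaryValue_neg, hD.symm_s] with x hx0 hlt hw hneg hs
  have hB := hΛ.norm_blaschke_ofReal hx0
  have hB0 : blaschke Λ x ≠ 0 := fun h => by simp [h] at hB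
  have hE : ‖D.outerLine x‖ = Real.sqrt (1 - ‖D.s x‖ ^ 2) := hw
  have hpos : 0 < 1 - ‖D.s x‖ ^ 2 := by nlinarith [norm_nonneg (D.s x)]
  have hT : ‖D.transLine x‖ = Real.sqrt (1 - ‖D.s x‖ ^ 2) := by
    rw [transLine, norm_div, hB, div_one, hE]
  refine ⟨hx0, ?_, ?_, ?_, ?_, ?_⟩
  · rw [Complex.mul_conj, Complex.mul_conj, Complex.normSq_eq_norm_sq, Complex.normSq_eq_norm_sq,
      hT, Real.sq_sqrt hpos.le]
    push_cast
    rfl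
  · rw [← norm_ne_zero_iff, hT]
    exact (Real.sqrt_pos.2 hpos).ne'
  · rw [transLine, transLine, hΛ.blaschke_neg_ofReal hx0, map_div₀]
    congr 1
  · rw [hs, Complex.conj_conj]
  · rw [transLine, div_mul_cancel₀ _ hB0]

namespace IsRegularAt

variable {x : ℝ}

lemma conj_trans_ne_zero (h : D.IsRegularAt x) : conj (D.transLine x) ≠ 0 := by
  simpa using h.trans_ne_zero

lemma minus_s_neg (h : D.IsRegularAt x) :
    D.minus.s (-x) = -(conj (D.transLine x) / D.transLine x) * D.s x := by
  simp only [minus]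
  rw [h.trans_neg, h.s_neg, Complex.conj_conj, Complex.conj_conj]

lemma conj_minus_s (h : D.IsRegularAt x) : conj (D.minus.s x) = D.minus.s (-x) := by
  rw [h.minus_s_neg]
  simp [minus]

lemma norm_minus_s (h : D.IsRegularAt x) : ‖D.minus.s x‖ = ‖D.s x‖ := by
  simp only [minus]
  rw [norm_mul, norm_neg, norm_div, Complex.norm_conj, Complex.norm_conj,
    div_self (norm_ne_zero_iff.2 h.trans_ne_zero), one_mul]

/-- The first relation at $x$ and at $-x$ gives both $f^-(x)$ and $f^-(-x)$. Substitution into the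
right-hand side leaves $(1-|s_+|^2)f^+/\bar s$, which is $sf^+$ by $|s|^2+|s_+|^2=1$. -/
lemma line_minus_of_line_plus (h : D.IsRegularAt x) {fp fm : ℝ → ℂ}
    (h1 : D.transLine x * fm x = D.s x * fp x - fp (-x))
    (h2 : D.transLine (-x) * fm (-x) = D.s (-x) * fp (-x) - fp (- -x)) :
    D.transLine x * fp x = -fm (-x) + D.minus.s x * fm x := by
  have hT := h.trans_ne_zero
  have hT' := h.conj_trans_ne_zero
  rw [h.trans_neg, h.s_neg, neg_neg] at h2
  have h3 : fm x = (D.s x * fp x - fp (-x)) / D.transLine x := by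
    rw [← h1]
    field_simp
  have h4 : fm (-x) = (conj (D.s x) * fp (-x) - fp x) / conj (D.transLine x) := by
    rw [← h2]
    field_simp
  rw [h3, h4]
  simp only [minus]
  field_simp
  linear_combination fp x * h.trans_mul_conj

lemma line_plus_of_line_minus (h : D.IsRegularAt x) {fp fm : ℝ → ℂ}
    (h1 : D.transLine x * fp x = -fm (-x) + D.minus.s x * fm x)
    (h2 : D.transLine (-x) * fp (-x) = -fm (- -x) + D.minus.s (-x) * fm (-x)) :
    D.transLine x * fm x = D.s x * fp x - fp (-x) := by
  have hT := h.trans_ne_zero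
  have hT' := h.conj_trans_ne_zero
  rw [h.trans_neg, h.minus_s_neg, neg_neg] at h2
  simp only [minus] at h1
  have h3 : fp x = (-fm (-x) + -(D.transLine x / conj (D.transLine x)) * conj (D.s x) * fm x) /
      D.transLine x := by
    rw [← h1]
    field_simp
  have h4 : fp (-x) = (-fm x + -(conj (D.transLine x) / D.transLine x) * D.s x * fm (-x)) /
      conj (D.transLine x) := by
    rw [← h2]
    field_simp
  rw [h3, h4]
  field_simp
  linear_combination D.transLine x * fm x * h.trans_mul_conj

end IsRegularAt

lemma form_apply (f h : ℝ → ℂ) (x : ℝ) :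
    D.form f h x = conj (h x) * (f x - conj (D.s x) * f (-x)) +
      conj (h (-x)) * (f (-x) - D.s x * f x) := by
  simp [form, vec, weight, Matrix.mulVec, dotProduct, Fin.sum_univ_two]
  ring

/-- The form of a function and of a function whose dual is known. -/
lemma IsRegularAt.form_eq {x : ℝ} (hx : D.IsRegularAt x) {fp fm : ℝ → ℂ} (h : ℝ → ℂ)
    (h1 : D.transLine x * fm x = D.s x * fp x - fp (-x))
    (h2 : D.transLine (-x) * fm (-x) = D.s (-x) * fp (-x) - fp (- -x)) :
    D.form fp h x = -(conj (h (- -x)) * D.transLine (-x) * fm (-x)) -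
      conj (h (-x)) * D.transLine x * fm x := by
  rw [form_apply]
  rw [hx.s_neg, neg_neg] at h2
  rw [neg_neg]
  linear_combination (conj (h (-x))) * h1 + (conj (h x)) * h2

/-- `form_eq` writes the left density through $f^-$ and $sg^+$; eliminating $sg^+$ by the second
matrix relation leaves the density of the minus data. -/
lemma IsRegularAt.form_eq_form {x : ℝ} (hx : D.IsRegularAt x) {fp fm gp gm : ℝ → ℂ}
    (h1 : D.transLine x * fm x = D.s x * fp x - fp (-x))
    (h2 : D.transLine (-x) * fm (-x) = D.s (-x) * fp (-x) - fp (- -x))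
    (g1 : D.transLine x * gp x = -gm (-x) + D.minus.s x * gm x)
    (g2 : D.transLine (-x) * gp (-x) = -gm (- -x) + D.minus.s (-x) * gm (-x)) :
    D.form fp gp x = D.minus.form fm gm x := by
  rw [hx.form_eq gp h1 h2, form_apply, neg_neg]
  have g1' := congrArg conj g1
  have g2' := congrArg conj g2
  rw [hx.trans_neg, neg_neg] at g2'
  simp only [map_mul, map_add, map_neg, Complex.conj_conj] at g1' g2'
  rw [← hx.conj_minus_s, Complex.conj_conj] at g2'
  rw [hx.trans_neg]
  linear_combination -fm (-x) * g1' - fm x * g2'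

/-! ### The duality -/

lemma line_plus_iff {fp fm : ℝ → ℂ} {x : ℝ} :
    ![D.transLine x * fp x, D.transLine x * fm x] =
      !![D.transLine x, 0; D.s x, 1] *ᵥ ![fp x, -fp (-x)] ↔
    D.transLine x * fm x = D.s x * fp x - fp (-x) := by
  constructor
  · intro h
    have := congrFun h 1
    simpa [Matrix.mulVec, dotProduct, Fin.sum_univ_two, sub_eq_add_neg] using this
  · intro h
    funext i
    fin_cases i <;> simp [Matrix.mulVec, dotProduct, Fin.sum_univ_two, h, sub_eq_add_neg]

lemma line_minus_iff {fp fm : ℝ → ℂ} {x : ℝ} :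
    ![D.transLine x * fp x, D.transLine x * fm x] =
      !![1, D.minus.s x; 0, D.transLine x] *ᵥ ![-fm (-x), fm x] ↔
    D.transLine x * fp x = -fm (-x) + D.minus.s x * fm x := by
  constructor
  · intro h
    have := congrFun h 0
    simpa [Matrix.mulVec, dotProduct, Fin.sum_univ_two] using this
  · intro h
    funext i
    fin_cases i <;> simp [Matrix.mulVec, dotProduct, Fin.sum_univ_two, h]

lemma IsDualPair.ae_plus {fp fm : LineAndPoints Λ} (h : D.IsDualPair fp fm) :
    ∀ᵐ x, D.transLine x * fm.1 x = D.s x * fp.1 x - fp.1 (-x) :=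
  h.line_plus.mono fun _ hx => line_plus_iff.1 hx

lemma IsDualPair.ae_minus {fp fm : LineAndPoints Λ} (h : D.IsDualPair fp fm) :
    ∀ᵐ x, D.transLine x * fp.1 x = -fm.1 (-x) + D.minus.s x * fm.1 x :=
  h.line_minus.mono fun _ hx => line_minus_iff.1 hx

/-- The derivative at `p` of the reciprocal of the entry `s_e / B`. -/
lemma Admissible.recipDeriv_eq (hD : D.Admissible) (p : Λ) :
    D.recipDeriv p = blaschkeFactorDeriv p * blaschke (Λ \ {(p : ℂ)}) p / D.outer p := by
  have hΛ := hD.isBlaschkeSet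
  have hp := hΛ.mem_upperHalf p.2
  have hp' : 0 < (p : ℂ).im := hp
  set k : ℂ → ℂ := fun z => blaschkeSign p / (z - conj (p : ℂ)) *
    blaschke (Λ \ {(p : ℂ)}) z / D.outer z with hk
  have hkc : ContinuousAt k p := by
    refine ContinuousAt.div (ContinuousAt.mul ?_
      ((hΛ.mono sdiff_subset).continuousAt_blaschke hp)) ?_ (outer_ne_zero _)
    · exact ContinuousAt.div (by fun_prop) (by fun_prop) (sub_conj_ne_zero hp' hp'.le)
    · exact (hD.differentiableOn_outer.differentiableAt
        (isOpen_upperHalf.mem_nhds hp)).continuousAt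
  have h1 : HasDerivAt (fun z => 1 / D.trans z) (k p) p := by
    refine (hasDerivAt_sub_mul hkc).congr_of_eventuallyEq ?_
    filter_upwards [isOpen_upperHalf.mem_nhds hp] with z hz
    have hz' : 0 < z.im := hz
    rw [trans, one_div_div, hΛ.blaschke_eq_prod_mul (F := {(p : ℂ)}) (by simp) hz'.le
      (fun h => by simp [h] at hz'), Finset.prod_singleton, Finset.coe_singleton,
      blaschkeFactor_eq, hk]
    simp only
    ring
  exact h1.deriv

lemma Admissible.recipDeriv_ne_zero (hD : D.Admissible) (p : Λ) : D.recipDeriv p ≠ 0 := by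
  have hΛ := hD.isBlaschkeSet
  have hp : 0 < (p : ℂ).im := hΛ.mem_upperHalf p.2
  rw [hD.recipDeriv_eq]
  refine div_ne_zero (mul_ne_zero (blaschkeFactorDeriv_ne_zero hp) ?_) (outer_ne_zero _)
  exact (hΛ.mono sdiff_subset).blaschke_ne_zero hp.le (fun h => by simp [h] at hp) (by simp)

lemma Admissible.ofReal_ν_ne_zero (hD : D.Admissible) (p : Λ) : (D.ν p : ℂ) ≠ 0 := by
  exact_mod_cast (hD.pos_ν p).ne'

lemma Admissible.exists_isDualPair_left (hD : D.Admissible) (fp : LineAndPoints Λ) :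
    ∃ fm, D.IsDualPair fp fm := by
  set fm : LineAndPoints Λ := (fun x => (D.s x * fp.1 x - fp.1 (-x)) / D.transLine x,
    fun p => -I * D.recipDeriv p * (D.ν p : ℂ) * fp.2 p) with hfm
  have h1 : ∀ᵐ x, D.transLine x * fm.1 x = D.s x * fp.1 x - fp.1 (-x) :=
    hD.ae_isRegularAt.mono fun x hx => mul_div_cancel₀ _ hx.trans_ne_zero
  refine ⟨fm, h1.mono fun x hx => line_plus_iff.2 hx, ?_, fun p => rfl⟩
  filter_upwards [hD.ae_isRegularAt, h1, ae_neg h1] with x hx hx1 hx2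
  exact line_minus_iff.2 (hx.line_minus_of_line_plus hx1 hx2)

lemma Admissible.exists_isDualPair_right (hD : D.Admissible) (fm : LineAndPoints Λ) :
    ∃ fp, D.IsDualPair fp fm := by
  set fp : LineAndPoints Λ := (fun x => (-fm.1 (-x) + D.minus.s x * fm.1 x) / D.transLine x,
    fun p => fm.2 p / (-I * D.recipDeriv p * (D.ν p : ℂ))) with hfp
  have h1 : ∀ᵐ x, D.transLine x * fp.1 x = -fm.1 (-x) + D.minus.s x * fm.1 x :=
    hD.ae_isRegularAt.mono fun x hx => mul_div_cancel₀ _ hx.trans_ne_zero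
  refine ⟨fp, ?_, h1.mono fun x hx => line_minus_iff.2 hx, fun p => ?_⟩
  · filter_upwards [hD.ae_isRegularAt, h1, ae_neg h1] with x hx hx1 hx2
    exact line_plus_iff.2 (hx.line_plus_of_line_minus hx1 hx2)
  · refine (mul_div_cancel₀ _ (mul_ne_zero (mul_ne_zero (by simp) (hD.recipDeriv_ne_zero p))
      (hD.ofReal_ν_ne_zero p))).symm

lemma Admissible.ae_form_eq (hD : D.Admissible) {fp fm gp gm : LineAndPoints Λ}
    (hf : D.IsDualPair fp fm) (hg : D.IsDualPair gp gm) :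
    D.form fp.1 gp.1 =ᵐ[volume] D.minus.form fm.1 gm.1 := by
  filter_upwards [hD.ae_isRegularAt, hf.ae_plus, ae_neg hf.ae_plus, hg.ae_minus,
    ae_neg hg.ae_minus] with x hx h1 h2 g1 g2
  exact hx.form_eq_form h1 h2 g1 g2

lemma Admissible.innerProd_minus_eq (hD : D.Admissible) {fp fm gp gm : LineAndPoints Λ}
    (hf : D.IsDualPair fp fm) (hg : D.IsDualPair gp gm) :
    D.minus.innerProd fm gm = D.innerProd fp gp := by
  rw [innerProd, innerProd, integral_congr_ae (hD.ae_form_eq hf hg)]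
  congr 1
  -- The transition factor enters through its squared modulus $|(1/s)'|^2\nu_+^2$, which $\nu_-$
  -- turns back into $\nu_+$.
  refine tsum_congr fun p => ?_
  have h1 := hD.recipDeriv_ne_zero p
  have h2 := hD.ofReal_ν_ne_zero p
  have h3 : conj (D.recipDeriv p) ≠ 0 := by simpa using h1
  rw [hf.points, hg.points]
  simp only [minus]
  push_cast
  rw [← Complex.mul_conj']
  simp only [map_mul, map_neg, Complex.conj_I, Complex.conj_ofReal]
  field_simp
  rw [I_sq]
  ring

lemma aestronglyMeasurable_comp_neg {f : ℝ → ℂ} (hf : AEStronglyMeasurable f) :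
    AEStronglyMeasurable fun x => f (-x) :=
  hf.comp_measurePreserving (Measure.measurePreserving_neg volume)

lemma Admissible.aestronglyMeasurable_minus_s (hD : D.Admissible) :
    AEStronglyMeasurable D.minus.s := by
  have h1 := hD.aestronglyMeasurable_transLine
  have hc : ∀ {f : ℝ → ℂ}, AEStronglyMeasurable f → AEStronglyMeasurable fun x => conj (f x) :=
    fun hf => Complex.continuous_conj.comp_aestronglyMeasurable hf
  exact ((h1.aemeasurable.div (hc h1).aemeasurable).neg.mul
    (hc hD.measurable_s).aemeasurable).aestronglyMeasurable

lemma Admissible.memL2_iff (hD : D.Admissible) {fp fm : LineAndPoints Λ}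
    (hf : D.IsDualPair fp fm) : D.MemL2 fp ↔ D.minus.MemL2 fm := by
  have hpts : ∀ p, ‖fm.2 p‖ ^ 2 * D.minus.ν p = ‖fp.2 p‖ ^ 2 * D.ν p := fun p => by
    have h1 := norm_ne_zero_iff.2 (hD.recipDeriv_ne_zero p)
    have h2 := (hD.pos_ν p).ne'
    rw [hf.points]
    simp only [minus, norm_mul, norm_neg, norm_I, one_mul, Complex.norm_real,
      Real.norm_of_nonneg (hD.pos_ν p).le]
    field_simp
  have hform := hD.ae_form_eq hf hf
  have hT := hD.aestronglyMeasurable_transLine.aemeasurable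
  constructor
  · intro h
    refine ⟨?_, h.integrable.congr hform, h.summable.congr fun p => (hpts p).symm⟩
    have hm := aestronglyMeasurable_comp_neg h.measurable
    have hm' := (((hD.measurable_s.aemeasurable.mul h.measurable.aemeasurable).sub
      hm.aemeasurable).div hT).aestronglyMeasurable
    refine hm'.congr ?_
    filter_upwards [hD.ae_isRegularAt, hf.ae_plus] with x hx h1
    simp only [Pi.div_apply, Pi.sub_apply, Pi.mul_apply]
    rw [← h1, mul_div_cancel_left₀ _ hx.trans_ne_zero]
  · intro h
    refine ⟨?_, h.integrable.congr hform.symm, h.summable.congr hpts⟩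
    have hm := aestronglyMeasurable_comp_neg h.measurable
    have hm' := ((hm.aemeasurable.neg.add
      (hD.aestronglyMeasurable_minus_s.aemeasurable.mul h.measurable.aemeasurable)).div
      hT).aestronglyMeasurable
    refine hm'.congr ?_
    filter_upwards [hD.ae_isRegularAt, hf.ae_minus] with x hx h1
    simp only [Pi.div_apply, Pi.add_apply, Pi.mul_apply, Pi.neg_apply]
    rw [← h1, mul_div_cancel_left₀ _ hx.trans_ne_zero]

/-- $|s_-|=|s_+|$ a.e., and the outer function depends on the modulus only. -/
lemma Admissible.minus_outer (hD : D.Admissible) : D.minus.outer = D.outer := by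
  funext z
  rw [outer, outer, outerFun, outerFun]
  congr 2
  refine integral_congr_ae ?_
  filter_upwards [hD.ae_isRegularAt] with t ht
  rw [ht.norm_minus_s]

lemma Admissible.minus_outerLine (hD : D.Admissible) : D.minus.outerLine = D.outerLine := by
  funext x
  rw [outerLine, outerLine, hD.minus_outer]

end ScatteringData

/-! ### Reflection of functions of Hardy class -/

lemma neg_conj_line (x y : ℝ) : -conj (x + y * I : ℂ) = ((-x : ℝ) : ℂ) + y * I := by
  apply Complex.ext <;> simp

/-- A generator enters the pairing through $\overline{g(-x)}$, which is the boundary function of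
this reflection and hence again of class $H^2$. -/
lemma IsHardyTwo.reflect {G : ℂ → ℂ} (hG : IsHardyTwo G) :
    IsHardyTwo fun z => conj (G (-conj z)) := by
  obtain ⟨hd, C, hC, hb⟩ := hG
  refine ⟨fun z hz => ?_, C, hC, fun y hy => ?_⟩
  · have hz' : -conj z ∈ upperHalf := by
      have hz : 0 < z.im := hz
      simpa [upperHalf] using hz
    have h1 : DifferentiableAt ℂ (fun w => G (-w)) (conj z) := by
      have := hd.differentiableAt (isOpen_upperHalf.mem_nhds hz')
      exact DifferentiableAt.comp (conj z) this differentiableAt_id.neg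
    have h2 := h1.conj_conj
    rw [Complex.conj_conj] at h2
    exact h2.differentiableWithinAt
  · refine le_trans (le_of_eq ?_) (hb y hy)
    simp_rw [neg_conj_line]
    rw [lintegral_congr fun x => by rw [show ‖conj (G (((-x : ℝ) : ℂ) + y * I))‖ₑ =
      ‖G (((-x : ℝ) : ℂ) + y * I)‖ₑ by rw [← ofReal_norm, Complex.norm_conj, ofReal_norm]]]
    exact lintegral_neg_eq_self (fun x : ℝ => ‖G (x + y * I)‖ₑ ^ 2)

lemma HasBoundaryFun.reflect {G : ℂ → ℂ} {g : ℝ → ℂ} (h : HasBoundaryFun G g) :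
    HasBoundaryFun (fun z => conj (G (-conj z))) fun x => conj (g (-x)) := by
  filter_upwards [ScatteringData.ae_neg h] with x hx
  simp_rw [neg_conj_line]
  exact (Complex.continuous_conj.tendsto _).comp hx

lemma memLp_comp_neg {f : ℝ → ℂ} (hf : MemLp f 2) : MemLp (fun x => f (-x)) 2 :=
  hf.comp_measurePreserving (Measure.measurePreserving_neg volume)

namespace ScatteringData

variable {Λ : Set ℂ} {D : ScatteringData Λ}

/-! ### The weighted space in terms of dual pairs -/

/-- Completing the square in the matrix weight. On the diagonal the density becomes
$|sf^-|^2+|sf^+|^2$, so for the line part finite norm means that $sf^+$ and $sf^-$ lie in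
$L^2(\mathbb R)$, and the weighted space inherits its linear and metric properties from there. -/
lemma IsRegularAt.form_eq_add {x : ℝ} (hx : D.IsRegularAt x) {fp fm gp gm : ℝ → ℂ}
    (h1 : D.transLine x * fm x = D.s x * fp x - fp (-x))
    (g1 : D.transLine x * gm x = D.s x * gp x - gp (-x)) :
    D.form fp gp x = conj (D.transLine x * gm x) * (D.transLine x * fm x) +
      conj (D.transLine x * gp x) * (D.transLine x * fp x) := by
  rw [form_apply, h1, g1]
  simp only [map_sub, map_mul]
  linear_combination -fp x * conj (gp x) * hx.trans_mul_conj

lemma Admissible.ae_form_eq_add (hD : D.Admissible) {fp fm gp gm : LineAndPoints Λ}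
    (hf : D.IsDualPair fp fm) (hg : D.IsDualPair gp gm) :
    ∀ᵐ x, D.form fp.1 gp.1 x =
      conj (D.transLine x * gm.1 x) * (D.transLine x * fm.1 x) +
        conj (D.transLine x * gp.1 x) * (D.transLine x * fp.1 x) := by
  filter_upwards [hD.ae_isRegularAt, hf.ae_plus, hg.ae_plus] with x hx h1 h2
  exact hx.form_eq_add h1 h2

lemma Admissible.ae_form_self_eq (hD : D.Admissible) {fp fm : LineAndPoints Λ}
    (hf : D.IsDualPair fp fm) :
    ∀ᵐ x, D.form fp.1 fp.1 x = ((‖D.transLine x * fm.1 x‖ ^ 2 +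
      ‖D.transLine x * fp.1 x‖ ^ 2 : ℝ) : ℂ) := by
  filter_upwards [hD.ae_form_eq_add hf hf] with x hx
  rw [hx, Complex.conj_mul', Complex.conj_mul']
  push_cast
  rfl

lemma Admissible.memLp_of_memL2 (hD : D.Admissible) {fp fm : LineAndPoints Λ}
    (hf : D.IsDualPair fp fm) (h : D.MemL2 fp) :
    MemLp (fun x => D.transLine x * fm.1 x) 2 ∧ MemLp (fun x => D.transLine x * fp.1 x) 2 := by
  have hT := hD.aestronglyMeasurable_transLine
  have hm := hT.mul ((hD.memL2_iff hf).1 h).measurable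
  have hp := hT.mul h.measurable
  have hint : Integrable fun x => ‖D.transLine x * fm.1 x‖ ^ 2 + ‖D.transLine x * fp.1 x‖ ^ 2 := by
    exact (h.integrable.congr (hD.ae_form_self_eq hf)).re.congr
      (ae_of_all _ fun x => Complex.ofReal_re _)
  refine ⟨(memLp_two_iff_integrable_sq_norm hm).2 (hint.mono' (hm.norm.pow 2) ?_),
    (memLp_two_iff_integrable_sq_norm hp).2 (hint.mono' (hp.norm.pow 2) ?_)⟩ <;>
  · refine ae_of_all _ fun x => ?_
    rw [Real.norm_of_nonneg (by positivity)]
    simp [sq_nonneg]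

lemma Admissible.memL2_of_memLp (hD : D.Admissible) {fp fm : LineAndPoints Λ}
    (hf : D.IsDualPair fp fm) (hm : AEStronglyMeasurable fp.1)
    (h1 : MemLp (fun x => D.transLine x * fm.1 x) 2)
    (h2 : MemLp (fun x => D.transLine x * fp.1 x) 2)
    (hs : Summable fun p : Λ => ‖fp.2 p‖ ^ 2 * D.ν p) : D.MemL2 fp := by
  refine ⟨hm, ?_, hs⟩
  have h3 := ((memLp_two_iff_integrable_sq_norm h1.1).1 h1).add
    ((memLp_two_iff_integrable_sq_norm h2.1).1 h2)
  refine (h3.ofReal (𝕜 := ℂ)).congr ?_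
  filter_upwards [hD.ae_form_self_eq hf] with x hx
  rw [hx]
  rfl

lemma Admissible.integrable_form (hD : D.Admissible) {fp gp : LineAndPoints Λ}
    (hf : D.MemL2 fp) (hg : D.MemL2 gp) : Integrable (D.form fp.1 gp.1) := by
  obtain ⟨fm, hfm⟩ := hD.exists_isDualPair_left fp
  obtain ⟨gm, hgm⟩ := hD.exists_isDualPair_left gp
  obtain ⟨f1, f2⟩ := hD.memLp_of_memL2 hfm hf
  obtain ⟨g1, g2⟩ := hD.memLp_of_memL2 hgm hg
  have h := (integrable_mul_of_memLp_two g1.star f1).add (integrable_mul_of_memLp_two g2.star f2)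
  refine h.congr ?_
  filter_upwards [hD.ae_form_eq_add hfm hgm] with x hx
  rw [hx]
  rfl

/-- Expansion of $c^{-1}(c|a|-|b|)^2\ge0$; the free parameter `c` is what later lets a small error
in one factor beat a fixed norm in the other. -/
lemma norm_points_le (hν : ∀ p, 0 < D.ν p) (f g : LineAndPoints Λ) {c : ℝ} (hc : 0 < c) (p : Λ) :
    ‖f.2 p * conj (g.2 p) * (D.ν p : ℂ)‖ ≤
      c * (‖f.2 p‖ ^ 2 * D.ν p) + c⁻¹ * (‖g.2 p‖ ^ 2 * D.ν p) := by
  rw [norm_mul, norm_mul, Complex.norm_conj, Complex.norm_real, Real.norm_of_nonneg (hν p).le,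
    ← mul_assoc, ← mul_assoc, ← add_mul]
  refine mul_le_mul_of_nonneg_right ?_ (hν p).le
  have h1 : 0 ≤ c⁻¹ * (c * ‖f.2 p‖ - ‖g.2 p‖) ^ 2 := by positivity
  have h2 : c⁻¹ * (c * ‖f.2 p‖ - ‖g.2 p‖) ^ 2 =
      c * ‖f.2 p‖ ^ 2 + c⁻¹ * ‖g.2 p‖ ^ 2 - 2 * (‖f.2 p‖ * ‖g.2 p‖) := by
    field_simp
    ring
  have h3 : 0 ≤ ‖f.2 p‖ * ‖g.2 p‖ := by positivity
  linarith

lemma Admissible.summable_points (hD : D.Admissible) {f g : LineAndPoints Λ}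
    (hf : D.MemL2 f) (hg : D.MemL2 g) :
    Summable fun p : Λ => f.2 p * conj (g.2 p) * (D.ν p : ℂ) :=
  Summable.of_norm_bounded ((hf.summable.mul_left 1).add (hg.summable.mul_left 1⁻¹))
    fun p => norm_points_le hD.pos_ν f g one_pos p

lemma Admissible.innerProd_sub_right (hD : D.Admissible) {f g h : LineAndPoints Λ}
    (hf : D.MemL2 f) (hg : D.MemL2 g) (hh : D.MemL2 h) :
    D.innerProd f (g - h) = D.innerProd f g - D.innerProd f h := by
  rw [innerProd, innerProd, innerProd]
  have h1 : ∀ p, f.2 p * conj ((g - h).2 p) * (D.ν p : ℂ) =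
      f.2 p * conj (g.2 p) * (D.ν p : ℂ) - f.2 p * conj (h.2 p) * (D.ν p : ℂ) := fun p => by
    simp
    ring
  have h2 : ∀ x, D.form f.1 (g - h).1 x = D.form f.1 g.1 x - D.form f.1 h.1 x := fun x => by
    simp only [form_apply, Prod.fst_sub, Pi.sub_apply, map_sub]
    ring
  simp_rw [h1, h2]
  rw [(hD.summable_points hf hg).tsum_sub (hD.summable_points hf hh),
    integral_sub (hD.integrable_form hf hg) (hD.integrable_form hf hh)]
  ring

lemma Admissible.memL2_sub (hD : D.Admissible) {g h : LineAndPoints Λ}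
    (hg : D.MemL2 g) (hh : D.MemL2 h) : D.MemL2 (g - h) := by
  obtain ⟨gm, hgm⟩ := hD.exists_isDualPair_left g
  obtain ⟨hm, hhm⟩ := hD.exists_isDualPair_left h
  obtain ⟨dm, hdm⟩ := hD.exists_isDualPair_left (g - h)
  obtain ⟨g1, g2⟩ := hD.memLp_of_memL2 hgm hg
  obtain ⟨h1, h2⟩ := hD.memLp_of_memL2 hhm hh
  refine hD.memL2_of_memLp hdm (hg.measurable.sub hh.measurable) ?_ ?_ ?_
  · refine (g1.sub h1).ae_eq ?_
    filter_upwards [hgm.ae_plus, hhm.ae_plus, hdm.ae_plus] with x e1 e2 e3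
    rw [Pi.sub_apply, e1, e2, e3]
    simp only [Prod.fst_sub, Pi.sub_apply]
    ring
  · refine (g2.sub h2).ae_eq (ae_of_all _ fun x => ?_)
    simp only [Prod.fst_sub, Pi.sub_apply]
    ring
  · refine Summable.of_nonneg_of_le (fun p => mul_nonneg (sq_nonneg _) (hD.pos_ν p).le)
      (fun p => ?_) ((hg.summable.mul_left 2).add (hh.summable.mul_left 2))
    rw [← mul_assoc, ← mul_assoc, ← add_mul]
    refine mul_le_mul_of_nonneg_right ?_ (hD.pos_ν p).le
    have := norm_sub_le (g.2 p) (h.2 p)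
    simp only [Prod.snd_sub, Pi.sub_apply]
    nlinarith [norm_nonneg (g.2 p - h.2 p), sq_nonneg (‖g.2 p‖ - ‖h.2 p‖), norm_nonneg (g.2 p),
      norm_nonneg (h.2 p)]

lemma Admissible.normSq_eq (hD : D.Admissible) {fp fm : LineAndPoints Λ}
    (hf : D.IsDualPair fp fm) : D.normSq fp = ∑' p : Λ, ‖fp.2 p‖ ^ 2 * D.ν p +
      1 / (4 * Real.pi) * ∫ x, (‖D.transLine x * fm.1 x‖ ^ 2 + ‖D.transLine x * fp.1 x‖ ^ 2) := by
  rw [normSq, innerProd, integral_congr_ae (hD.ae_form_self_eq hf), integral_complex_ofReal]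
  have h1 : ∀ p : Λ, fp.2 p * conj (fp.2 p) * (D.ν p : ℂ) = ((‖fp.2 p‖ ^ 2 * D.ν p : ℝ) : ℂ) :=
    fun p => by
      rw [Complex.mul_conj']
      push_cast
      rfl
  simp_rw [h1]
  rw [← Complex.ofReal_tsum]
  norm_cast

/-- A form of the Cauchy–Schwarz inequality. -/
lemma Admissible.norm_innerProd_le (hD : D.Admissible) {fp gp : LineAndPoints Λ}
    (hf : D.MemL2 fp) (hg : D.MemL2 gp) {c : ℝ} (hc : 0 < c) :
    ‖D.innerProd fp gp‖ ≤ c * D.normSq fp + c⁻¹ * D.normSq gp := by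
  obtain ⟨fm, hfm⟩ := hD.exists_isDualPair_left fp
  obtain ⟨gm, hgm⟩ := hD.exists_isDualPair_left gp
  obtain ⟨f1, f2⟩ := hD.memLp_of_memL2 hfm hf
  obtain ⟨g1, g2⟩ := hD.memLp_of_memL2 hgm hg
  have hfi : Integrable fun x =>
      ‖D.transLine x * fm.1 x‖ ^ 2 + ‖D.transLine x * fp.1 x‖ ^ 2 :=
    ((memLp_two_iff_integrable_sq_norm f1.1).1 f1).add
      ((memLp_two_iff_integrable_sq_norm f2.1).1 f2)
  have hgi : Integrable fun x =>
      ‖D.transLine x * gm.1 x‖ ^ 2 + ‖D.transLine x * gp.1 x‖ ^ 2 :=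
    ((memLp_two_iff_integrable_sq_norm g1.1).1 g1).add
      ((memLp_two_iff_integrable_sq_norm g2.1).1 g2)
  rw [hD.normSq_eq hfm, hD.normSq_eq hgm, innerProd]
  have hsum := tsum_of_norm_bounded
    ((hf.summable.hasSum.mul_left c).add (hg.summable.hasSum.mul_left c⁻¹))
    fun p => norm_points_le hD.pos_ν fp gp hc p
  have hamgm : ∀ a b : ℂ, ‖conj b * a‖ ≤ c * ‖a‖ ^ 2 + c⁻¹ * ‖b‖ ^ 2 := by
    intro a b
    rw [norm_mul, Complex.norm_conj]
    have h1 : 0 ≤ c⁻¹ * (c * ‖a‖ - ‖b‖) ^ 2 := by positivity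
    have h2 : c⁻¹ * (c * ‖a‖ - ‖b‖) ^ 2 = c * ‖a‖ ^ 2 + c⁻¹ * ‖b‖ ^ 2 - 2 * (‖b‖ * ‖a‖) := by
      field_simp
      ring
    have h3 : 0 ≤ ‖b‖ * ‖a‖ := by positivity
    linarith
  have hint : ‖∫ x, D.form fp.1 gp.1 x‖ ≤
      c * (∫ x, (‖D.transLine x * fm.1 x‖ ^ 2 + ‖D.transLine x * fp.1 x‖ ^ 2)) +
      c⁻¹ * ∫ x, (‖D.transLine x * gm.1 x‖ ^ 2 + ‖D.transLine x * gp.1 x‖ ^ 2) := by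
    have := norm_integral_le_of_norm_le (f := D.form fp.1 gp.1)
      ((hfi.const_mul c).add (hgi.const_mul c⁻¹)) (by
        filter_upwards [hD.ae_form_eq_add hfm hgm] with x hx
        rw [hx]
        refine (norm_add_le _ _).trans ((add_le_add (hamgm _ _) (hamgm _ _)).trans_eq ?_)
        simp only [Pi.add_apply]
        ring)
    refine this.trans_eq ?_
    simp only [Pi.add_apply]
    rw [integral_add (hfi.const_mul c) (hgi.const_mul c⁻¹), integral_const_mul, integral_const_mul]
  refine (norm_add_le _ _).trans ?_
  rw [norm_mul]
  have hπ : ‖(1 / (4 * (Real.pi : ℂ)))‖ = 1 / (4 * Real.pi) := by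
    rw [norm_div, norm_mul, Complex.norm_real, Real.norm_of_nonneg Real.pi_pos.le]
    simp
  rw [hπ]
  refine (add_le_add hsum (mul_le_mul_of_nonneg_left hint (by positivity))).trans_eq ?_
  ring

/-- Approximating `h` by a generator with squared error below $c^2$ and using the scalar product
bound with parameter `c` gives at most $c(\|f\|^2+1)$; then $c\downarrow0$. -/
lemma Admissible.innerProd_eq_zero_of_memH2 (hD : D.Admissible) {f : LineAndPoints Λ}
    (hf : D.MemL2 f)
    (h0 : ∀ k, IsGenerator k → D.MemL2 k → D.innerProd f k = 0) {h : LineAndPoints Λ}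
    (hh : D.MemH2 h) : D.innerProd f h = 0 := by
  have hle : ∀ c : ℝ, 0 < c → ‖D.innerProd f h‖ ≤ c * (D.normSq f + 1) := by
    intro c hc
    obtain ⟨k, hk, hk2, hlt⟩ := hh.2 (c * c) (by positivity)
    have h1 := hD.innerProd_sub_right hf hh.1 hk2
    rw [h0 k hk hk2, sub_zero] at h1
    rw [← h1]
    refine (hD.norm_innerProd_le hf (hD.memL2_sub hh.1 hk2) hc).trans ?_
    have : c⁻¹ * D.normSq (h - k) ≤ c⁻¹ * (c * c) :=
      mul_le_mul_of_nonneg_left hlt.le (by positivity)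
    rw [inv_mul_cancel_left₀ hc.ne'] at this
    linarith
  have hlim : Tendsto (fun c : ℝ => c * (D.normSq f + 1)) (𝓝[>] 0) (𝓝 0) := by
    have : Continuous fun c : ℝ => c * (D.normSq f + 1) := by fun_prop
    have := this.tendsto 0
    rw [zero_mul] at this
    exact this.mono_left nhdsWithin_le_nhds
  refine norm_le_zero_iff.1 (ge_of_tendsto hlim ?_)
  filter_upwards [self_mem_nhdsWithin] with c hc
  exact hle c hc

end ScatteringData

namespace ScatteringData

variable {Λ : Set ℂ} {D : ScatteringData Λ}

/-! ### Pairing with the generators -/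

/-- The generator of `H²_{s,ν}` built from a function `G` with boundary function `g`. -/
noncomputable def generator (S : Set ℂ) (G : ℂ → ℂ) (g : ℝ → ℂ) : LineAndPoints Λ :=
  (fun x => blaschke S x * g x, fun p => blaschke S p * G p)

lemma isGenerator_generator {F : Set ℂ} (hFΛ : F ⊆ Λ) (hF : F.Finite) {G : ℂ → ℂ} {g : ℝ → ℂ}
    (h1 : IsHardyInfty G) (h2 : IsHardyTwo G) (h3 : HasBoundaryFun G g) :
    IsGenerator (generator (Λ := Λ) (Λ \ F) G g) :=
  ⟨F, G, g, hFΛ, hF, h1, h2, h3, ae_of_all _ fun _ => rfl, fun _ => rfl⟩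

lemma Admissible.ae_norm_blaschke_mul (hD : D.Admissible) (F : Set ℂ) (g : ℝ → ℂ) :
    ∀ᵐ x : ℝ, ‖blaschke (Λ \ F) x * g x‖ = ‖g x‖ := by
  have hΛ := hD.isBlaschkeSet.mono (sdiff_subset (t := F))
  filter_upwards [hD.ae_isRegularAt] with x hx
  rw [norm_mul, hΛ.norm_blaschke_ofReal hx.ne_zero, one_mul]

lemma Admissible.memLp_blaschke_mul (hD : D.Admissible) (F : Set ℂ) {g : ℝ → ℂ}
    (hg : MemLp g 2) : MemLp (fun x : ℝ => blaschke (Λ \ F) x * g x) 2 := by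
  have hΛ := hD.isBlaschkeSet.mono (sdiff_subset (t := F))
  exact hg.of_le (hΛ.aestronglyMeasurable_blaschke.mul hg.1)
    ((hD.ae_norm_blaschke_mul F g).mono fun x hx => hx.le)

/-- Functions in `L²(ℝ)` vanishing outside a finite subset of `Λ` belong to `L²_{s,ν}`. -/
lemma Admissible.memL2_of_memLp_two (hD : D.Admissible) {h : LineAndPoints Λ} (hh : MemLp h.1 2)
    {F : Finset Λ} (hF : ∀ p ∉ F, h.2 p = 0) : D.MemL2 h := by
  obtain ⟨hm, hhm⟩ := hD.exists_isDualPair_left h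
  have hT : ∀ᵐ x, ‖D.transLine x‖ ≤ 1 := by
    filter_upwards [hD.ae_isRegularAt] with x hx
    have h1 := hx.trans_mul_conj
    rw [Complex.mul_conj', Complex.mul_conj'] at h1
    have h2 : ‖D.transLine x‖ ^ 2 = 1 - ‖D.s x‖ ^ 2 := by exact_mod_cast h1
    nlinarith [sq_nonneg ‖D.s x‖, norm_nonneg (D.transLine x)]
  have hmul : ∀ {a : ℝ → ℂ}, AEStronglyMeasurable a → (∀ᵐ x, ‖a x‖ ≤ 1) →
      MemLp (fun x => a x * h.1 x) 2 := fun {a} ha hb =>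
    hh.of_le (ha.mul hh.1) (hb.mono fun x hx => by
      rw [norm_mul]
      exact mul_le_of_le_one_left (norm_nonneg _) hx)
  refine hD.memL2_of_memLp hhm hh.1 ?_ (hmul hD.aestronglyMeasurable_transLine hT) ?_
  · refine ((hmul hD.measurable_s (hD.norm_lt_one.mono fun x hx => hx.le)).sub
      (memLp_comp_neg hh)).ae_eq ?_
    filter_upwards [hhm.ae_plus] with x hx
    rw [Pi.sub_apply, hx]
  · exact summable_of_ne_finset_zero (s := F) fun p hp => by simp [hF p hp]

lemma _root_.IsBlaschkeSet.blaschke_sdiff_eq_zero (hΛ : IsBlaschkeSet Λ) {F : Finset Λ} {p : Λ}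
    (hp : p ∉ F) : blaschke (Λ \ (F.map (Function.Embedding.subtype _) : Finset ℂ)) p = 0 :=
  (hΛ.mono sdiff_subset).blaschke_eq_zero ⟨p.2, by simpa using hp⟩

lemma Admissible.memL2_generator (hD : D.Admissible) (F : Finset Λ) {G : ℂ → ℂ} {g : ℝ → ℂ}
    (hg : MemLp g 2) :
    D.MemL2 (generator (Λ \ (F.map (Function.Embedding.subtype _) : Finset ℂ)) G g) :=
  hD.memL2_of_memLp_two (hD.memLp_blaschke_mul _ hg) (F := F) fun p hp => by
    change blaschke _ _ * _ = 0
    rw [hD.isBlaschkeSet.blaschke_sdiff_eq_zero hp, zero_mul]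

/-- The density is $-k(x)-k(-x)$, so its integral is $-2\int k$ and $1/4\pi$ becomes $1/2\pi$. By
$\overline{B'(-x)}=B'(x)$ and $s=s_e/B$, only the finitely many Blaschke factors indexed by `F`
survive in the denominator. Nothing here assumes $s_ef^-\in H^2$, so the formula is available for
proving that. -/
lemma Admissible.innerProd_generator (hD : D.Admissible) {fp fm h : LineAndPoints Λ}
    (hf : D.IsDualPair fp fm) (hfp : D.MemL2 fp) (F : Finset Λ) {G₀ : ℂ → ℂ} {g : ℝ → ℂ}
    (hg : MemLp g 2)
    (h1 : ∀ᵐ x : ℝ, h.1 x =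
      blaschke (Λ \ (F.map (Function.Embedding.subtype _) : Finset ℂ)) x * g x)
    (h2 : ∀ p : Λ, h.2 p =
      blaschke (Λ \ (F.map (Function.Embedding.subtype _) : Finset ℂ)) p * G₀ p) :
    D.innerProd fp h = ∑ p ∈ F, fp.2 p * conj (h.2 p) * (D.ν p : ℂ) -
      1 / (2 * Real.pi) * ∫ x : ℝ, conj (g (-x)) * (D.outerLine x * fm.1 x) *
        (∏ q ∈ F.map (Function.Embedding.subtype _), blaschkeFactor q x)⁻¹ := by
  have hΛ := hD.isBlaschkeSet
  set F' : Finset ℂ := F.map (Function.Embedding.subtype _) with hF'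
  have hF'Λ : (F' : Set ℂ) ⊆ Λ := by simp [hF']
  have hsum : ∑' p : Λ, fp.2 p * conj (h.2 p) * (D.ν p : ℂ) =
      ∑ p ∈ F, fp.2 p * conj (h.2 p) * (D.ν p : ℂ) := by
    refine tsum_eq_sum fun p hp => ?_
    rw [h2, hΛ.blaschke_sdiff_eq_zero hp]
    simp
  have hhL : MemLp h.1 2 := (hD.memLp_blaschke_mul F' hg).ae_eq (by
    filter_upwards [h1] with x hx
    exact hx.symm)
  obtain ⟨f1, -⟩ := hD.memLp_of_memL2 hf hfp
  set k : ℝ → ℂ := fun x => conj (h.1 (-x)) * D.transLine x * fm.1 x with hk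
  have hki : Integrable k := by
    refine (integrable_mul_of_memLp_two (memLp_comp_neg hhL).star f1).congr
      (ae_of_all _ fun x => ?_)
    rw [hk]
    simp only
    rw [mul_assoc]
    rfl
  have hform : ∫ x, D.form fp.1 h.1 x = -2 * ∫ x, k x := by
    have h3 : D.form fp.1 h.1 =ᵐ[volume] fun x => -k (-x) - k x := by
      filter_upwards [hD.ae_isRegularAt, hf.ae_plus, ae_neg hf.ae_plus] with x hx e1 e2
      exact hx.form_eq h.1 e1 e2
    have hkn : Integrable fun x => -k (-x) := hki.comp_neg.neg
    rw [integral_congr_ae h3, integral_sub hkn hki, integral_neg,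
      integral_neg_eq_self k]
    ring
  have hk' : ∫ x, k x = ∫ x : ℝ, conj (g (-x)) * (D.outerLine x * fm.1 x) *
      (∏ q ∈ F', blaschkeFactor q x)⁻¹ := by
    refine integral_congr_ae ?_
    filter_upwards [hD.ae_isRegularAt, ae_neg h1] with x hx hx1
    have hprod : ∏ q ∈ F', blaschkeFactor q x ≠ 0 := by
      refine Finset.prod_ne_zero_iff.2 fun q hq => ?_
      have hq' := (hΛ.imaginary q (hF'Λ hq)).2
      exact blaschkeFactor_ne_zero hq' (by simp) fun h => by simp [← h] at hq'
    have hB := hΛ.blaschke_eq_prod_mul hF'Λ (z := x) (by simp) (by simpa using hx.ne_zero)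
    rw [hk]
    simp only
    rw [hx1, map_mul, (hΛ.mono sdiff_subset).blaschke_neg_ofReal hx.ne_zero, Complex.conj_conj,
      hx.outerLine_eq, hB]
    field_simp
  rw [innerProd, hsum, hform, hk']
  ring

/-- The discrete term at `p` carries the same coefficient as the residue at `p`:
$B_{\Lambda\setminus F}(p)$ cancels against the factor of $(1/s)'(p)$ in $f^-(p)$, because
$B_{\Lambda\setminus\{p\}}=B_{F\setminus\{p\}}B_{\Lambda\setminus F}$. This matching is the reason
for the constant in the definition of duality on `Λ`. -/
lemma Admissible.mul_ν_eq (hD : D.Admissible) {fp fm : LineAndPoints Λ} (hf : D.IsDualPair fp fm)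
    (F : Finset Λ) {p : Λ} (hp : p ∈ F) :
    fp.2 p * (D.ν p : ℂ) * blaschke (Λ \ (F.map (Function.Embedding.subtype _) : Finset ℂ)) p =
      I * (blaschkeFactorDeriv p * ∏ q ∈ (F.map (Function.Embedding.subtype _)).erase (p : ℂ),
        blaschkeFactor q p)⁻¹ * (D.outer p * fm.2 p) := by
  have hΛ := hD.isBlaschkeSet
  have hp' : 0 < (p : ℂ).im := (hΛ.imaginary p p.2).2
  set F' : Finset ℂ := F.map (Function.Embedding.subtype _) with hF'
  have hF'Λ : (F' : Set ℂ) ⊆ Λ := by simp [hF']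
  have hpF' : (p : ℂ) ∈ F' := by simpa [hF'] using hp
  have hB := (hΛ.mono (sdiff_subset (t := {(p : ℂ)}))).blaschke_eq_prod_mul
    (F := F'.erase p) (z := p) (by
      intro q hq
      rw [Finset.coe_erase] at hq
      exact ⟨hF'Λ hq.1, hq.2⟩) hp'.le (fun h => by simp [h] at hp')
  have hset : (Λ \ {(p : ℂ)}) \ ((F'.erase p : Finset ℂ) : Set ℂ) = Λ \ F' := by
    ext q
    simp only [Finset.coe_erase, Set.mem_sdiff, mem_singleton_iff, Finset.mem_coe, not_and, not_not]
    constructor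
    · rintro ⟨⟨h1, h2⟩, h3⟩
      exact ⟨h1, fun h4 => h2 (h3 h4)⟩
    · rintro ⟨h1, h2⟩
      exact ⟨⟨h1, fun h4 => h2 (h4 ▸ hpF')⟩, fun h4 => absurd h4 h2⟩
  rw [hset] at hB
  have hr := hD.recipDeriv_eq p
  rw [hB] at hr
  have hprod : ∏ q ∈ F'.erase (p : ℂ), blaschkeFactor q p ≠ 0 := by
    refine Finset.prod_ne_zero_iff.2 fun q hq => ?_
    rw [Finset.mem_erase] at hq
    exact blaschkeFactor_ne_zero (hΛ.imaginary q (hF'Λ hq.2)).2 hp'.le hq.1.symm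
  have hβ := blaschkeFactorDeriv_ne_zero hp'
  have hE : D.outer p ≠ 0 := outer_ne_zero _
  rw [hf.points, hr]
  field_simp
  rw [I_sq]
  ring

/-- The scalar product of a function with a generator, in terms of the dual function. -/
lemma Admissible.innerProd_generator_eq_sum (hD : D.Admissible) {fp fm h : LineAndPoints Λ}
    (hf : D.IsDualPair fp fm) (hfp : D.MemL2 fp) {G : ℂ → ℂ} (hG : IsHardyTwo G)
    (hGb : HasBoundaryFun G fun x => D.outerLine x * fm.1 x) (F : Finset Λ) {G₀ : ℂ → ℂ}
    {g : ℝ → ℂ} (hG₀ : IsHardyTwo G₀) (hg : HasBoundaryFun G₀ g)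
    (h1 : ∀ᵐ x : ℝ, h.1 x =
      blaschke (Λ \ (F.map (Function.Embedding.subtype _) : Finset ℂ)) x * g x)
    (h2 : ∀ p : Λ, h.2 p =
      blaschke (Λ \ (F.map (Function.Embedding.subtype _) : Finset ℂ)) p * G₀ p) :
    D.innerProd fp h = ∑ p ∈ F, I * (blaschkeFactorDeriv p *
      ∏ q ∈ (F.map (Function.Embedding.subtype _)).erase (p : ℂ), blaschkeFactor q p)⁻¹ *
        conj (G₀ p) * (D.outer p * fm.2 p - G p) := by
  have hΛ := hD.isBlaschkeSet
  rw [hD.innerProd_generator hf hfp F (hG₀.memLp_boundary hg) h1 h2,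
    integral_boundary_mul_div_prod_blaschkeFactor hG₀.reflect hG hg.reflect hGb _ (fun q hq => by
      obtain ⟨r, -, rfl⟩ := Finset.mem_map.1 hq
      exact (hΛ.imaginary r r.2).2), Finset.sum_map, Finset.mul_sum, Finset.mul_sum,
    ← Finset.sum_sub_distrib]
  refine Finset.sum_congr rfl fun p hp => ?_
  have hπ : (Real.pi : ℂ) ≠ 0 := by exact_mod_cast Real.pi_ne_zero
  have h3 := hD.mul_ν_eq hf F hp
  simp only [Function.Embedding.subtype_apply]
  rw [h2, map_mul, hΛ.conj_blaschke_self sdiff_subset p.2, hΛ.conj_eq_neg p.2, neg_neg]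
  generalize (blaschkeFactorDeriv p * ∏ q ∈ (F.map (Function.Embedding.subtype _)).erase (p : ℂ),
    blaschkeFactor q p)⁻¹ = a at h3 ⊢
  have h4 : 1 / (2 * Real.pi : ℂ) * (2 * Real.pi * I * (a * (conj (G₀ p) * G p))) =
      I * (a * (conj (G₀ p) * G p)) := by
    field_simp
  rw [h4]
  linear_combination conj (G₀ p) * h3

/-! ### The orthogonal complement -/

lemma exists_finset_map_eq {F : Set ℂ} (hFΛ : F ⊆ Λ) (hF : F.Finite) :
    ∃ F' : Finset Λ, ((F'.map (Function.Embedding.subtype _) : Finset ℂ) : Set ℂ) = F := by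
  classical
  refine ⟨hF.toFinset.subtype (· ∈ Λ), ?_⟩
  ext q
  simp only [Finset.coe_map, Function.Embedding.subtype_apply, mem_image, Finset.mem_coe,
    Finset.mem_subtype, Finite.mem_toFinset]
  constructor
  · rintro ⟨r, hr, rfl⟩
    exact hr
  · exact fun hq => ⟨⟨q, hFΛ hq⟩, hq, rfl⟩

lemma Admissible.memOrthH2_of_memHatH2 (hD : D.Admissible) {fp fm : LineAndPoints Λ}
    (hf : D.IsDualPair fp fm) (h : D.minus.MemHatH2 fm) : D.MemOrthH2 fp := by
  obtain ⟨hm, G, hG, hGb, hGp⟩ := h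
  rw [hD.minus_outerLine] at hGb
  have hfp := (hD.memL2_iff hf).2 hm
  refine ⟨hfp, fun h hh => hD.innerProd_eq_zero_of_memH2 hfp (fun k hk _ => ?_) hh⟩
  obtain ⟨F, G₀, g, hFΛ, hF, -, hG₀, hg, h1, h2⟩ := hk
  obtain ⟨F', rfl⟩ := exists_finset_map_eq hFΛ hF
  rw [hD.innerProd_generator_eq_sum hf hfp hG hGb F' hG₀ hg h1 h2]
  refine Finset.sum_eq_zero fun p _ => ?_
  rw [hGp, hD.minus_outer, mul_div_cancel₀ _ (outer_ne_zero _), sub_self, mul_zero]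

/-! ### Testing orthogonality with Cauchy kernels -/

lemma memH2_of_isGenerator {h : LineAndPoints Λ} (hh : IsGenerator h) (hm : D.MemL2 h) :
    D.MemH2 h := by
  refine ⟨hm, fun ε hε => ⟨h, hh, hm, ?_⟩⟩
  have h0 : ∀ x, D.form (0 : ℝ → ℂ) 0 x = 0 := fun x => by simp [form_apply]
  simpa [normSq, innerProd, h0] using hε

lemma hasBoundaryFun_inv_sub {q : ℂ} (hq : q.im < 0) :
    HasBoundaryFun (fun z => 1 / (z - q)) fun x => 1 / ((x : ℂ) - q) := by
  refine ae_of_all _ fun x => ?_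
  have hne : (x : ℂ) - q ≠ 0 := fun h => by
    have := congrArg Complex.im h
    simp at this
    exact hq.ne this
  have hc : ContinuousAt (fun y : ℝ => 1 / ((x + y * I : ℂ) - q)) 0 :=
    ContinuousAt.div (by fun_prop) (by fun_prop) (by simpa using hne)
  have := hc.tendsto
  simp only [ofReal_zero, zero_mul, add_zero] at this
  exact this.mono_left nhdsWithin_le_nhds

lemma isHardyInfty_inv_sub {q : ℂ} (hq : q.im < 0) : IsHardyInfty fun z => 1 / (z - q) := by
  refine ⟨(differentiableOn_const _).div (by fun_prop) fun z hz h0 => ?_, (-q.im)⁻¹,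
    fun z hz => ?_⟩
  · have h1 := congrArg Complex.im h0
    have hz : 0 < z.im := hz
    simp at h1
    linarith
  · have hz : 0 < z.im := hz
    rw [norm_div, norm_one, one_div]
    refine inv_anti₀ (by linarith) (le_trans ?_ ((le_abs_self _).trans
      (Complex.abs_im_le_norm _)))
    rw [sub_im]
    linarith

lemma isHardyTwo_inv_sub {q : ℂ} (hq : q.im < 0) : IsHardyTwo fun z => 1 / (z - q) :=
  (isHardyInfty_const 1).isHardyTwo_div_sub hq

lemma Admissible.memHatH2_of_memOrthH2 (hD : D.Admissible) {fp fm : LineAndPoints Λ}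
    (hf : D.IsDualPair fp fm) (h : D.MemOrthH2 fp) : D.minus.MemHatH2 fm := by
  obtain ⟨hfp, horth⟩ := h
  have hΛ := hD.isBlaschkeSet
  obtain ⟨f1, -⟩ := hD.memLp_of_memL2 hf hfp
  have hgen : ∀ (F : Finset Λ) {q : ℂ} (_ : q.im < 0), D.innerProd fp
      (generator (Λ \ (F.map (Function.Embedding.subtype _) : Finset ℂ)) (fun z => 1 / (z - q))
        fun x => 1 / ((x : ℂ) - q)) = 0 := by
    intro F q hq
    refine horth _ (memH2_of_isGenerator (isGenerator_generator (by simp)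
      (Finset.finite_toSet _) (isHardyInfty_inv_sub hq) (isHardyTwo_inv_sub hq)
      (hasBoundaryFun_inv_sub hq)) (hD.memL2_generator F ?_))
    exact (isHardyTwo_inv_sub hq).memLp_boundary (hasBoundaryFun_inv_sub hq)
  have hu : MemLp (fun x => D.outerLine x * fm.1 x) 2 := by
    refine ((hD.memLp_blaschke_mul ∅ f1)).ae_eq ?_
    filter_upwards [hD.ae_isRegularAt] with x hx
    rw [hx.outerLine_eq, sdiff_empty]
    ring
  obtain ⟨G, hG, hGb⟩ := exists_isHardyTwo_of_forall_integral_eq_zero hu fun q hq => by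
    -- With `F` empty there are neither point masses nor Blaschke denominators. The kernel is placed
    -- at $-\bar q$ because conjugation and $x\mapsto-x$ turn it into $-1/(x-q)$.
    have hq' : (-conj q).im < 0 := by simpa using hq
    have h1 := hgen ∅ hq'
    rw [hD.innerProd_generator hf hfp ∅ (G₀ := fun z => 1 / (z - -conj q))
      ((isHardyTwo_inv_sub hq').memLp_boundary (hasBoundaryFun_inv_sub hq'))
      (ae_of_all _ fun _ => rfl) fun _ => rfl] at h1
    have hπ : (Real.pi : ℂ) ≠ 0 := by exact_mod_cast Real.pi_ne_zero
    have h2 : ∫ x : ℝ, conj (1 / (((-x : ℝ) : ℂ) - -conj q)) * (D.outerLine x * fm.1 x) *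
        (∏ q ∈ (∅ : Finset Λ).map (Function.Embedding.subtype _), blaschkeFactor q x)⁻¹ = 0 := by
      simpa [hπ] using h1
    rw [← neg_eq_zero, ← integral_neg, ← h2]
    refine integral_congr_ae (ae_of_all _ fun x => ?_)
    have h3 : conj (1 / (((-x : ℝ) : ℂ) - -conj q)) = -((x : ℂ) - q)⁻¹ := by
      rw [map_div₀, map_one, map_sub, map_neg, Complex.conj_conj, Complex.conj_ofReal, one_div,
        ofReal_neg, ← inv_neg]
      congr 1
      ring
    simp only
    rw [h3]
    simp
    ring
  refine ⟨(hD.memL2_iff hf).1 hfp, G, hG, by rwa [hD.minus_outerLine], fun p => ?_⟩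
  have hp := (hΛ.imaginary p p.2).2
  have hI : (-I : ℂ).im < 0 := by simp
  -- With `F = {p}` the sum has the single term $s_e(p)f^-(p)-G(p)$ with nonzero coefficient; the
  -- kernel at $-i$ serves merely as a test function that does not vanish at `p`.
  have h1 := hgen {p} hI
  rw [hD.innerProd_generator_eq_sum hf hfp hG hGb {p} (isHardyTwo_inv_sub hI)
    (hasBoundaryFun_inv_sub hI) (ae_of_all _ fun _ => rfl) fun _ => rfl, Finset.sum_singleton] at h1
  have hne : (p : ℂ) - -I ≠ 0 := fun h0 => by
    have := congrArg Complex.im h0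
    simp at this
    linarith
  have h2 : D.outer p * fm.2 p - G p = 0 := by
    refine (mul_eq_zero.1 h1).resolve_left (mul_ne_zero (mul_ne_zero I_ne_zero ?_) ?_)
    · simpa using blaschkeFactorDeriv_ne_zero hp
    · rw [map_ne_zero]
      exact one_div_ne_zero hne
  rw [hD.minus_outer, eq_div_iff (outer_ne_zero _), mul_comm]
  exact sub_eq_zero.1 h2

end ScatteringData

theorem theorem1p1 {Λ : Set ℂ} (D : ScatteringData Λ) (hD : D.Admissible) :
    -- the duality is a unitary map from `L²_{s_+,ν_+}` onto `L²_{s_-,ν_-}`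
    ((∀ fp, D.MemL2 fp → ∃ fm, D.IsDualPair fp fm) ∧
      (∀ fm, D.minus.MemL2 fm → ∃ fp, D.IsDualPair fp fm) ∧
      (∀ fp fm, D.IsDualPair fp fm → (D.MemL2 fp ↔ D.minus.MemL2 fm)) ∧
      (∀ fp fm gp gm, D.MemL2 fp → D.MemL2 gp → D.IsDualPair fp fm → D.IsDualPair gp gm →
        D.minus.innerProd fm gm = D.innerProd fp gp)) ∧
    (∀ fp fm, D.MemOrthH2 fp → D.IsDualPair fp fm → D.minus.MemHatH2 fm) ∧
    {fp | ∃ fm, D.minus.MemHatH2 fm ∧ D.IsDualPair fp fm} = {fp | D.MemOrthH2 fp} := by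
  refine ⟨⟨fun fp _ => hD.exists_isDualPair_left fp, fun fm _ => hD.exists_isDualPair_right fm,
    fun _ _ h => hD.memL2_iff h, fun _ _ _ _ _ _ hf hg => hD.innerProd_minus_eq hf hg⟩,
    fun _ _ h hf => hD.memHatH2_of_memOrthH2 hf h, ?_⟩
  ext fp
  constructor
  · rintro ⟨fm, hm, hf⟩
    exact hD.memOrthH2_of_memHatH2 hf hm
  · intro h
    obtain ⟨fm, hf⟩ := hD.exists_isDualPair_left fp
    exact ⟨fm, hD.memHatH2_of_memOrthH2 hf h, hf⟩
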